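/- Let $X$ be a shelf, i.e. a set with an operation $(x,y)\mapsto x^y$ such that $(x^y)^z=(x^z)^{(y^z)}$, and let $k$ be a commutative ring (for instance $k=\mathbb Z$). Let $$B=B(X)=k\langle x,e_y : x,y\in X\rangle/\langle yx^y-xy,\ ye_{x^y}-e_xy\rangle,\qquad |x|=0,\ |e_x|=1,$$ with the super-derivation $d$ given by $d(x)=0$, $d(e_x)=1-x$, and the algebra map $\Delta:B\to B\otimes B$ given by $\Delta(x)=x\otimes x$, $\Delta(e_x)=e_x\otimes x+1\otimes e_x$, where $B\otimes B$ carries the product with Koszul signs. Let $\overline B=B/\langle xb-b : x\in X, b\in B\rangle$, with the induced grading, $d$ and $\Delta$. Let $\tau(u\otimes v)=(-1)^{|u||v|}v\otimes u$; for a graded module $C$ put $C^+=\bigoplus_{i\ge1}C_i$. All maps between tensor products follow the Koszul sign rule. A graded coalgebra $(C,\Delta)$ is *$+$-codendriform* if there are degree $0$ maps $\overleftarrow\Delta:C^+\to C^+\otimes C$ and $\overrightarrow\Delta:C^+\to C\otimes C^+$ with $(\overleftarrow\Delta\otimes\mathrm{Id})\overleftarrow\Delta=(\mathrm{Id}\otimes\Delta)\overleftarrow\Delta$,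 $(\mathrm{Id}\otimes\overrightarrow\Delta)\overrightarrow\Delta=(\Delta\otimes\mathrm{Id})\overrightarrow\Delta$, $(\mathrm{Id}\otimes\overleftarrow\Delta)\overrightarrow\Delta=(\overrightarrow\Delta\otimes\mathrm{Id})\overleftarrow\Delta$, with $\Delta=\overleftarrow\Delta+\overrightarrow\Delta$ on $C^+$, and with $\Delta$ coassociative on $C_0$. It is *d.g. $+$-codendriform* if moreover it has a differential $d$ of degree $-1$ such that $\overleftarrow\Delta d=(d\otimes\mathrm{Id}+\mathrm{Id}\otimes d)\overleftarrow\Delta$ and $\overrightarrow\Delta d=(d\otimes\mathrm{Id}+\mathrm{Id}\otimes d)\overrightarrow\Delta$ on $\bigoplus_{i\ge2}C_i$, and $\Delta d=(d\otimes\mathrm{Id})\overleftarrow\Delta+(\mathrm{Id}\otimes d)\overrightarrow\Delta$ on $C_1$. 1. The monomials $ae_{x_1}\cdots e_{x_n}$ ($n\ge0$, $a$ a product of elements of $X$) span $B$, and there are linear maps $\overleftarrow\Delta,\overrightarrow\Delta$ on $B^+$ and $h,\overline h:B\to B\otimes B$ with, for $n\ge1$ in the first, second and fourth formula, $$\overleftarrow\Delta(ae_{x_1}\cdots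 e_{x_n})=(ae_{x_1}\otimes ax_1)\Delta(e_{x_2}\cdots e_{x_n}),\qquad \overrightarrow\Delta(ae_{x_1}\cdots e_{x_n})=(a\otimes ae_{x_1})\Delta(e_{x_2}\cdots e_{x_n}),$$ $$h(ae_{x_1}\cdots e_{x_n})=\sum_{i=1}^n(-1)^{i-1}(a\otimes a)\,(\tau\Delta)(e_{x_1}\cdots e_{x_{i-1}})\,(e_{x_i}\otimes e_{x_i})\,\Delta(e_{x_{i+1}}\cdots e_{x_n}),$$ $$\overline h(a)=0,\qquad \overline h(ae_{x_1}\cdots e_{x_n})=-(ax_1\otimes ae_{x_1})\,h(e_{x_2}\cdots e_{x_n}).$$ With $\overleftarrow\Delta,\overrightarrow\Delta$, the graded coalgebra $(B,\Delta)$ is $+$-codendriform. 2. The maps $\overleftarrow\Delta,\overrightarrow\Delta,\overline h$ descend to $\overline B$, and make $(\overline B,d,\Delta,\overleftarrow\Delta,\overrightarrow\Delta)$ a d.g. $+$-codendriform coalgebra. 3. The induced map $\overline h:\overline B\to\overline B\otimes\overline B$ has degree $1$, is given by $\overline h(e_{x_1}\cdots e_{x_n})=-(1\otimes e_{x_1})h(e_{x_2}\cdots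 e_{x_n})$ (right-hand side computed in $B\otimes B$ and projected to $\overline B\otimes\overline B$), and on $\overline B^+$ $$(d\otimes\mathrm{Id}+\mathrm{Id}\otimes d)\,\overline h+\overline h\,d=\overrightarrow\Delta-\tau\overleftarrow\Delta .$$ 4. Let $C^n(X)=k^{X^n}$, and for $f\in C^n(X)$ let $\partial^*f=(-1)^nf\circ\partial$, where $$\partial(x_1\cdots x_n)=\sum_{i=1}^n(-1)^{i-1}\bigl(x_1\cdots\widehat{x_i}\cdots x_n-x_1^{x_i}\cdots x_{i-1}^{x_i}x_{i+1}\cdots x_n\bigr)$$ (the sign $(-1)^n$ does not affect cohomology). View $f\in C^n(X)$ as the functional on $\overline B$ with $f(e_{x_1}\cdots e_{x_n})=f(x_1,\dots,x_n)$ that vanishes in degrees other than $n$. On $\bigoplus_{n\ge1}C^n(X)$ put $f\prec g=\mu(f\otimes g)\overleftarrow\Delta$ and $f\succ g=\mu(f\otimes g)\overrightarrow\Delta$, where $\mu$ is the multiplication of $k$ and $(f\otimes g)(u\otimes v)=(-1)^{|g||u|}f(u)g(v)$. Then $f\prec g+f\succ g$ is the cup product $\mu(f\otimes g)\Delta$,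 and $(\bigoplus_{n\ge1}C^n(X),\partial^*,\prec,\succ)$ is a differential graded dendriform algebra: $(\partial^*)^2=0$; $\prec$ and $\succ$ have degree $0$; $\partial^*$ is a super-derivation for $\prec$ and for $\succ$; and for all $f,g,l$ $$(f\prec g)\prec l=f\prec(g\prec l+g\succ l),\quad (f\succ g)\prec l=f\succ(g\prec l),\quad (f\prec g+f\succ g)\succ l=f\succ(g\succ l).$$ It is Zinbiel up to the homotopy induced by $\overline h$: with $H(f,g)=(-1)^{|f|+|g|+1}\mu(f\otimes g)\overline h$, of degree $-1$, one has for homogeneous $f,g$ $$\partial^*H(f,g)+H(\partial^*f,g)+(-1)^{|f|}H(f,\partial^*g)=f\succ g-(-1)^{|f||g|}\,g\prec f .$$ 5. The operations $\prec,\succ$ induce well-defined degree $0$ operations on the rack cohomology $\bigoplus_{n\ge1}H^n_{\mathrm R}(X)$, which make it a (strictly) Zinbiel algebra: the three dendriform identities hold, and for homogeneous classes $u\succ v=(-1)^{|u||v|}v\prec u$, so that $$(u\prec v)\prec w=u\prec\bigl(v\prec w+(-1)^{|v||w|}w\prec v\bigr).$$ -/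

import Mathlib

/-!
Right self-distributive operations `x ◁ y = x ^ y` are encoded by Mathlib's `Shelf` (which is
written on the left): `x ^ y` is `Shelf.act y x`, and `Shelf.self_distrib` is
`(x ^ y) ^ z = (x ^ z) ^ (y ^ z)`.
-/

open scoped TensorProduct DirectSum

namespace RackZinbiel

noncomputable section

/-! ### Graded modules -/

section Graded

variable {k C : Type*} [CommRing k] [AddCommGroup C] [Module k C]

/-- The positive part `C⁺ = ⨁_{i ≥ 1} C_i` of a graded module. -/
def plus (𝒞 : ℕ → Submodule k C) : Submodule k C := ⨆ n : ℕ, 𝒞 (n + 1)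

/-- The degree `n` part `⨁_{i + j = n} C_i ⊗ C_j` of `C ⊗ C`. -/
def tensorDegree (𝒞 : ℕ → Submodule k C) (n : ℕ) : Submodule k (C ⊗[k] C) :=
  ⨆ p ∈ Finset.HasAntidiagonal.antidiagonal n,
    LinearMap.range (TensorProduct.map (𝒞 p.1).subtype (𝒞 p.2).subtype)

/-- The submodule `C⁺ ⊗ C` of `C ⊗ C`. -/
def plusTensor (𝒞 : ℕ → Submodule k C) : Submodule k (C ⊗[k] C) :=
  LinearMap.range (TensorProduct.map (plus 𝒞).subtype (LinearMap.id : C →ₗ[k] C))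

/-- The submodule `C ⊗ C⁺` of `C ⊗ C`. -/
def tensorPlus (𝒞 : ℕ → Submodule k C) : Submodule k (C ⊗[k] C) :=
  LinearMap.range (TensorProduct.map (LinearMap.id : C →ₗ[k] C) (plus 𝒞).subtype)

/-- The signed flip `u ⊗ v ↦ (-1)^{|u||v|} v ⊗ u` of a graded module. -/
def signedFlip (𝒞 : ℕ → Submodule k C) [DirectSum.Decomposition 𝒞] :
    C ⊗[k] C →ₗ[k] C ⊗[k] C :=
  let D := DirectSum.decomposeLinearEquiv 𝒞
  (TensorProduct.congr D D ≪≫ₗ TensorProduct.gradedComm k (fun i => 𝒞 i) (fun i => 𝒞 i) ≪≫ₗ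
    (TensorProduct.congr D D).symm).toLinearMap

/-- The sign operator `c ↦ (-1)^{|c|} c` of a graded module. -/
def signOp (𝒞 : ℕ → Submodule k C) [DirectSum.Decomposition 𝒞] : C →ₗ[k] C :=
  DirectSum.toModule k ℕ C (fun i => ((-1 : k) ^ i) • (𝒞 i).subtype) ∘ₗ
    (DirectSum.decomposeLinearEquiv 𝒞).toLinearMap

/-- `d ⊗ Id`. -/
def leftD (d : C →ₗ[k] C) : C ⊗[k] C →ₗ[k] C ⊗[k] C := TensorProduct.map d LinearMap.id

/-- `Id ⊗ d` for a map `d` of odd degree, with its Koszul sign: `u ⊗ v ↦ (-1)^{|u|} u ⊗ d v`. -/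
def rightD (𝒞 : ℕ → Submodule k C) [DirectSum.Decomposition 𝒞] (d : C →ₗ[k] C) :
    C ⊗[k] C →ₗ[k] C ⊗[k] C := TensorProduct.map (signOp 𝒞) d

/-- `(f ⊗ Id) g`, read in `C ⊗ (C ⊗ C)`. -/
def compLeft (f g : C →ₗ[k] C ⊗[k] C) : C →ₗ[k] C ⊗[k] (C ⊗[k] C) :=
  (TensorProduct.assoc k C C C).toLinearMap ∘ₗ TensorProduct.map f LinearMap.id ∘ₗ g

/-- `(Id ⊗ f) g`. -/
def compRight (f g : C →ₗ[k] C ⊗[k] C) : C →ₗ[k] C ⊗[k] (C ⊗[k] C) :=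
  TensorProduct.map LinearMap.id f ∘ₗ g

/-- `(C, Δ, L, R)` is a `+`-codendriform graded coalgebra. The maps `L : C⁺ → C⁺ ⊗ C` and
`R : C⁺ → C ⊗ C⁺` are extended by zero to `C₀`. -/
structure IsPlusCodendriform (𝒞 : ℕ → Submodule k C) [DirectSum.Decomposition 𝒞]
    (Δ L R : C →ₗ[k] C ⊗[k] C) : Prop where
  Δ_degree : ∀ n, ∀ c ∈ 𝒞 n, Δ c ∈ tensorDegree 𝒞 n
  L_zero : ∀ c ∈ 𝒞 0, L c = 0
  R_zero : ∀ c ∈ 𝒞 0, R c = 0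
  L_degree : ∀ n, ∀ c ∈ 𝒞 n, L c ∈ tensorDegree 𝒞 n
  R_degree : ∀ n, ∀ c ∈ 𝒞 n, R c ∈ tensorDegree 𝒞 n
  L_mem : ∀ c, L c ∈ plusTensor 𝒞
  R_mem : ∀ c, R c ∈ tensorPlus 𝒞
  dendri_left : compLeft L L = compRight Δ L
  dendri_right : compRight R R = compLeft Δ R
  dendri_mid : compRight L R = compLeft R L
  splitting : ∀ c ∈ plus 𝒞, Δ c = L c + R c
  coassoc_zero : ∀ c ∈ 𝒞 0, compLeft Δ Δ c = compRight Δ Δ c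

/-- `(C, Δ, L, R, d)` is a d.g. `+`-codendriform coalgebra. -/
structure IsDGPlusCodendriform (𝒞 : ℕ → Submodule k C) [DirectSum.Decomposition 𝒞]
    (d : C →ₗ[k] C) (Δ L R : C →ₗ[k] C ⊗[k] C) : Prop
    extends IsPlusCodendriform 𝒞 Δ L R where
  d_degree : ∀ n, ∀ c ∈ 𝒞 (n + 1), d c ∈ 𝒞 n
  d_zero : ∀ c ∈ 𝒞 0, d c = 0
  d_d : ∀ c, d (d c) = 0
  L_d : ∀ n, ∀ c ∈ 𝒞 (n + 2), L (d c) = leftD d (L c) + rightD 𝒞 d (L c)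
  R_d : ∀ n, ∀ c ∈ 𝒞 (n + 2), R (d c) = leftD d (R c) + rightD 𝒞 d (R c)
  Δ_d_one : ∀ c ∈ 𝒞 1, Δ (d c) = leftD d (L c) + rightD 𝒞 d (R c)

end Graded

/-! ### Dendriform and Zinbiel algebras -/

section Algebras

variable {k M : Type*} [CommRing k] [AddCommGroup M] [Module k M]

/-- Dendriform algebra: `l a b = a ≺ b`, `r a b = a ≻ b`. -/
structure IsDendriform (l r : M →ₗ[k] M →ₗ[k] M) : Prop where
  left : ∀ a b c, l (l a b) c = l a (l b c + r b c)
  mid : ∀ a b c, l (r a b) c = r a (l b c)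
  right : ∀ a b c, r (l a b + r a b) c = r a (r b c)

/-- The product `l` has degree `0`. -/
def IsGradedProduct (𝒜 : ℕ → Submodule k M) (l : M →ₗ[k] M →ₗ[k] M) : Prop :=
  ∀ p q, ∀ a ∈ 𝒜 p, ∀ b ∈ 𝒜 q, l a b ∈ 𝒜 (p + q)

/-- `δ` is a (super-)derivation for `l`. -/
def IsLeibniz (𝒜 : ℕ → Submodule k M) (δ : M →ₗ[k] M) (l : M →ₗ[k] M →ₗ[k] M) : Prop :=
  ∀ p, ∀ a ∈ 𝒜 p, ∀ b, δ (l a b) = l (δ a) b + (-1 : k) ^ p • l a (δ b)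

/-- Differential graded dendriform algebra, with differential of degree `+1`. -/
structure IsDGDendriform (𝒜 : ℕ → Submodule k M) (δ : M →ₗ[k] M)
    (l r : M →ₗ[k] M →ₗ[k] M) : Prop extends IsDendriform l r where
  δ_degree : ∀ p, ∀ a ∈ 𝒜 p, δ a ∈ 𝒜 (p + 1)
  δ_δ : ∀ a, δ (δ a) = 0
  l_degree : IsGradedProduct 𝒜 l
  r_degree : IsGradedProduct 𝒜 r
  l_δ : IsLeibniz 𝒜 δ l
  r_δ : IsLeibniz 𝒜 δ r

/-- `h`, of degree `-1`, is a homotopy between `≻` and the signed opposite of `≺`: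
`δ h(a, b) + h(δ a, b) + (-1)^{|a|} h(a, δ b) = a ≻ b - (-1)^{|a||b|} b ≺ a`. -/
structure IsZinbielHomotopy (𝒜 : ℕ → Submodule k M) (δ : M →ₗ[k] M)
    (l r h : M →ₗ[k] M →ₗ[k] M) : Prop where
  degree : ∀ p q, ∀ a ∈ 𝒜 p, ∀ b ∈ 𝒜 q, h a b ∈ 𝒜 (p + q - 1)
  homotopy : ∀ p q, ∀ a ∈ 𝒜 p, ∀ b ∈ 𝒜 q,
    δ (h a b) + h (δ a) b + (-1 : k) ^ p • h a (δ b) = r a b - (-1 : k) ^ (p * q) • l b a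

/-- (Super-)Zinbiel algebra: a graded dendriform algebra with `a ≻ b = (-1)^{|a||b|} b ≺ a`. -/
structure IsZinbiel (𝒜 : ℕ → Submodule k M) (l r : M →ₗ[k] M →ₗ[k] M) : Prop
    extends IsDendriform l r where
  l_degree : IsGradedProduct 𝒜 l
  r_degree : IsGradedProduct 𝒜 r
  comm : ∀ p q, ∀ a ∈ 𝒜 p, ∀ b ∈ 𝒜 q, r a b = (-1 : k) ^ (p * q) • l b a
  zinbiel : ∀ p q s, ∀ a ∈ 𝒜 p, ∀ b ∈ 𝒜 q, ∀ c ∈ 𝒜 s,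
    l (l a b) c = l a (l b c + (-1 : k) ^ (q * s) • l c b)

end Algebras

/-! ### The d.g. bialgebra `B(X)` -/

section Bialgebra

variable (k X : Type*) [CommRing k] [Shelf X]

/-- The generators: `Sum.inl x` is `x`, `Sum.inr x` is `e_x`. -/
abbrev Gen (X : Type*) : Type _ := X ⊕ X

/-- The relations `y x^y = x y` and `y e_{x^y} = e_x y`. -/
inductive Rel : FreeAlgebra k (Gen X) → FreeAlgebra k (Gen X) → Prop
  | xx (x y : X) : Rel
      (FreeAlgebra.ι k (Sum.inl y) * FreeAlgebra.ι k (Sum.inl (Shelf.act y x)))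
      (FreeAlgebra.ι k (Sum.inl x) * FreeAlgebra.ι k (Sum.inl y))
  | ex (x y : X) : Rel
      (FreeAlgebra.ι k (Sum.inl y) * FreeAlgebra.ι k (Sum.inr (Shelf.act y x)))
      (FreeAlgebra.ι k (Sum.inr x) * FreeAlgebra.ι k (Sum.inl y))

/-- The algebra `B(X, k)`. -/
def B : Type _ := RingQuot (Rel k X)

instance : Ring (B k X) := inferInstanceAs (Ring (RingQuot (Rel k X)))

instance : Algebra k (B k X) := inferInstanceAs (Algebra k (RingQuot (Rel k X)))

/-- The projection from the free algebra. -/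
def mkB : FreeAlgebra k (Gen X) →ₐ[k] B k X := RingQuot.mkAlgHom k (Rel k X)

variable {X}

/-- The class of a generator. -/
def gen (s : Gen X) : B k X := mkB k X (FreeAlgebra.ι k s)

/-- The generator `x`. -/
def gx (x : X) : B k X := gen k (Sum.inl x)

/-- The generator `e_x`. -/
def ge (x : X) : B k X := gen k (Sum.inr x)

variable {k}

theorem rel_xx (x y : X) : gx k y * gx k (Shelf.act y x) = gx k x * gx k y := by
  simp only [gx, gen, ← map_mul]
  exact RingQuot.mkAlgHom_rel k (Rel.xx x y)

theorem rel_ex (x y : X) : gx k y * ge k (Shelf.act y x) = ge k x * gx k y := by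
  simp only [gx, ge, gen, ← map_mul]
  exact RingQuot.mkAlgHom_rel k (Rel.ex x y)

/-- Universal property of `B(X)`: an algebra map is given by values on generators which satisfy
the relations. -/
def liftB {A : Type*} [Semiring A] [Algebra k A] (u v : X → A)
    (hu : ∀ x y, u y * u (Shelf.act y x) = u x * u y)
    (hv : ∀ x y, u y * v (Shelf.act y x) = v x * u y) : B k X →ₐ[k] A :=
  RingQuot.liftAlgHom k ⟨FreeAlgebra.lift k (Sum.elim u v), by
    intro a b h
    cases h with
    | xx x y => simpa using hu x y
    | ex x y => simpa using hv x y⟩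

@[simp] theorem liftB_gx {A : Type*} [Semiring A] [Algebra k A] (u v : X → A) (hu hv) (x : X) :
    liftB (k := k) u v hu hv (gx k x) = u x := by
  simp only [liftB, gx, gen]
  exact (RingQuot.liftAlgHom_mkAlgHom_apply k _ _ _).trans (by simp)

@[simp] theorem liftB_ge {A : Type*} [Semiring A] [Algebra k A] (u v : X → A) (hu hv) (x : X) :
    liftB (k := k) u v hu hv (ge k x) = v x := by
  simp only [liftB, ge, gen]
  exact (RingQuot.liftAlgHom_mkAlgHom_apply k _ _ _).trans (by simp)

theorem B_hom_ext {A : Type*} [Semiring A] [Algebra k A] {f g : B k X →ₐ[k] A}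
    (h0 : ∀ x, f (gx k x) = g (gx k x)) (h1 : ∀ x, f (ge k x) = g (ge k x)) : f = g := by
  apply RingQuot.ringQuot_ext'
  apply FreeAlgebra.hom_ext
  funext s
  cases s with
  | inl x => exact h0 x
  | inr x => exact h1 x

variable (k X)

/-- The grading `|x| = 0`, `|e_x| = 1`: `B_n` is spanned by the monomials in the generators with
exactly `n` letters of the form `e_x`. -/
def deg (n : ℕ) : Submodule k (B k X) :=
  Submodule.span k
    {b | ∃ l : List (Gen X), l.countP Sum.isRight = n ∧ b = (l.map (gen k)).prod}

variable {k X}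

theorem monomial_mem (l : List (Gen X)) :
    (l.map (gen k)).prod ∈ deg k X (l.countP Sum.isRight) :=
  Submodule.subset_span ⟨l, rfl, rfl⟩

theorem gx_mem (x : X) : gx k x ∈ deg k X 0 := by
  simpa [gx] using monomial_mem (k := k) [(Sum.inl x : Gen X)]

theorem ge_mem (x : X) : ge k x ∈ deg k X 1 := by
  simpa [ge] using monomial_mem (k := k) [(Sum.inr x : Gen X)]

instance deg_gradedMonoid : SetLike.GradedMonoid (deg k X) where
  one_mem := by simpa using monomial_mem (k := k) ([] : List (Gen X))
  mul_mem := by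
    intro i j a b ha hb
    have h := Submodule.mul_mem_mul ha hb
    rw [deg, deg, Submodule.span_mul_span] at h
    refine Submodule.span_mono ?_ h
    rintro _ ⟨_, ⟨l, hl, rfl⟩, _, ⟨m, hm, rfl⟩, rfl⟩
    exact ⟨l ++ m, by simp [List.countP_append, hl, hm], by simp⟩

/-- The algebra map `B → ⨁ B_n` that splits an element into its homogeneous components. -/
def splitB : B k X →ₐ[k] ⨁ n, deg k X n :=
  liftB (fun x => DirectSum.of (fun n => deg k X n) 0 ⟨gx k x, gx_mem x⟩)
    (fun x => DirectSum.of (fun n => deg k X n) 1 ⟨ge k x, ge_mem x⟩)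
    (by
      intro x y
      rw [DirectSum.of_mul_of, DirectSum.of_mul_of]
      exact DirectSum.of_eq_of_gradedMonoid_eq (Sigma.subtype_ext rfl (rel_xx x y)))
    (by
      intro x y
      rw [DirectSum.of_mul_of, DirectSum.of_mul_of]
      exact DirectSum.of_eq_of_gradedMonoid_eq (Sigma.subtype_ext rfl (rel_ex x y)))

theorem splitB_monomial (l : List (Gen X)) :
    splitB (l.map (gen k)).prod =
      DirectSum.of (fun n => deg k X n) (l.countP Sum.isRight) ⟨_, monomial_mem l⟩ := by
  have hcount : ∀ (x : X) (l : List (Gen X)),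
      1 + l.countP Sum.isRight = (Sum.inr x :: l).countP Sum.isRight := by
    intro x l
    rw [List.countP_cons_of_pos rfl, Nat.add_comm]
  induction l with
  | nil => simp only [List.map_nil, List.prod_nil, map_one]; rfl
  | cons s l ih =>
    simp only [List.map_cons, List.prod_cons, map_mul, ih]
    cases s with
    | inl x =>
      have h : splitB (gen k (Sum.inl x)) = _ := liftB_gx (k := k) _ _ _ _ x
      rw [h, DirectSum.of_mul_of]
      exact DirectSum.of_eq_of_gradedMonoid_eq (Sigma.subtype_ext (Nat.zero_add _) rfl)
    | inr x =>
      have h : splitB (gen k (Sum.inr x)) = _ := liftB_ge (k := k) _ _ _ _ x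
      rw [h, DirectSum.of_mul_of]
      exact DirectSum.of_eq_of_gradedMonoid_eq (Sigma.subtype_ext (hcount x l) rfl)

instance deg_gradedAlgebra : GradedAlgebra (deg k X) :=
  GradedAlgebra.ofAlgHom _ splitB
    (by
      apply B_hom_ext
      · intro x
        simp [splitB]
      · intro x
        simp [splitB])
    (by
      rintro i ⟨b, hb⟩
      dsimp only
      induction hb using Submodule.span_induction with
      | mem b h =>
        obtain ⟨l, rfl, rfl⟩ := h
        exact splitB_monomial l
      | zero => rw [map_zero]; exact (map_zero _).symm
      | add x y hx hy ihx ihy => rw [map_add, ihx, ihy, ← map_add]; rfl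
      | smul c x hx ih =>
        rw [map_smul, ih, ← DirectSum.lof_eq_of k, ← map_smul]; rfl)

variable (k X)

/-- The algebra `B ⊗ B`, whose product carries the Koszul sign. -/
abbrev BB : Type _ := GradedTensorProduct k (deg k X) (deg k X)

variable {k X}

/-- `a ⊗ b` in the algebra `B ⊗ B`. -/
abbrev tm (a b : B k X) : BB k X := GradedTensorProduct.tmul k a b

theorem tm_mul_tm {i j : ℕ} (a b c d : B k X) (hb : b ∈ deg k X i) (hc : c ∈ deg k X j) :
    tm a b * tm c d = (-1 : ℤˣ) ^ (i * j) • tm (a * c) (b * d) :=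
  GradedTensorProduct.tmul_coe_mul_coe_tmul (deg k X) (deg k X) a ⟨b, hb⟩ ⟨c, hc⟩ d

theorem tm_gx_mul (x : X) (a b c : B k X) :
    tm a (gx k x) * tm b c = tm (a * b) (gx k x * c) := by
  induction b using DirectSum.Decomposition.inductionOn (deg k X) with
  | zero =>
    have e : ∀ w : B k X, tm 0 w = 0 := by
      intro w
      change GradedTensorProduct.of k (deg k X) (deg k X) (0 ⊗ₜ[k] w) = 0
      rw [TensorProduct.zero_tmul, map_zero]
    rw [mul_zero, e, e, mul_zero]
  | homogeneous b => simpa using tm_mul_tm a _ _ c (gx_mem x) b.2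
  | add m n hm hn =>
    have e : ∀ u v w : B k X, tm (u + v) w = tm u w + tm v w := by
      intro u v w
      change GradedTensorProduct.of k (deg k X) (deg k X) ((u + v) ⊗ₜ[k] w) = _
      rw [TensorProduct.add_tmul, map_add]
    rw [e, mul_add, hm, hn, mul_add, e]

variable (k X)

/-- The comultiplication `Δ : B → B ⊗ B` as an algebra map:
`Δ(x) = x ⊗ x` and `Δ(e_x) = e_x ⊗ x + 1 ⊗ e_x`. -/
def comulHom : B k X →ₐ[k] BB k X :=
  liftB (fun x => tm (gx k x) (gx k x)) (fun x => tm (ge k x) (gx k x) + tm 1 (ge k x))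
    (by
      intro x y
      rw [tm_gx_mul, tm_gx_mul, rel_xx])
    (by
      intro x y
      rw [mul_add, add_mul, tm_gx_mul, tm_gx_mul, tm_gx_mul, rel_xx, rel_ex, mul_one,
        tm_mul_tm _ _ _ _ (ge_mem x) (gx_mem y)]
      simp)

/-- The comultiplication as a linear map to the tensor product. -/
def comul : B k X →ₗ[k] B k X ⊗[k] B k X :=
  (GradedTensorProduct.of k (deg k X) (deg k X)).symm.toLinearMap ∘ₗ (comulHom k X).toLinearMap

/-- The algebra map `b ↦ !![(-1)^{|b|} b, d b; 0, b]`; its being multiplicative says that `d` is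
a super-derivation. -/
def diffHom : B k X →ₐ[k] Matrix (Fin 2) (Fin 2) (B k X) :=
  liftB (fun x => !![gx k x, 0; 0, gx k x]) (fun x => !![-ge k x, 1 - gx k x; 0, ge k x])
    (by
      intro x y
      simp [rel_xx])
    (by
      intro x y
      simp [rel_ex, mul_sub, sub_mul, rel_xx, mul_neg])

/-- The differential of `B`: the super-derivation with `d x = 0` and `d e_x = 1 - x`. -/
def diff : B k X →ₗ[k] B k X :=
  Matrix.entryLinearMap k (B k X) (0 : Fin 2) (1 : Fin 2) ∘ₗ (diffHom k X).toLinearMap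

variable {k X}

@[simp] theorem diff_gx (x : X) : diff k X (gx k x) = 0 := by
  simp [diff, diffHom]

@[simp] theorem diff_ge (x : X) : diff k X (ge k x) = 1 - gx k x := by
  simp [diff, diffHom]

theorem diffHom_corner (b : B k X) :
    diffHom k X b 1 0 = 0 ∧ diffHom k X b 1 1 = b := by
  have key : ∀ l : List (Gen X), diffHom k X (l.map (gen k)).prod 1 0 = 0 ∧
      diffHom k X (l.map (gen k)).prod 1 1 = (l.map (gen k)).prod := by
    intro l
    induction l with
    | nil => simp
    | cons s l ih =>
      have h : diffHom k X (gen k s) 1 0 = 0 ∧ diffHom k X (gen k s) 1 1 = gen k s := by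
        cases s with
        | inl x => rw [show gen k (Sum.inl x) = gx k x from rfl]; simp [diffHom]
        | inr x => rw [show gen k (Sum.inr x) = ge k x from rfl]; simp [diffHom]
      simp [Matrix.mul_apply, Fin.sum_univ_two, ih, h]
  induction b using DirectSum.Decomposition.inductionOn (deg k X) with
  | zero => simp
  | homogeneous b =>
    obtain ⟨b, hb⟩ := b
    dsimp only
    induction hb using Submodule.span_induction with
    | mem b h => obtain ⟨l, -, rfl⟩ := h; exact key l
    | zero => simp
    | add x y _ _ hx hy => simp [hx, hy]
    | smul c x _ hx => simp [hx]
  | add m n hm hn => simp [hm, hn]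

theorem diffHom_sign {n : ℕ} {b : B k X} (hb : b ∈ deg k X n) :
    diffHom k X b 0 0 = (-1 : k) ^ n • b := by
  induction hb using Submodule.span_induction with
  | mem b h =>
    obtain ⟨l, rfl, rfl⟩ := h
    induction l with
    | nil => simp
    | cons s l ih =>
      cases s with
      | inl x =>
        have h : diffHom k X (gen k (Sum.inl x)) = _ := liftB_gx (k := k) _ _ _ _ x
        simp [Matrix.mul_apply, Fin.sum_univ_two, ih, h, (diffHom_corner _).1, gx]
      | inr x =>
        have h : diffHom k X (gen k (Sum.inr x)) = _ := liftB_ge (k := k) _ _ _ _ x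
        simp [Matrix.mul_apply, Fin.sum_univ_two, ih, h, (diffHom_corner _).1, ge, pow_succ, List.countP_cons, neg_mul]
  | zero => simp
  | add x y _ _ hx hy => simp [hx, hy]
  | smul c x _ hx => rw [map_smul, Matrix.smul_apply, hx, smul_comm]

theorem diff_mul {n : ℕ} {a : B k X} (ha : a ∈ deg k X n) (b : B k X) :
    diff k X (a * b) = diff k X a * b + (-1 : k) ^ n • (a * diff k X b) := by
  simp [diff, Matrix.mul_apply, Fin.sum_univ_two, diffHom_sign ha, (diffHom_corner b).2,
    add_comm]

variable (k)

/-- The product `x₁ ⋯ x_m` of generators of degree `0`. -/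
def gxs (xs : List X) : B k X := (xs.map (gx k)).prod

/-- The product `e_{x₁} ⋯ e_{x_n}`. -/
def ges (xs : List X) : B k X := (xs.map (ge k)).prod

variable {k}

/-- `L` is given on canonical monomials by
`L(a) = 0`, `L(a e_{x₁} ⋯ e_{x_n}) = (a e_{x₁} ⊗ a x₁) Δ(e_{x₂} ⋯ e_{x_n})`. -/
def IsLeftHalf (L : B k X →ₗ[k] B k X ⊗[k] B k X) : Prop :=
  (∀ as : List X, L (gxs k as) = 0) ∧
  ∀ (as : List X) (x : X) (xs : List X),
    GradedTensorProduct.of k (deg k X) (deg k X) (L (gxs k as * ges k (x :: xs))) =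
      tm (gxs k as * ge k x) (gxs k as * gx k x) * comulHom k X (ges k xs)

/-- `R` is given on canonical monomials by
`R(a) = 0`, `R(a e_{x₁} ⋯ e_{x_n}) = (a ⊗ a e_{x₁}) Δ(e_{x₂} ⋯ e_{x_n})`. -/
def IsRightHalf (R : B k X →ₗ[k] B k X ⊗[k] B k X) : Prop :=
  (∀ as : List X, R (gxs k as) = 0) ∧
  ∀ (as : List X) (x : X) (xs : List X),
    GradedTensorProduct.of k (deg k X) (deg k X) (R (gxs k as * ges k (x :: xs))) =
      tm (gxs k as) (gxs k as * ge k x) * comulHom k X (ges k xs)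

/-- `h` is given on canonical monomials by `h(a e_{x₁} ⋯ e_{x_n}) = ∑ᵢ (-1)^{i-1} (a ⊗ a)
(τΔ)(e_{x₁} ⋯ e_{x_{i-1}}) (e_{xᵢ} ⊗ e_{xᵢ}) Δ(e_{x_{i+1}} ⋯ e_{x_n})`; in particular
`h(a) = 0`. Here `τ` is `GradedTensorProduct.comm` and `i` is counted from `0`. -/
def IsHomotopyH (h : B k X →ₗ[k] B k X ⊗[k] B k X) : Prop :=
  ∀ (as xs : List X),
    GradedTensorProduct.of k (deg k X) (deg k X) (h (gxs k as * ges k xs)) =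
      ∑ i : Fin xs.length, (-1 : k) ^ (i : ℕ) •
        (tm (gxs k as) (gxs k as) *
          GradedTensorProduct.comm (deg k X) (deg k X) (comulHom k X (ges k (xs.take i))) *
          tm (ge k (xs.get i)) (ge k (xs.get i)) *
          comulHom k X (ges k (xs.drop (i + 1))))

/-- `hb` is given on canonical monomials by
`hb(a) = 0`, `hb(a e_{x₁} ⋯ e_{x_n}) = -(a x₁ ⊗ a e_{x₁}) h(e_{x₂} ⋯ e_{x_n})`. -/
def IsHomotopyBar (h hb : B k X →ₗ[k] B k X ⊗[k] B k X) : Prop :=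
  (∀ as : List X, hb (gxs k as) = 0) ∧
  ∀ (as : List X) (x : X) (xs : List X),
    GradedTensorProduct.of k (deg k X) (deg k X) (hb (gxs k as * ges k (x :: xs))) =
      -(tm (gxs k as * gx k x) (gxs k as * ge k x) *
        GradedTensorProduct.of k (deg k X) (deg k X) (h (ges k xs)))

/-! ### The quotient `B̄(X)` -/

variable (k X)

/-- The submodule spanned by the elements `x b - b`. -/
def barRel : Submodule k (B k X) :=
  Submodule.span k {c | ∃ (x : X) (b : B k X), c = gx k x * b - b}

/-- `B̄(X) = k ⊗_A B(X) = B(X) / ⟨x b - b⟩`. -/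
abbrev Bbar : Type _ := B k X ⧸ barRel k X

/-- The projection `B → B̄`. -/
def proj : B k X →ₗ[k] Bbar k X := (barRel k X).mkQ

/-- The projection `B ⊗ B → B̄ ⊗ B̄`. -/
def proj₂ : B k X ⊗[k] B k X →ₗ[k] Bbar k X ⊗[k] Bbar k X :=
  TensorProduct.map (proj k X) (proj k X)

variable {k X}

theorem proj_gx_mul (x : X) (b : B k X) : proj k X (gx k x * b) = proj k X b := by
  rw [← sub_eq_zero, ← map_sub]
  exact (Submodule.Quotient.mk_eq_zero _).2 (Submodule.subset_span ⟨x, b, rfl⟩)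

variable (k X)

/-- The induced grading of `B̄`. -/
def degBar (n : ℕ) : Submodule k (Bbar k X) := (deg k X n).map (proj k X)

/-- The restriction `B_n → B̄_n` of the projection. -/
def projDeg (n : ℕ) : deg k X n →ₗ[k] degBar k X n :=
  (proj k X).restrict (fun _ hb => Submodule.mem_map_of_mem hb)

/-- Splitting an element of `B` into its homogeneous components, projected to `B̄`. -/
def splitProj : B k X →ₗ[k] ⨁ n, degBar k X n :=
  DirectSum.lmap (projDeg k X) ∘ₗ (DirectSum.decomposeLinearEquiv (deg k X)).toLinearMap

theorem splitProj_of_mem {n : ℕ} {b : B k X} (hb : b ∈ deg k X n) :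
    splitProj k X b =
      DirectSum.lof k ℕ (fun n => degBar k X n) n (projDeg k X n ⟨b, hb⟩) := by
  change DirectSum.lmap (projDeg k X) (DirectSum.decompose (deg k X) b) = _
  rw [DirectSum.decompose_of_mem _ hb, ← DirectSum.lof_eq_of k, DirectSum.lmap_lof]

theorem splitProj_gx_mul (x : X) (b : B k X) :
    splitProj k X (gx k x * b) = splitProj k X b := by
  induction b using DirectSum.Decomposition.inductionOn (deg k X) with
  | zero => rw [mul_zero]
  | @homogeneous i b =>
    have hm : gx k x * (b : B k X) ∈ deg k X i := by
      simpa using SetLike.mul_mem_graded (gx_mem x) b.2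
    rw [splitProj_of_mem k X hm, splitProj_of_mem k X b.2]
    congr 1
    exact Subtype.ext (proj_gx_mul x _)
  | add m n hm hn => rw [mul_add, map_add, map_add, hm, hn]

variable {k X} in
/-- A linear map on `B` with `f (x b) = f b` descends to `B̄`. -/
def barLift {M : Type*} [AddCommGroup M] [Module k M] (f : B k X →ₗ[k] M)
    (hf : ∀ (x : X) (b : B k X), f (gx k x * b) = f b) : Bbar k X →ₗ[k] M :=
  (barRel k X).liftQ f (by
    refine Submodule.span_le.2 ?_
    rintro _ ⟨x, b, rfl⟩
    rw [SetLike.mem_coe, LinearMap.mem_ker, map_sub, hf, sub_self])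

variable {k X} in
@[simp] theorem barLift_proj {M : Type*} [AddCommGroup M] [Module k M] (f : B k X →ₗ[k] M)
    (hf : ∀ (x : X) (b : B k X), f (gx k x * b) = f b) (b : B k X) :
    barLift f hf (proj k X b) = f b := rfl

/-- Splitting an element of `B̄` into its homogeneous components. -/
def splitBbar : Bbar k X →ₗ[k] ⨁ n, degBar k X n :=
  barLift (M := ⨁ n, degBar k X n) (splitProj k X) (splitProj_gx_mul k X)

instance degBar_decomposition : DirectSum.Decomposition (degBar k X) :=
  DirectSum.Decomposition.ofLinearMap _ (splitBbar k X)
    (by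
      apply Submodule.linearMap_qext
      apply DirectSum.decompose_lhom_ext (deg k X)
      intro i
      ext1 ⟨b, hb⟩
      change DirectSum.coeLinearMap (degBar k X) (splitProj k X b) = proj k X b
      rw [splitProj_of_mem k X hb, DirectSum.coeLinearMap_lof]
      rfl)
    (by
      apply DirectSum.linearMap_ext
      intro i
      ext1 ⟨c, hc⟩
      obtain ⟨b, hb, rfl⟩ := hc
      rw [LinearMap.comp_apply, LinearMap.comp_apply, DirectSum.coeLinearMap_lof]
      exact splitProj_of_mem k X hb)

/-- The induced differential of `B̄`. -/
def diffBar : Bbar k X →ₗ[k] Bbar k X :=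
  barLift (proj k X ∘ₗ diff k X) (by
    intro x b
    simp [diff_mul (gx_mem x), proj_gx_mul])

theorem proj₂_gx_mul (x : X) (t : BB k X) :
    proj₂ k X ((GradedTensorProduct.of k (deg k X) (deg k X)).symm
      (tm (gx k x) (gx k x) * t)) =
    proj₂ k X ((GradedTensorProduct.of k (deg k X) (deg k X)).symm t) := by
  obtain ⟨t, rfl⟩ := (GradedTensorProduct.of k (deg k X) (deg k X)).surjective t
  induction t with
  | zero => simp
  | tmul a b =>
    have h := tm_gx_mul (k := k) x (gx k x) a b
    rw [h]
    simp [proj₂, proj_gx_mul]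
  | add s t hs ht => rw [map_add, mul_add, map_add, map_add, hs, ht, map_add, map_add]

/-- The induced comultiplication of `B̄`. -/
def comulBar : Bbar k X →ₗ[k] Bbar k X ⊗[k] Bbar k X :=
  barLift (proj₂ k X ∘ₗ comul k X) (by
    intro x b
    have h : comulHom k X (gx k x) = tm (gx k x) (gx k x) := liftB_gx (k := k) _ _ _ _ x
    change proj₂ k X ((GradedTensorProduct.of k (deg k X) (deg k X)).symm
      (comulHom k X (gx k x * b))) = _
    rw [map_mul, h, proj₂_gx_mul]
    rfl)

/-! ### The identification of `B̄` with words, and cochains -/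

/-- The right action of `B` on words: `x` acts on each letter and `e_x` appends the letter `x`. -/
def wordAction : B k X →ₐ[k] (Module.End k (List X →₀ k))ᵐᵒᵖ :=
  liftB (fun x => MulOpposite.op (Finsupp.lmapDomain k k (List.map (Shelf.act x))))
    (fun x => MulOpposite.op (Finsupp.lmapDomain k k (fun w => w ++ [x])))
    (by
      intro x y
      rw [← MulOpposite.op_mul, ← MulOpposite.op_mul]
      congr 1
      ext w : 2
      have e : Shelf.act (Shelf.act y x) ∘ Shelf.act y = Shelf.act y ∘ Shelf.act x := by
        funext z
        exact Shelf.self_distrib.symm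
      simp [Finsupp.mapDomain_single, e])
    (by
      intro x y
      rw [← MulOpposite.op_mul, ← MulOpposite.op_mul]
      congr 1
      ext w : 2
      simp [Finsupp.mapDomain_single])

/-- The result of acting on the empty word. -/
def toWordsB : B k X →ₗ[k] (List X →₀ k) :=
  LinearMap.applyₗ (Finsupp.single [] 1) ∘ₗ
    (MulOpposite.opLinearEquiv k).symm.toLinearMap ∘ₗ (wordAction k X).toLinearMap

/-- The isomorphism `B̄ → k⟨X⟩ = C_•(X)`, `e_{x₁} ⋯ e_{x_n} ↦ x₁ ⋯ x_n`. -/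
def toWords : Bbar k X →ₗ[k] (List X →₀ k) :=
  barLift (toWordsB k X) (by
    intro x b
    have h : wordAction k X (gx k x) = _ := liftB_gx (k := k) _ _ _ _ x
    simp [toWordsB, h, Finsupp.mapDomain_single])

variable {k X}

theorem toWords_ges (xs : List X) :
    toWords k X (proj k X (ges k xs)) = Finsupp.single xs 1 := by
  change toWordsB k X (ges k xs) = _
  induction xs using List.reverseRecOn with
  | nil => simp [toWordsB, ges]
  | append_singleton xs x ih =>
    have h : wordAction k X (ge k x) = _ := liftB_ge (k := k) _ _ _ _ x
    have h2 : ges k (xs ++ [x]) = ges k xs * ge k x := by simp [ges]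
    have h3 : toWordsB k X (ges k xs * ge k x) =
        MulOpposite.unop (wordAction k X (ge k x)) (toWordsB k X (ges k xs)) := by
      simp [toWordsB]
    rw [h2, h3, ih, h]
    simp [Finsupp.mapDomain_single]

variable (k X)

/-- `C^n(X) = k^{X^n}`. -/
abbrev Cochain (n : ℕ) : Type _ := (Fin n → X) → k

variable {X}

/-- `(x₁, …, x_n)` with `x_i` omitted. -/
def face₀ {n : ℕ} (i : Fin (n + 1)) (x : Fin (n + 1) → X) : Fin n → X :=
  fun j => x (i.succAbove j)

/-- `(x₁ ^ x_i, …, x_{i-1} ^ x_i, x_{i+1}, …, x_n)`. -/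
def face₁ {n : ℕ} (i : Fin (n + 1)) (x : Fin (n + 1) → X) : Fin n → X :=
  fun j => if i.succAbove j < i then Shelf.act (x i) (x (i.succAbove j))
    else x (i.succAbove j)

variable (X)

/-- The rack coboundary with its Koszul sign, `∂* f = (-1)^n f ∘ ∂` for `f ∈ C^n(X)`. -/
def coboundary (n : ℕ) : Cochain k X n →ₗ[k] Cochain k X (n + 1) where
  toFun f := fun x => (-1 : k) ^ n * ∑ i : Fin (n + 1),
    (-1 : k) ^ (i : ℕ) * (f (face₀ i x) - f (face₁ i x))
  map_add' f g := by
    funext x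
    simp only [Pi.add_apply, ← mul_add, ← Finset.sum_add_distrib]
    congr 1
    exact Finset.sum_congr rfl fun i _ => by ring
  map_smul' c f := by
    funext x
    simp only [Pi.smul_apply, smul_eq_mul, RingHom.id_apply, Finset.mul_sum]
    exact Finset.sum_congr rfl fun i _ => by ring

/-- A cochain of degree `n` as a functional on `B̄`: it sends `e_{x₁} ⋯ e_{x_n}` to
`f(x₁, …, x_n)` and vanishes in the other degrees. -/
def functional (n : ℕ) : Cochain k X n →ₗ[k] Module.Dual k (Bbar k X) where
  toFun f := Finsupp.linearCombination k
    (fun w : List X => if h : w.length = n then f (fun i => w.get (i.cast h.symm)) else 0) ∘ₗ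
      toWords k X
  map_add' f g := by
    ext b
    simp only [LinearMap.comp_apply, LinearMap.add_apply, Finsupp.linearCombination_apply,
      Finsupp.sum, ← Finset.sum_add_distrib]
    refine Finset.sum_congr rfl fun w _ => ?_
    split_ifs <;> simp [mul_add]
  map_smul' c f := by
    ext b
    simp only [LinearMap.comp_apply, LinearMap.smul_apply, Finsupp.linearCombination_apply,
      Finsupp.sum, Finset.smul_sum, RingHom.id_apply]
    refine Finset.sum_congr rfl fun w _ => ?_
    split_ifs <;> simp [mul_left_comm]

/-- The functional `u ⊗ v ↦ f(u) g(v)` on `B̄ ⊗ B̄` (without sign). -/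
def pairing (p q : ℕ) :
    Cochain k X p →ₗ[k] Cochain k X q →ₗ[k] Module.Dual k (Bbar k X ⊗[k] Bbar k X) :=
  ((TensorProduct.mk k _ _).compl₁₂ (functional k X p) (functional k X q)).compr₂
    (TensorProduct.dualDistrib k (Bbar k X) (Bbar k X))

/-- The transpose of `φ : B̄ → B̄ ⊗ B̄`, restricted to `B̄_n`. -/
def transpose (φ : Bbar k X →ₗ[k] Bbar k X ⊗[k] Bbar k X) (n : ℕ) :
    Module.Dual k (Bbar k X ⊗[k] Bbar k X) →ₗ[k] Cochain k X n :=
  LinearMap.pi fun x => LinearMap.applyₗ (φ (proj k X (ges k (List.ofFn x))))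

/-- The product of cochains `μ (f ⊗ g) φ` dual to `φ : B̄ → B̄ ⊗ B̄` of degree `0`; the sign
`(-1)^{pq}` is the Koszul sign of `(f ⊗ g)(u ⊗ v) = (-1)^{|g||u|} f(u) g(v)`. -/
def dualProduct (φ : Bbar k X →ₗ[k] Bbar k X ⊗[k] Bbar k X) (p q : ℕ) :
    Cochain k X p →ₗ[k] Cochain k X q →ₗ[k] Cochain k X (p + q) :=
  ((-1 : k) ^ (p * q)) • (pairing k X p q).compr₂ (transpose k X φ (p + q))

/-- The cochain homotopy `(-1)^{p+q+1} μ (f ⊗ g) η` dual to `η : B̄ → B̄ ⊗ B̄` of degree `1`, on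
cochains of degrees `p + 1` and `q + 1`; including the Koszul sign `(-1)^{(p+1)(q+1)}` of
`f ⊗ g`, the total sign is `(-1)^{pq}`. -/
def dualHomotopy (η : Bbar k X →ₗ[k] Bbar k X ⊗[k] Bbar k X) (p q : ℕ) :
    Cochain k X (p + 1) →ₗ[k] Cochain k X (q + 1) →ₗ[k] Cochain k X (p + q + 1) :=
  ((-1 : k) ^ (p * q)) • (pairing k X (p + 1) (q + 1)).compr₂ (transpose k X η (p + q + 1))

/-- `⨁_{n ≥ 1} C^n(X)`; the summand with index `n` is `C^{n+1}(X)`. -/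
abbrev PosCochains : Type _ := ⨁ n : ℕ, Cochain k X (n + 1)

/-- `∂*` on `⨁_{n ≥ 1} C^n(X)`. -/
def posCoboundary : PosCochains k X →ₗ[k] PosCochains k X :=
  DirectSum.toModule k ℕ _ fun n =>
    DirectSum.lof k ℕ (fun n => Cochain k X (n + 1)) (n + 1) ∘ₗ coboundary k X (n + 1)

variable {k X} in
/-- The degree `n` part of `⨁_{n ≥ 1} M^n`, where `M^{n+1}` is the summand with index `n`. -/
def posDegree (M : ℕ → Type*) [∀ n, AddCommGroup (M n)] [∀ n, Module k (M n)] :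
    ℕ → Submodule k (⨁ n, M n)
  | 0 => ⊥
  | n + 1 => LinearMap.range (DirectSum.lof k ℕ M n)

/-- The bilinear map on `⨁_{n ≥ 1} C^n(X)` with the given components. -/
def assemble (m : ℕ → ℕ → ℕ)
    (F : ∀ p q, Cochain k X (p + 1) →ₗ[k] Cochain k X (q + 1) →ₗ[k] Cochain k X (m p q + 1)) :
    PosCochains k X →ₗ[k] PosCochains k X →ₗ[k] PosCochains k X :=
  DirectSum.toModule k ℕ _ fun p => LinearMap.flip <|
    DirectSum.toModule k ℕ _ fun q => LinearMap.flip <|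
      (F p q).compr₂ (DirectSum.lof k ℕ (fun n => Cochain k X (n + 1)) (m p q))

/-- The product on `⨁_{n ≥ 1} C^n(X)` dual to `φ`. -/
def posProduct (φ : Bbar k X →ₗ[k] Bbar k X ⊗[k] Bbar k X) :
    PosCochains k X →ₗ[k] PosCochains k X →ₗ[k] PosCochains k X :=
  assemble k X (fun p q => p + 1 + q) fun p q => dualProduct k X φ (p + 1) (q + 1)

/-- The homotopy on `⨁_{n ≥ 1} C^n(X)` dual to `η`. -/
def posHomotopy (η : Bbar k X →ₗ[k] Bbar k X ⊗[k] Bbar k X) :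
    PosCochains k X →ₗ[k] PosCochains k X →ₗ[k] PosCochains k X :=
  assemble k X (fun p q => p + q) fun p q => dualHomotopy k X η p q

/-- The cocycles in `C^n(X)`. -/
def cocycles (n : ℕ) : Submodule k (Cochain k X n) := LinearMap.ker (coboundary k X n)

/-- Rack cohomology `H^{n+1}_R(X)`. -/
abbrev Cohomology (n : ℕ) : Type _ :=
  cocycles k X (n + 1) ⧸ (LinearMap.range (coboundary k X n)).submoduleOf (cocycles k X (n + 1))

/-- Rack cohomology `⨁_{n ≥ 1} H^n_R(X)` in positive degree. -/
abbrev PosCohomology : Type _ := ⨁ n : ℕ, Cohomology k X n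

variable {k X}

/-- The class of a cocycle of degree `n + 1` in `⨁_{n ≥ 1} H^n_R(X)`. -/
def cls {n : ℕ} (f : Cochain k X (n + 1)) (hf : f ∈ cocycles k X (n + 1)) :
    PosCohomology k X :=
  DirectSum.lof k ℕ (fun n => Cohomology k X n) n (Submodule.Quotient.mk ⟨f, hf⟩)

/-- The product `z` on cohomology is induced by the product of cochains dual to `φ`. -/
def IsInducedProduct (φ : Bbar k X →ₗ[k] Bbar k X ⊗[k] Bbar k X)
    (z : PosCohomology k X →ₗ[k] PosCohomology k X →ₗ[k] PosCohomology k X) : Prop :=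
  ∀ (p q : ℕ) (f : Cochain k X (p + 1)) (g : Cochain k X (q + 1))
    (hf : f ∈ cocycles k X (p + 1)) (hg : g ∈ cocycles k X (q + 1)),
    ∃ hfg : dualProduct k X φ (p + 1) (q + 1) f g ∈ cocycles k X (p + 1 + q + 1),
      z (cls f hf) (cls g hg) = cls (dualProduct k X φ (p + 1) (q + 1) f g) hfg

end Bialgebra

end

end RackZinbiel

open RackZinbiel

/-!
The algebra `B` acts on `B ⊗ B` by left multiplication, and all the maps of the theorem obey
recursions in a generator on the left: multiplication by `x ∈ X` becomes multiplication by
`x ⊗ x`, while `Δ(e_x b) = (e_x ⊗ x + 1 ⊗ e_x) Δ(b)`, the two halves of `Δ` keep one of the two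
summands each, `h(e_x b) = (e_x ⊗ e_x) Δ(b) - (x ⊗ e_x + e_x ⊗ 1) h(b)` and
`h̄(e_x b) = -(x ⊗ e_x) h(b)`. The maps therefore exist because these formulas define one
representation `fiveRep` of `B` on `(B ⊗ B)⁵`: only compatibility with the two families of relations
has to be checked, and it holds because each of the multipliers commutes with `x ⊗ x` in the way
that the relations require. Linear maps on `B` that satisfy the same recursion and agree at `1`
are equal (`linearMap_ext_generators`), and every identity on `B` is proved in this way. At `e_x b`
the three codendriform identities amount to coassociativity of `Δ` at `b`.

The Zinbiel homotopy comes from the identity `D h + h d = Δ - τ Δ` on all of `B`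
(`tensorDiff_homotopyH`), where `D = d ⊗ Id + Id ⊗ d`. Multiply it by `x ⊗ e_x` and move this
factor past `D`; the terms in which `d(e_x) = 1 - x` appears vanish in `B̄`, because there `x` acts
as `1`, and what is left is `D h̄ + h̄ d = Δ_right - τ Δ_left` at `e_x b` (`tensorDiffBar_homBar`).
For the same reason `d` is compatible with the two halves of `Δ` separately, but only on `B̄`.

A cochain is determined by its functional on `B̄`, and under this identification `∂*` is, up to
sign, the transpose of `d`, and the products and `H` are, up to sign, transposes of the
half-coproducts and of `h̄`. So the identities between cochains are transposes of identities on
`B̄`: associativity relations (`functional_dualProduct_assoc`), the Leibniz rule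
(`functional_coboundary_dualProduct`) and the homotopy relation (`functional_zinbielHomotopy`).
By the Leibniz rule the products descend to cohomology, where the left-hand side of the homotopy
relation between cocycles is a coboundary, so that `≻` becomes the signed opposite of `≺`.
-/

open scoped TensorProduct DirectSum

namespace RackZinbiel

noncomputable section

/-! ### Graded modules and their tensor squares -/

section Graded

variable {k C C' : Type*} [CommRing k] [AddCommGroup C] [Module k C] [AddCommGroup C'] [Module k C']
variable {𝒞 : ℕ → Submodule k C} {𝒞' : ℕ → Submodule k C'}

theorem tmul_mem_tensorDegree {i j : ℕ} {u v : C} (hu : u ∈ 𝒞 i) (hv : v ∈ 𝒞 j) :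
    u ⊗ₜ[k] v ∈ tensorDegree 𝒞 (i + j) :=
  Submodule.mem_iSup_of_mem (i, j) <| Submodule.mem_iSup_of_mem (by simp)
    ⟨(⟨u, hu⟩ : 𝒞 i) ⊗ₜ (⟨v, hv⟩ : 𝒞 j), by simp⟩

theorem tensorDegree_le {n : ℕ} {N : Submodule k (C ⊗[k] C)}
    (h : ∀ i j, i + j = n → ∀ u ∈ 𝒞 i, ∀ v ∈ 𝒞 j, u ⊗ₜ[k] v ∈ N) : tensorDegree 𝒞 n ≤ N := by
  refine iSup₂_le ?_
  rintro ⟨i, j⟩ hij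
  rintro _ ⟨t, rfl⟩
  induction t with
  | zero => simp
  | tmul u v => exact h i j (by simpa using hij) u u.2 v v.2
  | add s t hs ht => rw [map_add]; exact add_mem hs ht

/-- The tensor product of maps of degrees `a` and `b` has degree `a + b`. -/
theorem map_mem_tensorDegree {f g : C →ₗ[k] C'} {a b n : ℕ}
    (hf : ∀ i, ∀ c ∈ 𝒞 i, f c ∈ 𝒞' (i + a)) (hg : ∀ i, ∀ c ∈ 𝒞 i, g c ∈ 𝒞' (i + b))
    {t : C ⊗[k] C} (ht : t ∈ tensorDegree 𝒞 n) :
    TensorProduct.map f g t ∈ tensorDegree 𝒞' (n + (a + b)) := by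
  refine tensorDegree_le (N := (tensorDegree 𝒞' (n + (a + b))).comap (TensorProduct.map f g))
    ?_ ht
  rintro i j rfl u hu v hv
  rw [Submodule.mem_comap, TensorProduct.map_tmul, add_add_add_comm]
  exact tmul_mem_tensorDegree (hf i u hu) (hg j v hv)

theorem map_mem_plusTensor {f g : C →ₗ[k] C'} (hf : ∀ c ∈ plus 𝒞, f c ∈ plus 𝒞')
    {t : C ⊗[k] C} (ht : t ∈ plusTensor 𝒞) : TensorProduct.map f g t ∈ plusTensor 𝒞' := by
  obtain ⟨t, rfl⟩ := ht
  induction t with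
  | zero => simp
  | tmul u v => exact ⟨(⟨f u, hf u u.2⟩ : plus 𝒞') ⊗ₜ g v, by simp⟩
  | add s t hs ht => rw [map_add, map_add]; exact add_mem hs ht

theorem map_mem_tensorPlus {f g : C →ₗ[k] C'} (hg : ∀ c ∈ plus 𝒞, g c ∈ plus 𝒞')
    {t : C ⊗[k] C} (ht : t ∈ tensorPlus 𝒞) : TensorProduct.map f g t ∈ tensorPlus 𝒞' := by
  obtain ⟨t, rfl⟩ := ht
  induction t with
  | zero => simp
  | tmul u v => exact ⟨f u ⊗ₜ (⟨g v, hg v v.2⟩ : plus 𝒞'), by simp⟩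
  | add s t hs ht => rw [map_add, map_add]; exact add_mem hs ht

theorem mem_plus {n : ℕ} {c : C} (hc : c ∈ 𝒞 (n + 1)) : c ∈ plus 𝒞 :=
  Submodule.mem_iSup_of_mem n hc

theorem map_mem_plusTensor_of_range {f g : C →ₗ[k] C'} (hf : ∀ c, f c ∈ plus 𝒞')
    (t : C ⊗[k] C) : TensorProduct.map f g t ∈ plusTensor 𝒞' := by
  induction t with
  | zero => simp
  | tmul u v => exact ⟨(⟨f u, hf u⟩ : plus 𝒞') ⊗ₜ g v, by simp⟩
  | add s t hs ht => rw [map_add]; exact add_mem hs ht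

theorem map_mem_tensorPlus_of_range {f g : C →ₗ[k] C'} (hg : ∀ c, g c ∈ plus 𝒞')
    (t : C ⊗[k] C) : TensorProduct.map f g t ∈ tensorPlus 𝒞' := by
  induction t with
  | zero => simp
  | tmul u v => exact ⟨f u ⊗ₜ (⟨g v, hg v⟩ : plus 𝒞'), by simp⟩
  | add s t hs ht => rw [map_add]; exact add_mem hs ht

variable [DirectSum.Decomposition 𝒞] [DirectSum.Decomposition 𝒞']

variable (𝒞) in
/-- Linear maps that agree on homogeneous elements are equal. -/
theorem linearMap_ext_homogeneous {M : Type*} [AddCommGroup M] [Module k M] {f g : C →ₗ[k] M}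
    (h : ∀ n, ∀ c ∈ 𝒞 n, f c = g c) : f = g :=
  DirectSum.decompose_lhom_ext 𝒞 fun n => LinearMap.ext fun c => h n c c.2

variable (𝒞) in
theorem linearMap_tensor_ext_homogeneous {M : Type*} [AddCommGroup M] [Module k M]
    {f g : C ⊗[k] C →ₗ[k] M}
    (h : ∀ i j, ∀ u ∈ 𝒞 i, ∀ v ∈ 𝒞 j, f (u ⊗ₜ v) = g (u ⊗ₜ v)) : f = g := by
  apply TensorProduct.ext
  refine linearMap_ext_homogeneous 𝒞 fun i u hu => ?_
  exact linearMap_ext_homogeneous 𝒞 fun j v hv => h i j u hu v hv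

theorem signOp_of_mem {n : ℕ} {c : C} (hc : c ∈ 𝒞 n) : signOp 𝒞 c = (-1 : k) ^ n • c := by
  simp only [signOp, LinearMap.comp_apply, LinearEquiv.coe_coe,
    DirectSum.decomposeLinearEquiv_apply]
  rw [DirectSum.decompose_of_mem _ hc, ← DirectSum.lof_eq_of k, DirectSum.toModule_lof]
  rfl

theorem signOp_mem {n : ℕ} {c : C} (hc : c ∈ 𝒞 n) : signOp 𝒞 c ∈ 𝒞 n := by
  rw [signOp_of_mem hc]
  exact Submodule.smul_mem _ _ hc

theorem neg_one_pow_mul_self (n : ℕ) : (-1 : k) ^ n * (-1 : k) ^ n = 1 := by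
  rw [← mul_pow]; simp

@[simp]
theorem signOp_signOp (c : C) : signOp 𝒞 (signOp 𝒞 c) = c := by
  have h : signOp 𝒞 ∘ₗ signOp 𝒞 = LinearMap.id := by
    refine linearMap_ext_homogeneous 𝒞 fun n c hc => ?_
    simp [signOp_of_mem hc, smul_smul, neg_one_pow_mul_self]
  exact LinearMap.congr_fun h c

/-- A map of degree `0` commutes with the sign operators. -/
theorem signOp_apply_of_degree_zero {f : C →ₗ[k] C'} (hf : ∀ i, ∀ c ∈ 𝒞 i, f c ∈ 𝒞' i) (c : C) :
    signOp 𝒞' (f c) = f (signOp 𝒞 c) := by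
  have h : signOp 𝒞' ∘ₗ f = f ∘ₗ signOp 𝒞 := by
    refine linearMap_ext_homogeneous 𝒞 fun n c hc => ?_
    simp [signOp_of_mem hc, signOp_of_mem (hf n c hc)]
  exact LinearMap.congr_fun h c

theorem signedFlip_tmul {i j : ℕ} {u v : C} (hu : u ∈ 𝒞 i) (hv : v ∈ 𝒞 j) :
    signedFlip 𝒞 (u ⊗ₜ v) = (-1 : k) ^ (i * j) • v ⊗ₜ u := by
  simp only [signedFlip, LinearEquiv.coe_coe, LinearEquiv.trans_apply,
    TensorProduct.congr_tmul, DirectSum.decomposeLinearEquiv_apply]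
  rw [DirectSum.decompose_of_mem _ hu, DirectSum.decompose_of_mem _ hv, ← DirectSum.lof_eq_of k,
    ← DirectSum.lof_eq_of k, TensorProduct.gradedComm_of_tmul_of]
  rw [Units.smul_def, ← Int.cast_smul_eq_zsmul k, LinearEquiv.map_smul]
  rw [TensorProduct.congr_symm_tmul, DirectSum.lof_eq_of, DirectSum.lof_eq_of]
  simp [DirectSum.decomposeLinearEquiv, mul_comm]

/-- The signed flip is natural for maps of degree `0`. -/
theorem signedFlip_map_of_degree_zero {f : C →ₗ[k] C'} (hf : ∀ i, ∀ c ∈ 𝒞 i, f c ∈ 𝒞' i)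
    (t : C ⊗[k] C) :
    signedFlip 𝒞' (TensorProduct.map f f t) = TensorProduct.map f f (signedFlip 𝒞 t) := by
  have h : signedFlip 𝒞' ∘ₗ TensorProduct.map f f = TensorProduct.map f f ∘ₗ signedFlip 𝒞 := by
    refine linearMap_tensor_ext_homogeneous 𝒞 fun i j u hu v hv => ?_
    simp [signedFlip_tmul hu hv, signedFlip_tmul (hf i u hu) (hf j v hv)]
  exact LinearMap.congr_fun h t

/-- `τ (f ⊗ g) = (g ⊗ f) τ` for `f` of degree `1` and `g` of degree `0`; the Koszul sign of
`g ⊗ f` is the factor `signOp`. -/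
theorem signedFlip_map_odd_even {f g : C →ₗ[k] C} (hf : ∀ i, ∀ c ∈ 𝒞 i, f c ∈ 𝒞 (i + 1))
    (hg : ∀ i, ∀ c ∈ 𝒞 i, g c ∈ 𝒞 i) (t : C ⊗[k] C) :
    signedFlip 𝒞 (TensorProduct.map f g t) =
      TensorProduct.map (g ∘ₗ signOp 𝒞) f (signedFlip 𝒞 t) := by
  have h : signedFlip 𝒞 ∘ₗ TensorProduct.map f g =
      TensorProduct.map (g ∘ₗ signOp 𝒞) f ∘ₗ signedFlip 𝒞 := by
    refine linearMap_tensor_ext_homogeneous 𝒞 fun i j u hu v hv => ?_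
    simp [signedFlip_tmul hu hv, signedFlip_tmul (hf i u hu) (hg j v hv), signOp_of_mem hv,
      TensorProduct.smul_tmul', smul_smul, add_mul, pow_add]
  exact LinearMap.congr_fun h t

/-- `τ (Id ⊗ f) = (f ⊗ Id) τ` for `f` of degree `1`. -/
theorem signedFlip_map_sign_odd {f : C →ₗ[k] C} (hf : ∀ i, ∀ c ∈ 𝒞 i, f c ∈ 𝒞 (i + 1))
    (t : C ⊗[k] C) :
    signedFlip 𝒞 (TensorProduct.map (signOp 𝒞) f t) =
      TensorProduct.map f LinearMap.id (signedFlip 𝒞 t) := by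
  have h : signedFlip 𝒞 ∘ₗ TensorProduct.map (signOp 𝒞) f =
      TensorProduct.map f LinearMap.id ∘ₗ signedFlip 𝒞 := by
    refine linearMap_tensor_ext_homogeneous 𝒞 fun i j u hu v hv => ?_
    have e : (-1 : k) ^ i * (-1 : k) ^ (i * (j + 1)) = (-1 : k) ^ (i * j) := by
      rw [mul_add, mul_one, pow_add, mul_left_comm, neg_one_pow_mul_self, mul_one]
    rw [LinearMap.comp_apply, LinearMap.comp_apply, TensorProduct.map_tmul, signedFlip_tmul hu hv,
      signedFlip_tmul (signOp_mem hu) (hf j v hv), signOp_of_mem hu, TensorProduct.tmul_smul,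
      smul_smul, mul_comm, e, map_smul, TensorProduct.map_tmul, LinearMap.id_apply]
  exact LinearMap.congr_fun h t

end Graded

/-! ### Induction on `B(X)` -/

section Induction

variable {k X : Type*} [CommRing k] [Shelf X]

theorem mkB_surjective : Function.Surjective (mkB k X) := RingQuot.mkAlgHom_surjective k _

/-- A submodule of `B(X)` that contains `1` and is stable under left multiplication by the
generators is everything. -/
theorem eq_top_of_generators {N : Submodule k (B k X)} (h1 : 1 ∈ N)
    (hx : ∀ x, ∀ b ∈ N, gx k x * b ∈ N) (he : ∀ x, ∀ b ∈ N, ge k x * b ∈ N) : N = ⊤ := by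
  have key : ∀ a : FreeAlgebra k (Gen X), ∀ b ∈ N, mkB k X a * b ∈ N := by
    intro a
    induction a using FreeAlgebra.induction with
    | grade0 r =>
      intro b hb
      rw [AlgHom.commutes, ← Algebra.smul_def]
      exact N.smul_mem r hb
    | grade1 s =>
      cases s with
      | inl x => exact hx x
      | inr x => exact he x
    | mul a b iha ihb =>
      intro c hc
      rw [map_mul, mul_assoc]
      exact iha _ (ihb c hc)
    | add a b iha ihb =>
      intro c hc
      rw [map_add, add_mul]
      exact add_mem (iha c hc) (ihb c hc)
  refine eq_top_iff.2 fun b _ => ?_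
  obtain ⟨a, rfl⟩ := mkB_surjective b
  simpa using key a 1 h1

/-- Two linear maps on `B(X)` are equal if they agree at `1` and their agreement is preserved by
left multiplication by the generators. -/
theorem linearMap_ext_generators {M : Type*} [AddCommGroup M] [Module k M] {f g : B k X →ₗ[k] M}
    (h1 : f 1 = g 1) (hx : ∀ x b, f b = g b → f (gx k x * b) = g (gx k x * b))
    (he : ∀ x b, f b = g b → f (ge k x * b) = g (ge k x * b)) : f = g := by
  have h : LinearMap.eqLocus f g = ⊤ := eq_top_of_generators h1 hx he
  exact LinearMap.ext fun b => (h ▸ Submodule.mem_top : b ∈ LinearMap.eqLocus f g)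

theorem gx_mul_mem {n : ℕ} (x : X) {b : B k X} (hb : b ∈ deg k X n) :
    gx k x * b ∈ deg k X n := by
  simpa using SetLike.mul_mem_graded (gx_mem x) hb

theorem ge_mul_mem {n : ℕ} (x : X) {b : B k X} (hb : b ∈ deg k X n) :
    ge k x * b ∈ deg k X (n + 1) := by
  simpa [add_comm] using SetLike.mul_mem_graded (ge_mem x) hb

/-- Induction on the homogeneous elements of `B(X)`. -/
theorem deg_le {N : ℕ → Submodule k (B k X)} (h1 : 1 ∈ N 0)
    (hx : ∀ n x, ∀ b ∈ N n, gx k x * b ∈ N n)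
    (he : ∀ n x, ∀ b ∈ deg k X n, b ∈ N n → ge k x * b ∈ N (n + 1)) (n : ℕ) :
    deg k X n ≤ N n := by
  refine Submodule.span_le.2 ?_
  rintro _ ⟨l, rfl, rfl⟩
  induction l with
  | nil => simpa using h1
  | cons s l ih =>
    cases s with
    | inl x => simpa [List.countP_cons, gx] using hx _ x _ ih
    | inr x => simpa [List.countP_cons, ge] using he _ x _ (monomial_mem l) ih

/-- A submodule of `B(X)` that contains all `e_x b` and is stable under left multiplication by
`X` contains `B(X)⁺`. -/
theorem plus_deg_le {N : Submodule k (B k X)} (hx : ∀ x, ∀ b ∈ N, gx k x * b ∈ N)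
    (he : ∀ x b, ge k x * b ∈ N) : plus (deg k X) ≤ N := by
  -- There is no condition in degree `0`.
  let N' : ℕ → Submodule k (B k X) := fun n => Nat.casesOn n ⊤ fun _ => N
  have h : ∀ n, deg k X n ≤ N' n := deg_le (N := N') trivial
    (fun n x b hb => by cases n with
      | zero => trivial
      | succ n => exact hx x b hb)
    (fun n x b _ _ => he x b)
  exact iSup_le fun n => h (n + 1)

/-- The relation `e_x y = y e_{x^y}` moves the letters of degree `0` to the front. -/
theorem ge_mul_gxs (x : X) (as : List X) :
    ∃ y, ge k x * gxs k as = gxs k as * ge k y := by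
  induction as generalizing x with
  | nil => exact ⟨x, by simp [gxs]⟩
  | cons a as ih =>
    obtain ⟨y, hy⟩ := ih (Shelf.act a x)
    refine ⟨y, ?_⟩
    have h : gxs k (a :: as) = gx k a * gxs k as := by simp [gxs]
    rw [h, ← mul_assoc, ← rel_ex, mul_assoc, hy, mul_assoc]

@[simp] theorem gxs_nil : gxs k ([] : List X) = 1 := rfl

@[simp] theorem ges_nil : ges k ([] : List X) = 1 := rfl

theorem gxs_cons (x : X) (xs : List X) : gxs k (x :: xs) = gx k x * gxs k xs := by simp [gxs]

theorem ges_cons (x : X) (xs : List X) : ges k (x :: xs) = ge k x * ges k xs := by simp [ges]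

theorem span_monomials :
    Submodule.span k {b : B k X | ∃ as xs : List X, b = gxs k as * ges k xs} = ⊤ := by
  refine eq_top_of_generators (Submodule.subset_span ⟨[], [], by simp⟩) ?_ ?_
  · intro x b hb
    induction hb using Submodule.span_induction with
    | mem b hb =>
      obtain ⟨as, xs, rfl⟩ := hb
      exact Submodule.subset_span ⟨x :: as, xs, by rw [gxs_cons, mul_assoc]⟩
    | zero => simp
    | add u v _ _ hu hv => rw [mul_add]; exact add_mem hu hv
    | smul c u _ hu => rw [mul_smul_comm]; exact Submodule.smul_mem _ _ hu
  · intro x b hb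
    induction hb using Submodule.span_induction with
    | mem b hb =>
      obtain ⟨as, xs, rfl⟩ := hb
      obtain ⟨y, hy⟩ := ge_mul_gxs (k := k) x as
      exact Submodule.subset_span ⟨as, y :: xs, by rw [ges_cons, ← mul_assoc, hy, mul_assoc]⟩
    | zero => simp
    | add u v _ _ hu hv => rw [mul_add]; exact add_mem hu hv
    | smul c u _ hu => rw [mul_smul_comm]; exact Submodule.smul_mem _ _ hu

end Induction

/-! ### Left multiplication by generators on `B ⊗ B` -/

section Operators

variable {k X : Type*} [CommRing k] [Shelf X]

/-- Left multiplication by `a` on `B`. -/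
def lmul (a : B k X) : B k X →ₗ[k] B k X := LinearMap.mulLeft k a

@[simp] theorem lmul_apply (a b : B k X) : lmul a b = a * b := rfl

@[simp] theorem lmul_one : lmul (1 : B k X) = LinearMap.id := LinearMap.ext fun b => one_mul b

theorem rel_xx_assoc (x y : X) (b : B k X) :
    gx k y * (gx k (Shelf.act y x) * b) = gx k x * (gx k y * b) := by
  rw [← mul_assoc, rel_xx, mul_assoc]

theorem rel_ex_assoc (x y : X) (b : B k X) :
    gx k y * (ge k (Shelf.act y x) * b) = ge k x * (gx k y * b) := by
  rw [← mul_assoc, rel_ex, mul_assoc]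

@[simp] theorem diff_one : diff k X 1 = 0 := by simp [diff]

@[simp] theorem diff_gx_mul (x : X) (b : B k X) :
    diff k X (gx k x * b) = gx k x * diff k X b := by
  simp [diff_mul (gx_mem x)]

@[simp] theorem diff_ge_mul (x : X) (b : B k X) :
    diff k X (ge k x * b) = b - gx k x * b - ge k x * diff k X b := by
  simp [diff_mul (ge_mem x), sub_mul, ← sub_eq_add_neg]

@[simp] theorem signOp_one : signOp (deg k X) (1 : B k X) = 1 := by
  simpa using signOp_of_mem (SetLike.GradedOne.one_mem : (1 : B k X) ∈ deg k X 0)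

@[simp] theorem signOp_gx_mul (x : X) (b : B k X) :
    signOp (deg k X) (gx k x * b) = gx k x * signOp (deg k X) b :=
  signOp_apply_of_degree_zero (𝒞 := deg k X) (𝒞' := deg k X) (f := lmul (gx k x))
    (fun _ _ hc => gx_mul_mem x hc) b

@[simp] theorem signOp_ge_mul (x : X) (b : B k X) :
    signOp (deg k X) (ge k x * b) = -(ge k x * signOp (deg k X) b) := by
  have h : signOp (deg k X) ∘ₗ lmul (ge k x) =
      -(lmul (ge k x) ∘ₗ signOp (deg k X)) := by
    refine linearMap_ext_homogeneous (deg k X) fun n c hc => ?_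
    simp [signOp_of_mem hc, signOp_of_mem (ge_mul_mem x hc), pow_succ]
  exact LinearMap.congr_fun h b

@[simp] theorem signOp_diff (b : B k X) :
    signOp (deg k X) (diff k X b) = -diff k X (signOp (deg k X) b) := by
  have h : signOp (deg k X) ∘ₗ diff k X = -(diff k X ∘ₗ signOp (deg k X)) := by
    refine linearMap_ext_generators (by simp) (fun x b hb => ?_) (fun x b hb => ?_)
    · have hb : signOp (deg k X) (diff k X b) = -diff k X (signOp (deg k X) b) := hb
      simp [hb]
    · have hb : signOp (deg k X) (diff k X b) = -diff k X (signOp (deg k X) b) := hb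
      simp [hb]
  exact LinearMap.congr_fun h b

@[simp] theorem diff_diff (b : B k X) : diff k X (diff k X b) = 0 := by
  have h : diff k X ∘ₗ diff k X = 0 := by
    refine linearMap_ext_generators (by simp) (fun x b hb => ?_) (fun x b hb => ?_)
    · have hb : diff k X (diff k X b) = 0 := hb
      simp [hb]
    · have hb : diff k X (diff k X b) = 0 := hb
      simp [hb]
  exact LinearMap.congr_fun h b

theorem diff_mem_deg {n : ℕ} {b : B k X} (hb : b ∈ deg k X (n + 1)) : diff k X b ∈ deg k X n := by
  -- Elements of degree `0` have to be treated together with the others: `d` vanishes on them.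
  let N : ℕ → Submodule k (B k X) := fun n =>
    (Nat.casesOn n ⊥ fun m => deg k X m : Submodule k (B k X)).comap (diff k X)
  have h : ∀ n, deg k X n ≤ N n := by
    refine deg_le ?_ ?_ ?_
    · change diff k X 1 = 0
      simp
    · intro n x b hb
      cases n with
      | zero =>
        have hb : diff k X b = 0 := hb
        change diff k X _ = 0
        simp [hb]
      | succ n =>
        change diff k X _ ∈ deg k X n
        rw [diff_gx_mul]
        exact gx_mul_mem x hb
    · intro n x b hb hb'
      change diff k X _ ∈ deg k X n
      rw [diff_ge_mul]
      refine sub_mem (sub_mem hb (gx_mul_mem x hb)) ?_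
      cases n with
      | zero =>
        have hb' : diff k X b = 0 := hb'
        simp [hb']
      | succ n => exact ge_mul_mem x hb'
  exact h (n + 1) hb

theorem diff_of_mem_deg_zero {b : B k X} (hb : b ∈ deg k X 0) : diff k X b = 0 := by
  let N : ℕ → Submodule k (B k X) := fun n => Nat.casesOn n (LinearMap.ker (diff k X)) fun _ => ⊤
  have h : ∀ n, deg k X n ≤ N n := by
    refine deg_le ?_ ?_ ?_
    · change diff k X 1 = 0
      simp
    · intro n x b hb
      cases n with
      | zero =>
        have hb : diff k X b = 0 := hb
        change diff k X _ = 0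
        simp [hb]
      | succ n => trivial
    · intros
      trivial
  exact h 0 hb

variable (k)

/-- Left multiplication by `x ⊗ x` on `B ⊗ B`. -/
def opXX (x : X) : B k X ⊗[k] B k X →ₗ[k] B k X ⊗[k] B k X :=
  TensorProduct.map (lmul (gx k x)) (lmul (gx k x))

/-- Left multiplication by `e_x ⊗ x` on `B ⊗ B`. -/
def opEX (x : X) : B k X ⊗[k] B k X →ₗ[k] B k X ⊗[k] B k X :=
  TensorProduct.map (lmul (ge k x)) (lmul (gx k x))

/-- Left multiplication by `1 ⊗ e_x` on `B ⊗ B`; the Koszul sign is the factor `signOp`, here and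
in `opXE` and `opEE`. -/
def opOE (x : X) : B k X ⊗[k] B k X →ₗ[k] B k X ⊗[k] B k X :=
  TensorProduct.map (signOp (deg k X)) (lmul (ge k x))

/-- Left multiplication by `x ⊗ e_x` on `B ⊗ B`. -/
def opXE (x : X) : B k X ⊗[k] B k X →ₗ[k] B k X ⊗[k] B k X :=
  TensorProduct.map (lmul (gx k x) ∘ₗ signOp (deg k X))
    (lmul (ge k x))

/-- Left multiplication by `e_x ⊗ 1` on `B ⊗ B`. -/
def opEO (x : X) : B k X ⊗[k] B k X →ₗ[k] B k X ⊗[k] B k X :=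
  TensorProduct.map (lmul (ge k x)) LinearMap.id

/-- Left multiplication by `e_x ⊗ e_x` on `B ⊗ B`. -/
def opEE (x : X) : B k X ⊗[k] B k X →ₗ[k] B k X ⊗[k] B k X :=
  TensorProduct.map (lmul (ge k x) ∘ₗ signOp (deg k X))
    (lmul (ge k x))

variable {k}

@[simp] theorem opXX_tmul (x : X) (u v : B k X) :
    opXX k x (u ⊗ₜ v) = (gx k x * u) ⊗ₜ (gx k x * v) := rfl

@[simp] theorem opEX_tmul (x : X) (u v : B k X) :
    opEX k x (u ⊗ₜ v) = (ge k x * u) ⊗ₜ (gx k x * v) := rfl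

@[simp] theorem opOE_tmul (x : X) (u v : B k X) :
    opOE k x (u ⊗ₜ v) = signOp (deg k X) u ⊗ₜ (ge k x * v) := rfl

@[simp] theorem opXE_tmul (x : X) (u v : B k X) :
    opXE k x (u ⊗ₜ v) = (gx k x * signOp (deg k X) u) ⊗ₜ (ge k x * v) := rfl

@[simp] theorem opEO_tmul (x : X) (u v : B k X) :
    opEO k x (u ⊗ₜ v) = (ge k x * u) ⊗ₜ v := rfl

@[simp] theorem opEE_tmul (x : X) (u v : B k X) :
    opEE k x (u ⊗ₜ v) = (ge k x * signOp (deg k X) u) ⊗ₜ (ge k x * v) := rfl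

theorem opXX_comm (x y : X) (t : B k X ⊗[k] B k X) :
    opXX k y (opXX k (Shelf.act y x) t) = opXX k x (opXX k y t) := by
  induction t with
  | zero => simp
  | tmul u v => simp [rel_xx_assoc]
  | add s t hs ht => simp only [map_add, hs, ht]

theorem opEX_comm (x y : X) (t : B k X ⊗[k] B k X) :
    opXX k y (opEX k (Shelf.act y x) t) = opEX k x (opXX k y t) := by
  induction t with
  | zero => simp
  | tmul u v => simp [rel_xx_assoc, rel_ex_assoc]
  | add s t hs ht => simp only [map_add, hs, ht]

theorem opEE_comm (x y : X) (t : B k X ⊗[k] B k X) :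
    opXX k y (opEE k (Shelf.act y x) t) = opEE k x (opXX k y t) := by
  induction t with
  | zero => simp
  | tmul u v => simp [rel_ex_assoc]
  | add s t hs ht => simp only [map_add, hs, ht]

theorem opXE_comm (x y : X) (t : B k X ⊗[k] B k X) :
    opXX k y (opXE k (Shelf.act y x) t) = opXE k x (opXX k y t) := by
  induction t with
  | zero => simp
  | tmul u v => simp [rel_xx_assoc, rel_ex_assoc]
  | add s t hs ht => simp only [map_add, hs, ht]

theorem opEO_comm (x y : X) (t : B k X ⊗[k] B k X) :
    opXX k y (opEO k (Shelf.act y x) t) = opEO k x (opXX k y t) := by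
  induction t with
  | zero => simp
  | tmul u v => simp [rel_ex_assoc]
  | add s t hs ht => simp only [map_add, hs, ht]

theorem opOE_comm (x y : X) (t : B k X ⊗[k] B k X) :
    opXX k y (opOE k (Shelf.act y x) t) = opOE k x (opXX k y t) := by
  induction t with
  | zero => simp
  | tmul u v => simp [rel_ex_assoc]
  | add s t hs ht => simp only [map_add, hs, ht]

/-- Left multiplication by `a ⊗ b` with `b` of degree `0` carries no sign. -/
theorem of_symm_tm_mul_even (a : B k X) {b : B k X} (hb : b ∈ deg k X 0) (t : BB k X) :
    (GradedTensorProduct.of k (deg k X) (deg k X)).symm (tm a b * t) =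
      TensorProduct.map (lmul a) (lmul b)
        ((GradedTensorProduct.of k (deg k X) (deg k X)).symm t) := by
  have h : (GradedTensorProduct.of k (deg k X) (deg k X)).symm.toLinearMap ∘ₗ
      LinearMap.mulLeft k (tm a b) ∘ₗ (GradedTensorProduct.of k (deg k X) (deg k X)).toLinearMap =
      TensorProduct.map (lmul a) (lmul b) := by
    refine linearMap_tensor_ext_homogeneous (deg k X) fun i j u hu v hv => ?_
    have h := tm_mul_tm a b u v hb hu
    simp only [LinearMap.comp_apply, LinearEquiv.coe_coe, LinearMap.mulLeft_apply, lmul_apply,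
      TensorProduct.map_tmul]
    rw [h]
    simp
  exact LinearMap.congr_fun h ((GradedTensorProduct.of k (deg k X) (deg k X)).symm t)

/-- Left multiplication by `a ⊗ b` with `b` of degree `1`, with its Koszul sign. -/
theorem of_symm_tm_mul_odd (a : B k X) {b : B k X} (hb : b ∈ deg k X 1) (t : BB k X) :
    (GradedTensorProduct.of k (deg k X) (deg k X)).symm (tm a b * t) =
      TensorProduct.map (lmul a ∘ₗ signOp (deg k X)) (lmul b)
        ((GradedTensorProduct.of k (deg k X) (deg k X)).symm t) := by
  have h : (GradedTensorProduct.of k (deg k X) (deg k X)).symm.toLinearMap ∘ₗ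
      LinearMap.mulLeft k (tm a b) ∘ₗ (GradedTensorProduct.of k (deg k X) (deg k X)).toLinearMap =
      TensorProduct.map (lmul a ∘ₗ signOp (deg k X)) (lmul b) := by
    refine linearMap_tensor_ext_homogeneous (deg k X) fun i j u hu v hv => ?_
    have h := tm_mul_tm a b u v hb hu
    simp only [LinearMap.comp_apply, LinearEquiv.coe_coe, LinearMap.mulLeft_apply, lmul_apply,
      TensorProduct.map_tmul]
    rw [h, signOp_of_mem hu, one_mul, mul_smul_comm, ← TensorProduct.smul_tmul',
      Units.smul_def, ← Int.cast_smul_eq_zsmul k, map_smul]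
    simp
  exact LinearMap.congr_fun h ((GradedTensorProduct.of k (deg k X) (deg k X)).symm t)

variable (k X)

/-- The linear identification of `B ⊗ B` with the algebra `B ⊗ B`. -/
abbrev ofBB : B k X ⊗[k] B k X ≃ₗ[k] BB k X := GradedTensorProduct.of k (deg k X) (deg k X)

variable {k X}

theorem ofBB_opXX (x : X) (t : B k X ⊗[k] B k X) :
    ofBB k X (opXX k x t) = tm (gx k x) (gx k x) * ofBB k X t :=
  (ofBB k X).symm.injective
    (of_symm_tm_mul_even (gx k x) (gx_mem x) (ofBB k X t)).symm

theorem ofBB_opEX (x : X) (t : B k X ⊗[k] B k X) :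
    ofBB k X (opEX k x t) = tm (ge k x) (gx k x) * ofBB k X t :=
  (ofBB k X).symm.injective
    (of_symm_tm_mul_even (ge k x) (gx_mem x) (ofBB k X t)).symm

theorem ofBB_opEO (x : X) (t : B k X ⊗[k] B k X) :
    ofBB k X (opEO k x t) = tm (ge k x) 1 * ofBB k X t := by
  refine (ofBB k X).symm.injective
    ((of_symm_tm_mul_even (ge k x) SetLike.GradedOne.one_mem (ofBB k X t)).trans ?_).symm
  rw [lmul_one]
  rfl

theorem ofBB_opOE (x : X) (t : B k X ⊗[k] B k X) :
    ofBB k X (opOE k x t) = tm 1 (ge k x) * ofBB k X t := by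
  refine (ofBB k X).symm.injective
    ((of_symm_tm_mul_odd 1 (ge_mem x) (ofBB k X t)).trans ?_).symm
  rw [lmul_one]
  rfl

theorem ofBB_opXE (x : X) (t : B k X ⊗[k] B k X) :
    ofBB k X (opXE k x t) = tm (gx k x) (ge k x) * ofBB k X t :=
  (ofBB k X).symm.injective
    (of_symm_tm_mul_odd (gx k x) (ge_mem x) (ofBB k X t)).symm

theorem ofBB_opEE (x : X) (t : B k X ⊗[k] B k X) :
    ofBB k X (opEE k x t) = tm (ge k x) (ge k x) * ofBB k X t :=
  (ofBB k X).symm.injective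
    (of_symm_tm_mul_odd (ge k x) (ge_mem x) (ofBB k X t)).symm

end Operators

/-! ### The half-coproducts and the homotopies on `B(X)` -/

section Maps

variable {k X : Type*} [CommRing k] [Shelf X]

theorem comul_one : comul k X (1 : B k X) = 1 ⊗ₜ 1 := by
  change (ofBB k X).symm (comulHom k X 1) = _
  rw [map_one]
  rfl

theorem ofBB_comul (b : B k X) : ofBB k X (comul k X b) = comulHom k X b := rfl

theorem comulHom_gx (x : X) : comulHom k X (gx k x) = tm (gx k x) (gx k x) :=
  liftB_gx (k := k) _ _ _ _ x

theorem comulHom_ge (x : X) :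
    comulHom k X (ge k x) = tm (ge k x) (gx k x) + tm 1 (ge k x) :=
  liftB_ge (k := k) _ _ _ _ x

theorem comul_gx_mul (x : X) (b : B k X) : comul k X (gx k x * b) = opXX k x (comul k X b) :=
  (ofBB k X).injective (by rw [ofBB_opXX, ofBB_comul, ofBB_comul, map_mul, comulHom_gx])

theorem comul_ge_mul (x : X) (b : B k X) :
    comul k X (ge k x * b) = opEX k x (comul k X b) + opOE k x (comul k X b) :=
  (ofBB k X).injective (by
    rw [map_add, ofBB_opEX, ofBB_opOE, ofBB_comul, ofBB_comul, map_mul, comulHom_ge, add_mul])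

variable (k X)

/-- The module `(B ⊗ B)⁵` of the values of `(Δ, L, R, h, h̄)`. -/
abbrev Five : Type _ :=
  (B k X ⊗[k] B k X) × (B k X ⊗[k] B k X) × (B k X ⊗[k] B k X) × (B k X ⊗[k] B k X) ×
    (B k X ⊗[k] B k X)

variable {X}

/-- The effect of left multiplication by `x` on the values of `(Δ, L, R, h, h̄)`. -/
def fiveX (x : X) : Module.End k (Five k X) :=
  (opXX k x).prodMap ((opXX k x).prodMap ((opXX k x).prodMap ((opXX k x).prodMap (opXX k x))))

/-- The effect of left multiplication by `e_x` on the values of `(Δ, L, R, h, h̄)`: only those of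
`Δ` and `h` enter. -/
def fiveE (x : X) : Module.End k (Five k X) :=
  let Δ := LinearMap.fst k _ _
  let h := LinearMap.fst k _ _ ∘ₗ LinearMap.snd k _ _ ∘ₗ LinearMap.snd k _ _ ∘ₗ
    LinearMap.snd k _ _
  ((opEX k x + opOE k x) ∘ₗ Δ).prod <| (opEX k x ∘ₗ Δ).prod <| (opOE k x ∘ₗ Δ).prod <|
    (opEE k x ∘ₗ Δ - (opXE k x + opEO k x) ∘ₗ h).prod <| -(opXE k x ∘ₗ h)

variable (X)

/-- The representation of `B` on `(B ⊗ B)⁵` through which `Δ`, its two halves and the two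
homotopies are defined simultaneously; by the relations of `B` it is enough to check that the
recursive formulas are compatible with `y x^y = x y` and `y e_{x^y} = e_x y`. -/
def fiveRep : B k X →ₐ[k] Module.End k (Five k X) :=
  liftB (fiveX k) (fiveE k)
    (by
      intro x y
      apply LinearMap.ext
      rintro ⟨a, b, c, d, e⟩
      simp [fiveX, opXX_comm])
    (by
      intro x y
      apply LinearMap.ext
      rintro ⟨a, b, c, d, e⟩
      simp [fiveX, fiveE, opEX_comm, opOE_comm, opEE_comm, opXE_comm, opEO_comm])

/-- The vector `(Δ, L, R, h, h̄)` of all maps. -/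
def five : B k X →ₗ[k] Five k X :=
  LinearMap.applyₗ (((1 : B k X) ⊗ₜ[k] (1 : B k X)), 0, 0, 0, 0) ∘ₗ (fiveRep k X).toLinearMap

/-- The left half `B → B ⊗ B` of the comultiplication. -/
def leftHalf : B k X →ₗ[k] B k X ⊗[k] B k X :=
  LinearMap.fst k _ _ ∘ₗ LinearMap.snd k _ _ ∘ₗ five k X

/-- The right half `B → B ⊗ B` of the comultiplication. -/
def rightHalf : B k X →ₗ[k] B k X ⊗[k] B k X :=
  LinearMap.fst k _ _ ∘ₗ LinearMap.snd k _ _ ∘ₗ LinearMap.snd k _ _ ∘ₗ five k X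

/-- The homotopy `h` between `Δ` and `τ Δ`. -/
def homotopyH : B k X →ₗ[k] B k X ⊗[k] B k X :=
  LinearMap.fst k _ _ ∘ₗ LinearMap.snd k _ _ ∘ₗ LinearMap.snd k _ _ ∘ₗ LinearMap.snd k _ _ ∘ₗ
    five k X

/-- The map `h̄` that induces the homotopy on `B̄`. -/
def homotopyBar : B k X →ₗ[k] B k X ⊗[k] B k X :=
  LinearMap.snd k _ _ ∘ₗ LinearMap.snd k _ _ ∘ₗ LinearMap.snd k _ _ ∘ₗ LinearMap.snd k _ _ ∘ₗ
    five k X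

variable {k X}

theorem fiveRep_gx (x : X) : fiveRep k X (gx k x) = fiveX k x := liftB_gx (k := k) _ _ _ _ x

theorem fiveRep_ge (x : X) : fiveRep k X (ge k x) = fiveE k x := liftB_ge (k := k) _ _ _ _ x

theorem five_fst (b : B k X) : (five k X b).1 = comul k X b := by
  have h : LinearMap.fst k _ _ ∘ₗ five k X = comul k X := by
    refine linearMap_ext_generators ?_ (fun x b hb => ?_) (fun x b hb => ?_)
    · simp [five, comul_one]
    · have hb : (five k X b).1 = comul k X b := hb
      rw [comul_gx_mul, ← hb]
      simp [five, fiveRep_gx, fiveX]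
    · have hb : (five k X b).1 = comul k X b := hb
      rw [comul_ge_mul, ← hb]
      simp [five, fiveRep_ge, fiveE]
  exact LinearMap.congr_fun h b

@[simp] theorem leftHalf_one : leftHalf k X 1 = 0 := by simp [leftHalf, five]

@[simp] theorem leftHalf_gx_mul (x : X) (b : B k X) :
    leftHalf k X (gx k x * b) = opXX k x (leftHalf k X b) := by
  simp [leftHalf, five, fiveRep_gx, fiveX]

@[simp] theorem leftHalf_ge_mul (x : X) (b : B k X) :
    leftHalf k X (ge k x * b) = opEX k x (comul k X b) := by
  rw [← five_fst]
  simp [leftHalf, five, fiveRep_ge, fiveE]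

@[simp] theorem rightHalf_one : rightHalf k X 1 = 0 := by simp [rightHalf, five]

@[simp] theorem rightHalf_gx_mul (x : X) (b : B k X) :
    rightHalf k X (gx k x * b) = opXX k x (rightHalf k X b) := by
  simp [rightHalf, five, fiveRep_gx, fiveX]

@[simp] theorem rightHalf_ge_mul (x : X) (b : B k X) :
    rightHalf k X (ge k x * b) = opOE k x (comul k X b) := by
  rw [← five_fst]
  simp [rightHalf, five, fiveRep_ge, fiveE]

@[simp] theorem homotopyH_one : homotopyH k X 1 = 0 := by simp [homotopyH, five]

@[simp] theorem homotopyH_gx_mul (x : X) (b : B k X) :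
    homotopyH k X (gx k x * b) = opXX k x (homotopyH k X b) := by
  simp [homotopyH, five, fiveRep_gx, fiveX]

@[simp] theorem homotopyH_ge_mul (x : X) (b : B k X) :
    homotopyH k X (ge k x * b) = opEE k x (comul k X b) -
      (opXE k x (homotopyH k X b) + opEO k x (homotopyH k X b)) := by
  rw [← five_fst]
  simp [homotopyH, five, fiveRep_ge, fiveE]

@[simp] theorem homotopyBar_one : homotopyBar k X 1 = 0 := by simp [homotopyBar, five]

@[simp] theorem homotopyBar_gx_mul (x : X) (b : B k X) :
    homotopyBar k X (gx k x * b) = opXX k x (homotopyBar k X b) := by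
  simp [homotopyBar, five, fiveRep_gx, fiveX]

@[simp] theorem homotopyBar_ge_mul (x : X) (b : B k X) :
    homotopyBar k X (ge k x * b) = -opXE k x (homotopyH k X b) := by
  simp [homotopyBar, homotopyH, five, fiveRep_ge, fiveE]

end Maps

/-! ### The closed formulas on monomials -/

section Formulas

variable {k X : Type*} [CommRing k] [Shelf X]

theorem tm_gxs_mul (as : List X) (u v : B k X) :
    tm (gxs k as) (gxs k as) * tm u v = tm (gxs k as * u) (gxs k as * v) := by
  induction as generalizing u v with
  | nil =>
    rw [gxs_nil, one_mul, one_mul]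
    exact one_mul _
  | cons a as ih =>
    rw [gxs_cons, ← tm_gx_mul, mul_assoc, ih, tm_gx_mul, mul_assoc, mul_assoc]

theorem ofBB_gxs_mul {f : B k X →ₗ[k] B k X ⊗[k] B k X}
    (hf : ∀ x b, f (gx k x * b) = opXX k x (f b)) (as : List X) (b : B k X) :
    ofBB k X (f (gxs k as * b)) = tm (gxs k as) (gxs k as) * ofBB k X (f b) := by
  induction as with
  | nil =>
    rw [gxs_nil, one_mul]
    exact (one_mul _).symm
  | cons a as ih =>
    rw [gxs_cons, mul_assoc, hf, ofBB_opXX, ih, ← mul_assoc, tm_gx_mul]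

theorem apply_gxs_eq_zero {f : B k X →ₗ[k] B k X ⊗[k] B k X}
    (hf : ∀ x b, f (gx k x * b) = opXX k x (f b)) (h1 : f 1 = 0) (as : List X) :
    f (gxs k as) = 0 := by
  have h := ofBB_gxs_mul hf as 1
  rw [mul_one, h1, map_zero, mul_zero] at h
  exact (ofBB k X).map_eq_zero_iff.1 h

theorem isLeftHalf_leftHalf : IsLeftHalf (leftHalf k X) := by
  refine ⟨apply_gxs_eq_zero leftHalf_gx_mul leftHalf_one, fun as x xs => ?_⟩
  refine (ofBB_gxs_mul leftHalf_gx_mul as _).trans ?_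
  rw [ges_cons, leftHalf_ge_mul, ofBB_opEX, ← mul_assoc, tm_gxs_mul, ofBB_comul]

theorem isRightHalf_rightHalf : IsRightHalf (rightHalf k X) := by
  refine ⟨apply_gxs_eq_zero rightHalf_gx_mul rightHalf_one, fun as x xs => ?_⟩
  refine (ofBB_gxs_mul rightHalf_gx_mul as _).trans ?_
  rw [ges_cons, rightHalf_ge_mul, ofBB_opOE, ← mul_assoc, tm_gxs_mul, ofBB_comul, mul_one]

theorem isHomotopyBar_homotopyBar : IsHomotopyBar (homotopyH k X) (homotopyBar k X) := by
  refine ⟨apply_gxs_eq_zero homotopyBar_gx_mul homotopyBar_one, fun as x xs => ?_⟩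
  refine (ofBB_gxs_mul homotopyBar_gx_mul as _).trans ?_
  rw [ges_cons, homotopyBar_ge_mul, map_neg, ofBB_opXE, mul_neg, ← mul_assoc, tm_gxs_mul]

theorem comm_tm_ge_gx (x : X) :
    GradedTensorProduct.comm (deg k X) (deg k X) (tm (ge k x) (gx k x)) =
      tm (gx k x) (ge k x) := by
  have h := GradedTensorProduct.comm_coe_tmul_coe (R := k) (deg k X) (deg k X)
    (⟨ge k x, ge_mem x⟩ : deg k X 1) (⟨gx k x, gx_mem x⟩ : deg k X 0)
  simpa using h

theorem comm_tm_one_ge (x : X) :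
    GradedTensorProduct.comm (deg k X) (deg k X) (tm 1 (ge k x)) = tm (ge k x) 1 := by
  have h := GradedTensorProduct.comm_coe_tmul_coe (R := k) (deg k X) (deg k X)
    (⟨1, SetLike.GradedOne.one_mem⟩ : deg k X 0) (⟨ge k x, ge_mem x⟩ : deg k X 1)
  simpa using h

theorem ofBB_homotopyH_ges (xs : List X) :
    ofBB k X (homotopyH k X (ges k xs)) =
      ∑ i : Fin xs.length, (-1 : k) ^ (i : ℕ) •
        (GradedTensorProduct.comm (deg k X) (deg k X) (comulHom k X (ges k (xs.take i))) *
          tm (ge k (xs.get i)) (ge k (xs.get i)) *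
          comulHom k X (ges k (xs.drop (i + 1)))) := by
  induction xs with
  | nil => simp
  | cons x xs ih =>
    rw [ges_cons, homotopyH_ge_mul, map_sub, map_add, ofBB_opEE, ofBB_opXE, ofBB_opEO, ← add_mul,
      ← comm_tm_ge_gx, ← comm_tm_one_ge, ← map_add, ← comulHom_ge, ih, ofBB_comul,
      sub_eq_add_neg, Finset.mul_sum, ← Finset.sum_neg_distrib]
    refine Eq.trans ?_ (Fin.sum_univ_succ (n := xs.length) _).symm
    congr 1
    · simp
    · refine Finset.sum_congr rfl fun i _ => ?_
      simp [ges_cons, pow_succ, mul_assoc]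

theorem isHomotopyH_homotopyH : IsHomotopyH (homotopyH k X) := by
  intro as xs
  refine (ofBB_gxs_mul homotopyH_gx_mul as _).trans ?_
  rw [ofBB_homotopyH_ges, Finset.mul_sum]
  refine Finset.sum_congr rfl fun i _ => ?_
  rw [mul_smul_comm, mul_assoc, mul_assoc, mul_assoc]

end Formulas

/-! ### `B(X)` is a `+`-codendriform coalgebra -/

section Codendriform

variable {k X : Type*} [CommRing k] [Shelf X]

section Maps

variable {M : Type*} [AddCommGroup M] [Module k M]

theorem assoc_map_map (a b c : M →ₗ[k] M) (t : (M ⊗[k] M) ⊗[k] M) :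
    TensorProduct.assoc k M M M (TensorProduct.map (TensorProduct.map a b) c t) =
      TensorProduct.map a (TensorProduct.map b c) (TensorProduct.assoc k M M M t) :=
  (LinearMap.congr_fun (TensorProduct.map_map_comp_assoc_eq a b c) t).symm

theorem map_id_map_left {f f' : M →ₗ[k] M ⊗[k] M} {a : M →ₗ[k] M}
    {w : M ⊗[k] M →ₗ[k] M ⊗[k] M} (h : ∀ u, f (a u) = w (f' u)) (b : M →ₗ[k] M) (t : M ⊗[k] M) :
    TensorProduct.map f LinearMap.id (TensorProduct.map a b t) =
      TensorProduct.map w b (TensorProduct.map f' LinearMap.id t) := by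
  induction t with
  | zero => simp
  | tmul u v => simp [h]
  | add s t hs ht => simp only [map_add, hs, ht]

theorem map_id_map_right {f f' : M →ₗ[k] M ⊗[k] M} {b : M →ₗ[k] M}
    {w : M ⊗[k] M →ₗ[k] M ⊗[k] M} (h : ∀ u, f (b u) = w (f' u)) (a : M →ₗ[k] M) (t : M ⊗[k] M) :
    TensorProduct.map LinearMap.id f (TensorProduct.map a b t) =
      TensorProduct.map a w (TensorProduct.map LinearMap.id f' t) := by
  induction t with
  | zero => simp
  | tmul u v => simp [h]
  | add s t hs ht => simp only [map_add, hs, ht]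

end Maps

theorem comul_signOp (b : B k X) :
    comul k X (signOp (deg k X) b) =
      TensorProduct.map (signOp (deg k X)) (signOp (deg k X)) (comul k X b) := by
  have hXX : ∀ x t, TensorProduct.map (signOp (deg k X)) (signOp (deg k X)) (opXX k x t) =
      opXX k x (TensorProduct.map (signOp (deg k X)) (signOp (deg k X)) t) := by
    intro x t
    induction t with
    | zero => simp
    | tmul u v => simp
    | add s t hs ht => simp only [map_add, hs, ht]
  have hEX : ∀ x t, TensorProduct.map (signOp (deg k X)) (signOp (deg k X)) (opEX k x t) =
      -opEX k x (TensorProduct.map (signOp (deg k X)) (signOp (deg k X)) t) := by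
    intro x t
    induction t with
    | zero => simp
    | tmul u v => simp [TensorProduct.neg_tmul]
    | add s t hs ht => simp only [map_add, hs, ht, neg_add]
  have hOE : ∀ x t, TensorProduct.map (signOp (deg k X)) (signOp (deg k X)) (opOE k x t) =
      -opOE k x (TensorProduct.map (signOp (deg k X)) (signOp (deg k X)) t) := by
    intro x t
    induction t with
    | zero => simp
    | tmul u v => simp [TensorProduct.tmul_neg]
    | add s t hs ht => simp only [map_add, hs, ht, neg_add]
  have h : comul k X ∘ₗ signOp (deg k X) =
      TensorProduct.map (signOp (deg k X)) (signOp (deg k X)) ∘ₗ comul k X := by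
    refine linearMap_ext_generators (by simp [comul_one]) (fun x b hb => ?_) (fun x b hb => ?_)
    · simp only [LinearMap.comp_apply] at hb ⊢
      rw [signOp_gx_mul, comul_gx_mul, comul_gx_mul, hXX, hb]
    · simp only [LinearMap.comp_apply] at hb ⊢
      rw [signOp_ge_mul, map_neg, comul_ge_mul, comul_ge_mul, map_add, hEX, hOE, hb, neg_add]
  exact LinearMap.congr_fun h b

/-- Equivariant maps into `B ⊗ B` have equivariant composites into `B ⊗ (B ⊗ B)`. -/
theorem compLeft_gx_mul {f g : B k X →ₗ[k] B k X ⊗[k] B k X}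
    (hf : ∀ x b, f (gx k x * b) = opXX k x (f b)) (hg : ∀ x b, g (gx k x * b) = opXX k x (g b))
    (x : X) (b : B k X) :
    compLeft f g (gx k x * b) =
      TensorProduct.map (lmul (gx k x)) (opXX k x) (compLeft f g b) := by
  simp only [compLeft, LinearMap.comp_apply, LinearEquiv.coe_coe]
  rw [hg]
  conv_lhs => rw [opXX, map_id_map_left (f' := f) (w := opXX k x) (hf x)]
  exact assoc_map_map _ _ _ _

theorem compRight_gx_mul {f g : B k X →ₗ[k] B k X ⊗[k] B k X}
    (hf : ∀ x b, f (gx k x * b) = opXX k x (f b)) (hg : ∀ x b, g (gx k x * b) = opXX k x (g b))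
    (x : X) (b : B k X) :
    compRight f g (gx k x * b) =
      TensorProduct.map (lmul (gx k x)) (opXX k x) (compRight f g b) := by
  simp only [compRight, LinearMap.comp_apply]
  rw [hg]
  exact map_id_map_right (hf x) _ _

theorem comul_coassoc : compLeft (comul k X) (comul k X) = compRight (comul k X) (comul k X) := by
  refine linearMap_ext_generators ?_ (fun x b hb => ?_) (fun x b hb => ?_)
  · simp [compLeft, compRight, comul_one]
  · rw [compLeft_gx_mul comul_gx_mul comul_gx_mul, compRight_gx_mul comul_gx_mul comul_gx_mul, hb]
  · simp only [compLeft, compRight, LinearMap.comp_apply, LinearEquiv.coe_coe] at hb ⊢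
    rw [comul_ge_mul, map_add, map_add, map_add]
    have h1 : TensorProduct.map (comul k X) LinearMap.id (opEX k x (comul k X b)) = _ :=
      map_id_map_left (w := opEX k x + opOE k x) (comul_ge_mul x) _ _
    have h2 : TensorProduct.map (comul k X) LinearMap.id (opOE k x (comul k X b)) = _ :=
      map_id_map_left (w := TensorProduct.map (signOp (deg k X)) (signOp (deg k X)))
        comul_signOp _ _
    have h3 : TensorProduct.map LinearMap.id (comul k X) (opEX k x (comul k X b)) = _ :=
      map_id_map_right (w := opXX k x) (comul_gx_mul x) _ _
    have h4 : TensorProduct.map LinearMap.id (comul k X) (opOE k x (comul k X b)) = _ :=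
      map_id_map_right (w := opEX k x + opOE k x) (comul_ge_mul x) _ _
    rw [h1, h2, h3, h4, TensorProduct.map_add_left, TensorProduct.map_add_right,
      LinearMap.add_apply, LinearMap.add_apply, map_add, opEX, opOE, assoc_map_map,
      assoc_map_map, assoc_map_map, hb, opXX, add_assoc]

/-- At `e_x b` this is coassociativity at `b`, multiplied by `e_x ⊗ x ⊗ x`. -/
theorem leftHalf_dendriform :
    compLeft (leftHalf k X) (leftHalf k X) = compRight (comul k X) (leftHalf k X) := by
  refine linearMap_ext_generators ?_ (fun x b hb => ?_) (fun x b _ => ?_)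
  · simp [compLeft, compRight]
  · rw [compLeft_gx_mul leftHalf_gx_mul leftHalf_gx_mul,
      compRight_gx_mul comul_gx_mul leftHalf_gx_mul, hb]
  · have hb := LinearMap.congr_fun (comul_coassoc (k := k) (X := X)) b
    simp only [compLeft, compRight, LinearMap.comp_apply, LinearEquiv.coe_coe] at hb ⊢
    rw [leftHalf_ge_mul]
    have h1 : TensorProduct.map (leftHalf k X) LinearMap.id (opEX k x (comul k X b)) = _ :=
      map_id_map_left (w := opEX k x) (leftHalf_ge_mul x) _ _
    have h2 : TensorProduct.map LinearMap.id (comul k X) (opEX k x (comul k X b)) = _ :=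
      map_id_map_right (w := opXX k x) (comul_gx_mul x) _ _
    rw [h1, h2, opEX, assoc_map_map, hb, opXX]

/-- At `e_x b` this is coassociativity at `b`, multiplied by `1 ⊗ 1 ⊗ e_x`. -/
theorem rightHalf_dendriform :
    compRight (rightHalf k X) (rightHalf k X) = compLeft (comul k X) (rightHalf k X) := by
  refine linearMap_ext_generators ?_ (fun x b hb => ?_) (fun x b _ => ?_)
  · simp [compLeft, compRight]
  · rw [compRight_gx_mul rightHalf_gx_mul rightHalf_gx_mul,
      compLeft_gx_mul comul_gx_mul rightHalf_gx_mul, hb]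
  · have hb := LinearMap.congr_fun (comul_coassoc (k := k) (X := X)) b
    simp only [compLeft, compRight, LinearMap.comp_apply, LinearEquiv.coe_coe] at hb ⊢
    rw [rightHalf_ge_mul]
    have h1 : TensorProduct.map LinearMap.id (rightHalf k X) (opOE k x (comul k X b)) = _ :=
      map_id_map_right (w := opOE k x) (rightHalf_ge_mul x) _ _
    have h2 : TensorProduct.map (comul k X) LinearMap.id (opOE k x (comul k X b)) = _ :=
      map_id_map_left (w := TensorProduct.map (signOp (deg k X)) (signOp (deg k X)))
        comul_signOp _ _
    rw [h1, h2, assoc_map_map, hb, opOE]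

/-- At `e_x b` this is coassociativity at `b`, multiplied by `1 ⊗ e_x ⊗ x`. -/
theorem middle_dendriform :
    compRight (leftHalf k X) (rightHalf k X) = compLeft (rightHalf k X) (leftHalf k X) := by
  refine linearMap_ext_generators ?_ (fun x b hb => ?_) (fun x b _ => ?_)
  · simp [compLeft, compRight]
  · rw [compRight_gx_mul leftHalf_gx_mul rightHalf_gx_mul,
      compLeft_gx_mul rightHalf_gx_mul leftHalf_gx_mul, hb]
  · have hb := LinearMap.congr_fun (comul_coassoc (k := k) (X := X)) b
    simp only [compLeft, compRight, LinearMap.comp_apply, LinearEquiv.coe_coe] at hb ⊢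
    rw [rightHalf_ge_mul, leftHalf_ge_mul]
    have h1 : TensorProduct.map LinearMap.id (leftHalf k X) (opOE k x (comul k X b)) = _ :=
      map_id_map_right (w := opEX k x) (leftHalf_ge_mul x) _ _
    have h2 : TensorProduct.map (rightHalf k X) LinearMap.id (opEX k x (comul k X b)) = _ :=
      map_id_map_left (w := opOE k x) (rightHalf_ge_mul x) _ _
    rw [h1, h2, opOE, assoc_map_map, hb, opEX]

theorem opXX_mem {n : ℕ} (x : X) {t : B k X ⊗[k] B k X} (ht : t ∈ tensorDegree (deg k X) n) :
    opXX k x t ∈ tensorDegree (deg k X) n :=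
  map_mem_tensorDegree (a := 0) (b := 0) (fun _ _ hc => gx_mul_mem x hc)
    (fun _ _ hc => gx_mul_mem x hc) ht

theorem opEX_mem {n : ℕ} (x : X) {t : B k X ⊗[k] B k X} (ht : t ∈ tensorDegree (deg k X) n) :
    opEX k x t ∈ tensorDegree (deg k X) (n + 1) :=
  map_mem_tensorDegree (a := 1) (b := 0) (fun _ _ hc => ge_mul_mem x hc)
    (fun _ _ hc => gx_mul_mem x hc) ht

theorem opOE_mem {n : ℕ} (x : X) {t : B k X ⊗[k] B k X} (ht : t ∈ tensorDegree (deg k X) n) :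
    opOE k x t ∈ tensorDegree (deg k X) (n + 1) :=
  map_mem_tensorDegree (a := 0) (b := 1) (fun _ _ hc => signOp_mem hc)
    (fun _ _ hc => ge_mul_mem x hc) ht

theorem opXE_mem {n : ℕ} (x : X) {t : B k X ⊗[k] B k X} (ht : t ∈ tensorDegree (deg k X) n) :
    opXE k x t ∈ tensorDegree (deg k X) (n + 1) :=
  map_mem_tensorDegree (a := 0) (b := 1) (fun _ _ hc => gx_mul_mem x (signOp_mem hc))
    (fun _ _ hc => ge_mul_mem x hc) ht

theorem opEO_mem {n : ℕ} (x : X) {t : B k X ⊗[k] B k X} (ht : t ∈ tensorDegree (deg k X) n) :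
    opEO k x t ∈ tensorDegree (deg k X) (n + 1) :=
  map_mem_tensorDegree (a := 1) (b := 0) (fun _ _ hc => ge_mul_mem x hc) (fun _ _ hc => hc) ht

theorem opEE_mem {n : ℕ} (x : X) {t : B k X ⊗[k] B k X} (ht : t ∈ tensorDegree (deg k X) n) :
    opEE k x t ∈ tensorDegree (deg k X) (n + 2) :=
  map_mem_tensorDegree (a := 1) (b := 1) (fun _ _ hc => ge_mul_mem x (signOp_mem hc))
    (fun _ _ hc => ge_mul_mem x hc) ht

theorem comul_mem {n : ℕ} {b : B k X} (hb : b ∈ deg k X n) :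
    comul k X b ∈ tensorDegree (deg k X) n := by
  refine deg_le (N := fun n => (tensorDegree (deg k X) n).comap (comul k X)) ?_ ?_ ?_ n hb
  · rw [Submodule.mem_comap, comul_one]
    exact tmul_mem_tensorDegree (i := 0) (j := 0) SetLike.GradedOne.one_mem
      SetLike.GradedOne.one_mem
  · intro n x b hb
    rw [Submodule.mem_comap, comul_gx_mul]
    exact opXX_mem x hb
  · intro n x b _ hb
    rw [Submodule.mem_comap, comul_ge_mul]
    exact add_mem (opEX_mem x hb) (opOE_mem x hb)

theorem leftHalf_mem {n : ℕ} {b : B k X} (hb : b ∈ deg k X n) :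
    leftHalf k X b ∈ tensorDegree (deg k X) n := by
  refine deg_le (N := fun n => (tensorDegree (deg k X) n).comap (leftHalf k X)) ?_ ?_ ?_ n hb
  · simp
  · intro n x b hb
    rw [Submodule.mem_comap, leftHalf_gx_mul]
    exact opXX_mem x hb
  · intro n x b hb _
    rw [Submodule.mem_comap, leftHalf_ge_mul]
    exact opEX_mem x (comul_mem hb)

theorem rightHalf_mem {n : ℕ} {b : B k X} (hb : b ∈ deg k X n) :
    rightHalf k X b ∈ tensorDegree (deg k X) n := by
  refine deg_le (N := fun n => (tensorDegree (deg k X) n).comap (rightHalf k X)) ?_ ?_ ?_ n hb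
  · simp
  · intro n x b hb
    rw [Submodule.mem_comap, rightHalf_gx_mul]
    exact opXX_mem x hb
  · intro n x b hb _
    rw [Submodule.mem_comap, rightHalf_ge_mul]
    exact opOE_mem x (comul_mem hb)

theorem homotopyH_mem {n : ℕ} {b : B k X} (hb : b ∈ deg k X n) :
    homotopyH k X b ∈ tensorDegree (deg k X) (n + 1) := by
  refine deg_le (N := fun n => (tensorDegree (deg k X) (n + 1)).comap (homotopyH k X))
    ?_ ?_ ?_ n hb
  · simp
  · intro n x b hb
    rw [Submodule.mem_comap, homotopyH_gx_mul]
    exact opXX_mem x hb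
  · intro n x b hb hb'
    rw [Submodule.mem_comap, homotopyH_ge_mul]
    exact sub_mem (opEE_mem x (comul_mem hb)) (add_mem (opXE_mem x hb') (opEO_mem x hb'))

theorem homotopyBar_mem {n : ℕ} {b : B k X} (hb : b ∈ deg k X n) :
    homotopyBar k X b ∈ tensorDegree (deg k X) (n + 1) := by
  refine deg_le (N := fun n => (tensorDegree (deg k X) (n + 1)).comap (homotopyBar k X))
    ?_ ?_ ?_ n hb
  · simp
  · intro n x b hb
    rw [Submodule.mem_comap, homotopyBar_gx_mul]
    exact opXX_mem x hb
  · intro n x b hb _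
    rw [Submodule.mem_comap, homotopyBar_ge_mul]
    exact neg_mem (opXE_mem x (homotopyH_mem hb))

/-- An equivariant map that vanishes at `1` vanishes in degree `0`. -/
theorem apply_eq_zero_of_mem_deg_zero {f : B k X →ₗ[k] B k X ⊗[k] B k X}
    (hf : ∀ x b, f (gx k x * b) = opXX k x (f b)) (h1 : f 1 = 0) {b : B k X}
    (hb : b ∈ deg k X 0) : f b = 0 := by
  let N : ℕ → Submodule k (B k X) := fun n => Nat.casesOn n (LinearMap.ker f) fun _ => ⊤
  have h : ∀ n, deg k X n ≤ N n := by
    refine deg_le h1 ?_ (fun _ _ _ _ _ => trivial)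
    intro n x b hb
    cases n with
    | zero =>
      have hb : f b = 0 := hb
      change f (gx k x * b) = 0
      rw [hf, hb, map_zero]
    | succ n => trivial
  exact h 0 hb

theorem gx_mul_mem_plus (x : X) {b : B k X} (hb : b ∈ plus (deg k X)) :
    gx k x * b ∈ plus (deg k X) := by
  have h : plus (deg k X) ≤ (plus (deg k X)).comap (lmul (gx k x)) :=
    iSup_le fun n b hb => mem_plus (gx_mul_mem x hb)
  exact h hb

theorem ge_mul_mem_plus (x : X) (b : B k X) : ge k x * b ∈ plus (deg k X) := by
  induction b using DirectSum.Decomposition.inductionOn (deg k X) with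
  | zero => simp
  | homogeneous b => exact mem_plus (ge_mul_mem x b.2)
  | add m n hm hn => rw [mul_add]; exact add_mem hm hn

theorem leftHalf_mem_plusTensor (b : B k X) : leftHalf k X b ∈ plusTensor (deg k X) := by
  have h : (plusTensor (deg k X)).comap (leftHalf k X) = ⊤ := by
    refine eq_top_of_generators (by simp) (fun x b hb => ?_) (fun x b _ => ?_)
    · rw [Submodule.mem_comap, leftHalf_gx_mul]
      exact map_mem_plusTensor (fun c hc => gx_mul_mem_plus x hc) hb
    · rw [Submodule.mem_comap, leftHalf_ge_mul]
      exact map_mem_plusTensor_of_range (fun c => ge_mul_mem_plus x c) _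
  exact (h ▸ Submodule.mem_top : b ∈ (plusTensor (deg k X)).comap (leftHalf k X))

theorem rightHalf_mem_tensorPlus (b : B k X) : rightHalf k X b ∈ tensorPlus (deg k X) := by
  have h : (tensorPlus (deg k X)).comap (rightHalf k X) = ⊤ := by
    refine eq_top_of_generators (by simp) (fun x b hb => ?_) (fun x b _ => ?_)
    · rw [Submodule.mem_comap, rightHalf_gx_mul]
      exact map_mem_tensorPlus (fun c hc => gx_mul_mem_plus x hc) hb
    · rw [Submodule.mem_comap, rightHalf_ge_mul]
      exact map_mem_tensorPlus_of_range (fun c => ge_mul_mem_plus x c) _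
  exact (h ▸ Submodule.mem_top : b ∈ (tensorPlus (deg k X)).comap (rightHalf k X))

theorem comul_eq_leftHalf_add_rightHalf {b : B k X} (hb : b ∈ plus (deg k X)) :
    comul k X b = leftHalf k X b + rightHalf k X b := by
  have h : plus (deg k X) ≤ LinearMap.eqLocus (comul k X) (leftHalf k X + rightHalf k X) := by
    refine plus_deg_le (fun x b hb => ?_) (fun x b => ?_)
    · have hb : comul k X b = leftHalf k X b + rightHalf k X b := hb
      change comul k X (gx k x * b) = leftHalf k X (gx k x * b) + rightHalf k X (gx k x * b)
      rw [comul_gx_mul, leftHalf_gx_mul, rightHalf_gx_mul, hb, map_add]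
    · change comul k X (ge k x * b) = leftHalf k X (ge k x * b) + rightHalf k X (ge k x * b)
      rw [comul_ge_mul, leftHalf_ge_mul, rightHalf_ge_mul]
  exact h hb

theorem isPlusCodendriform_B :
    IsPlusCodendriform (deg k X) (comul k X) (leftHalf k X) (rightHalf k X) where
  Δ_degree _ _ := comul_mem
  L_zero _ := apply_eq_zero_of_mem_deg_zero leftHalf_gx_mul leftHalf_one
  R_zero _ := apply_eq_zero_of_mem_deg_zero rightHalf_gx_mul rightHalf_one
  L_degree _ _ := leftHalf_mem
  R_degree _ _ := rightHalf_mem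
  L_mem := leftHalf_mem_plusTensor
  R_mem := rightHalf_mem_tensorPlus
  dendri_left := leftHalf_dendriform
  dendri_right := rightHalf_dendriform
  dendri_mid := middle_dendriform
  splitting _ := comul_eq_leftHalf_add_rightHalf
  coassoc_zero c _ := LinearMap.congr_fun comul_coassoc c

end Codendriform

/-! ### Differentials and homotopies on `B(X)` -/

section Differential

variable {k X : Type*} [CommRing k] [Shelf X]

variable (k X) in
/-- The differential `d ⊗ Id + Id ⊗ d` of `B ⊗ B`. -/
def tensorDiff : B k X ⊗[k] B k X →ₗ[k] B k X ⊗[k] B k X :=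
  leftD (diff k X) + rightD (deg k X) (diff k X)

@[simp] theorem tensorDiff_tmul (u v : B k X) :
    tensorDiff k X (u ⊗ₜ v) = diff k X u ⊗ₜ v + signOp (deg k X) u ⊗ₜ diff k X v := rfl

variable (k) in
/-- Left multiplication by `x ⊗ 1` on `B ⊗ B`. -/
def opXO (x : X) : B k X ⊗[k] B k X →ₗ[k] B k X ⊗[k] B k X :=
  TensorProduct.map (lmul (gx k x)) LinearMap.id

variable (k) in
/-- Left multiplication by `1 ⊗ x` on `B ⊗ B`. -/
def opOX (x : X) : B k X ⊗[k] B k X →ₗ[k] B k X ⊗[k] B k X :=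
  TensorProduct.map LinearMap.id (lmul (gx k x))

@[simp] theorem opXO_tmul (x : X) (u v : B k X) : opXO k x (u ⊗ₜ v) = (gx k x * u) ⊗ₜ v := rfl

@[simp] theorem opOX_tmul (x : X) (u v : B k X) : opOX k x (u ⊗ₜ v) = u ⊗ₜ (gx k x * v) := rfl

/-- As `d ⊗ Id + Id ⊗ d` is a super-derivation of the algebra `B ⊗ B`, its commutators with left
multiplications are given by the differentials of the multipliers. -/
theorem tensorDiff_opXX (x : X) (t : B k X ⊗[k] B k X) :
    tensorDiff k X (opXX k x t) = opXX k x (tensorDiff k X t) := by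
  induction t with
  | zero => simp
  | tmul u v => simp
  | add s t hs ht => simp only [map_add, hs, ht]

theorem tensorDiff_opEX (x : X) (t : B k X ⊗[k] B k X) :
    tensorDiff k X (opEX k x t) = opOX k x t - opXX k x t - opEX k x (tensorDiff k X t) := by
  induction t with
  | zero => simp
  | tmul u v => simp [TensorProduct.sub_tmul, TensorProduct.neg_tmul]; abel
  | add s t hs ht => simp only [map_add, hs, ht]; abel

theorem tensorDiff_opOE (x : X) (t : B k X ⊗[k] B k X) :
    tensorDiff k X (opOE k x t) = t - opOX k x t - opOE k x (tensorDiff k X t) := by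
  induction t with
  | zero => simp
  | tmul u v => simp [TensorProduct.tmul_sub, TensorProduct.neg_tmul]; abel
  | add s t hs ht => simp only [map_add, hs, ht]; abel

theorem tensorDiff_opEO (x : X) (t : B k X ⊗[k] B k X) :
    tensorDiff k X (opEO k x t) = t - opXO k x t - opEO k x (tensorDiff k X t) := by
  induction t with
  | zero => simp
  | tmul u v => simp [TensorProduct.sub_tmul, TensorProduct.neg_tmul]; abel
  | add s t hs ht => simp only [map_add, hs, ht]; abel

theorem tensorDiff_opXE (x : X) (t : B k X ⊗[k] B k X) :
    tensorDiff k X (opXE k x t) = opXO k x t - opXX k x t - opXE k x (tensorDiff k X t) := by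
  induction t with
  | zero => simp
  | tmul u v => simp [TensorProduct.tmul_sub, TensorProduct.neg_tmul]; abel
  | add s t hs ht => simp only [map_add, hs, ht]; abel

theorem tensorDiff_opEE (x : X) (t : B k X ⊗[k] B k X) :
    tensorDiff k X (opEE k x t) =
      opOE k x t - opXE k x t - opEO k x t + opEX k x t + opEE k x (tensorDiff k X t) := by
  induction t with
  | zero => simp
  | tmul u v =>
    simp [TensorProduct.sub_tmul, TensorProduct.tmul_sub, TensorProduct.neg_tmul]; abel
  | add s t hs ht => simp only [map_add, hs, ht]; abel

/-- The comultiplication is a chain map. -/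
theorem tensorDiff_comul (b : B k X) :
    tensorDiff k X (comul k X b) = comul k X (diff k X b) := by
  have h : tensorDiff k X ∘ₗ comul k X = comul k X ∘ₗ diff k X := by
    refine linearMap_ext_generators ?_ (fun x b hb => ?_) (fun x b hb => ?_)
    · simp [comul_one]
    · simp only [LinearMap.comp_apply] at hb ⊢
      rw [comul_gx_mul, tensorDiff_opXX, hb, diff_gx_mul, comul_gx_mul]
    · simp only [LinearMap.comp_apply] at hb ⊢
      rw [comul_ge_mul, map_add, tensorDiff_opEX, tensorDiff_opOE, hb, diff_ge_mul, map_sub,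
        map_sub, comul_gx_mul, comul_ge_mul]
      abel
  exact LinearMap.congr_fun h b

theorem lmul_gx_mem (x : X) (n : ℕ) (c : B k X) (hc : c ∈ deg k X n) :
    lmul (gx k x) c ∈ deg k X n := by
  rw [lmul_apply]
  exact gx_mul_mem x hc

theorem lmul_ge_mem (x : X) (n : ℕ) (c : B k X) (hc : c ∈ deg k X n) :
    lmul (ge k x) c ∈ deg k X (n + 1) := by
  rw [lmul_apply]
  exact ge_mul_mem x hc

theorem signedFlip_opXX (x : X) (t : B k X ⊗[k] B k X) :
    signedFlip (deg k X) (opXX k x t) = opXX k x (signedFlip (deg k X) t) :=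
  signedFlip_map_of_degree_zero (𝒞 := deg k X) (𝒞' := deg k X) (lmul_gx_mem x) t

theorem signedFlip_opEX (x : X) (t : B k X ⊗[k] B k X) :
    signedFlip (deg k X) (opEX k x t) = opXE k x (signedFlip (deg k X) t) :=
  signedFlip_map_odd_even (𝒞 := deg k X) (lmul_ge_mem x) (lmul_gx_mem x) t

theorem signedFlip_opOE (x : X) (t : B k X ⊗[k] B k X) :
    signedFlip (deg k X) (opOE k x t) = opEO k x (signedFlip (deg k X) t) :=
  signedFlip_map_sign_odd (𝒞 := deg k X) (lmul_ge_mem x) t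

/-- The map `h` is a homotopy from `Δ` to `τ Δ`. -/
theorem tensorDiff_homotopyH (b : B k X) :
    tensorDiff k X (homotopyH k X b) + homotopyH k X (diff k X b) =
      comul k X b - signedFlip (deg k X) (comul k X b) := by
  have h : tensorDiff k X ∘ₗ homotopyH k X + homotopyH k X ∘ₗ diff k X =
      comul k X - signedFlip (deg k X) ∘ₗ comul k X := by
    refine linearMap_ext_generators ?_ (fun x b hb => ?_) (fun x b hb => ?_)
    · have h1 : signedFlip (deg k X) ((1 : B k X) ⊗ₜ[k] (1 : B k X)) = 1 ⊗ₜ 1 := by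
        simpa using signedFlip_tmul (k := k) (𝒞 := deg k X)
          (SetLike.GradedOne.one_mem : (1 : B k X) ∈ deg k X 0) SetLike.GradedOne.one_mem
      simp [comul_one, h1]
    · simp only [LinearMap.comp_apply, LinearMap.add_apply, LinearMap.sub_apply] at hb ⊢
      rw [homotopyH_gx_mul, tensorDiff_opXX, diff_gx_mul, homotopyH_gx_mul, comul_gx_mul,
        signedFlip_opXX, ← map_add, hb, map_sub]
    · simp only [LinearMap.comp_apply, LinearMap.add_apply, LinearMap.sub_apply] at hb ⊢
      rw [← eq_sub_iff_add_eq] at hb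
      rw [homotopyH_ge_mul, map_sub, map_add, tensorDiff_opEE, tensorDiff_opXE, tensorDiff_opEO,
        diff_ge_mul, map_sub, map_sub, homotopyH_gx_mul, homotopyH_ge_mul, comul_ge_mul, map_add,
        signedFlip_opEX, signedFlip_opOE, tensorDiff_comul, hb]
      simp only [map_sub]
      abel
  exact LinearMap.congr_fun h b

end Differential

/-! ### Descent to the quotient `B̄(X)` -/

section Quotient

variable {k X : Type*} [CommRing k] [Shelf X]

theorem proj_surjective : Function.Surjective (proj k X) := Submodule.mkQ_surjective _

theorem proj_mem {n : ℕ} {b : B k X} (hb : b ∈ deg k X n) : proj k X b ∈ degBar k X n :=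
  Submodule.mem_map_of_mem hb

/-- Two linear maps on `B̄` are equal if they agree at `1` and at the classes of all `e_x b`. -/
theorem Bbar_ext {M : Type*} [AddCommGroup M] [Module k M] {f g : Bbar k X →ₗ[k] M}
    (h1 : f (proj k X 1) = g (proj k X 1))
    (he : ∀ x b, f (proj k X (ge k x * b)) = g (proj k X (ge k x * b))) : f = g := by
  have h : f ∘ₗ proj k X = g ∘ₗ proj k X := by
    refine linearMap_ext_generators h1 (fun x b hb => ?_) (fun x b _ => he x b)
    simpa [proj_gx_mul] using hb
  refine LinearMap.ext fun c => ?_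
  obtain ⟨b, rfl⟩ := proj_surjective c
  exact LinearMap.congr_fun h b

theorem proj_ext {M : Type*} [AddCommGroup M] [Module k M] {f g : Bbar k X →ₗ[k] M}
    (h : ∀ b, f (proj k X b) = g (proj k X b)) : f = g := by
  refine LinearMap.ext fun c => ?_
  obtain ⟨b, rfl⟩ := proj_surjective c
  exact h b

@[simp] theorem proj₂_tmul (u v : B k X) :
    proj₂ k X (u ⊗ₜ v) = proj k X u ⊗ₜ proj k X v := rfl

theorem proj₂_opXX (x : X) (t : B k X ⊗[k] B k X) : proj₂ k X (opXX k x t) = proj₂ k X t := by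
  induction t with
  | zero => simp
  | tmul u v => simp [proj_gx_mul]
  | add s t hs ht => simp only [map_add, hs, ht]

theorem proj₂_opXO (x : X) (t : B k X ⊗[k] B k X) : proj₂ k X (opXO k x t) = proj₂ k X t := by
  induction t with
  | zero => simp
  | tmul u v => simp [proj_gx_mul]
  | add s t hs ht => simp only [map_add, hs, ht]

theorem proj₂_opOX (x : X) (t : B k X ⊗[k] B k X) : proj₂ k X (opOX k x t) = proj₂ k X t := by
  induction t with
  | zero => simp
  | tmul u v => simp [proj_gx_mul]
  | add s t hs ht => simp only [map_add, hs, ht]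

theorem proj₂_opXE (x : X) (t : B k X ⊗[k] B k X) :
    proj₂ k X (opXE k x t) = proj₂ k X (opOE k x t) := by
  induction t with
  | zero => simp
  | tmul u v => simp [proj_gx_mul]
  | add s t hs ht => simp only [map_add, hs, ht]

/-- The map `B̄ → B̄ ⊗ B̄` induced by an equivariant map `B → B ⊗ B`. -/
def barMap (f : B k X →ₗ[k] B k X ⊗[k] B k X) (hf : ∀ x b, f (gx k x * b) = opXX k x (f b)) :
    Bbar k X →ₗ[k] Bbar k X ⊗[k] Bbar k X :=
  barLift (proj₂ k X ∘ₗ f) (fun x b => by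
    rw [LinearMap.comp_apply, hf, proj₂_opXX, LinearMap.comp_apply])

variable (k X)

/-- The left half of the comultiplication of `B̄`. -/
def leftBar : Bbar k X →ₗ[k] Bbar k X ⊗[k] Bbar k X := barMap (leftHalf k X) leftHalf_gx_mul

/-- The right half of the comultiplication of `B̄`. -/
def rightBar : Bbar k X →ₗ[k] Bbar k X ⊗[k] Bbar k X := barMap (rightHalf k X) rightHalf_gx_mul

/-- The homotopy on `B̄`. -/
def homBar : Bbar k X →ₗ[k] Bbar k X ⊗[k] Bbar k X := barMap (homotopyBar k X) homotopyBar_gx_mul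

variable {k X}

theorem leftBar_proj (b : B k X) : leftBar k X (proj k X b) = proj₂ k X (leftHalf k X b) := rfl

theorem rightBar_proj (b : B k X) : rightBar k X (proj k X b) = proj₂ k X (rightHalf k X b) := rfl

theorem homBar_proj (b : B k X) : homBar k X (proj k X b) = proj₂ k X (homotopyBar k X b) := rfl

theorem comulBar_proj (b : B k X) : comulBar k X (proj k X b) = proj₂ k X (comul k X b) := rfl

theorem diffBar_proj (b : B k X) : diffBar k X (proj k X b) = proj k X (diff k X b) := rfl

theorem signOp_proj (b : B k X) :
    signOp (degBar k X) (proj k X b) = proj k X (signOp (deg k X) b) :=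
  signOp_apply_of_degree_zero (𝒞 := deg k X) (𝒞' := degBar k X) (fun _ _ => proj_mem) b

theorem proj₂_mem {n : ℕ} {t : B k X ⊗[k] B k X} (ht : t ∈ tensorDegree (deg k X) n) :
    proj₂ k X t ∈ tensorDegree (degBar k X) n :=
  map_mem_tensorDegree (a := 0) (b := 0) (fun _ _ => proj_mem) (fun _ _ => proj_mem) ht

theorem proj_mem_plus {b : B k X} (hb : b ∈ plus (deg k X)) :
    proj k X b ∈ plus (degBar k X) := by
  have h : plus (deg k X) ≤ (plus (degBar k X)).comap (proj k X) :=
    iSup_le fun n b hb => mem_plus (proj_mem hb)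
  exact h hb

theorem exists_of_mem_plus {c : Bbar k X} (hc : c ∈ plus (degBar k X)) :
    ∃ b ∈ plus (deg k X), proj k X b = c := by
  have h : plus (degBar k X) ≤ (plus (deg k X)).map (proj k X) :=
    iSup_le fun n => Submodule.map_mono (le_iSup (fun n => deg k X (n + 1)) n)
  exact h hc

variable (k X) in
/-- The differential `d ⊗ Id + Id ⊗ d` of `B̄ ⊗ B̄`. -/
def tensorDiffBar : Bbar k X ⊗[k] Bbar k X →ₗ[k] Bbar k X ⊗[k] Bbar k X :=
  leftD (diffBar k X) + rightD (degBar k X) (diffBar k X)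

theorem tensorDiffBar_proj₂ (t : B k X ⊗[k] B k X) :
    tensorDiffBar k X (proj₂ k X t) = proj₂ k X (tensorDiff k X t) := by
  induction t with
  | zero => simp
  | tmul u v =>
    change diffBar k X (proj k X u) ⊗ₜ proj k X v +
      signOp (degBar k X) (proj k X u) ⊗ₜ diffBar k X (proj k X v) = _
    simp [diffBar_proj, signOp_proj]
  | add s t hs ht => simp only [map_add, hs, ht]

theorem leftBar_diffBar (c : Bbar k X) :
    leftBar k X (diffBar k X c) = tensorDiffBar k X (leftBar k X c) := by
  have h : leftBar k X ∘ₗ diffBar k X = tensorDiffBar k X ∘ₗ leftBar k X := by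
    refine Bbar_ext ?_ (fun x b => ?_)
    · simp [leftBar_proj, diffBar_proj]
    · simp only [LinearMap.comp_apply, leftBar_proj, diffBar_proj, tensorDiffBar_proj₂,
        diff_ge_mul, leftHalf_ge_mul, leftHalf_gx_mul, map_sub, tensorDiff_opEX, proj₂_opXX,
        proj₂_opOX, tensorDiff_comul]
      abel
  exact LinearMap.congr_fun h c

theorem rightBar_diffBar (c : Bbar k X) :
    rightBar k X (diffBar k X c) = tensorDiffBar k X (rightBar k X c) := by
  have h : rightBar k X ∘ₗ diffBar k X = tensorDiffBar k X ∘ₗ rightBar k X := by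
    refine Bbar_ext ?_ (fun x b => ?_)
    · simp [rightBar_proj, diffBar_proj]
    · simp only [LinearMap.comp_apply, rightBar_proj, diffBar_proj, tensorDiffBar_proj₂,
        diff_ge_mul, rightHalf_ge_mul, rightHalf_gx_mul, map_sub, tensorDiff_opOE, proj₂_opXX,
        proj₂_opOX, tensorDiff_comul]
      abel
  exact LinearMap.congr_fun h c

theorem signedFlip_proj₂ (t : B k X ⊗[k] B k X) :
    signedFlip (degBar k X) (proj₂ k X t) = proj₂ k X (signedFlip (deg k X) t) :=
  signedFlip_map_of_degree_zero (𝒞 := deg k X) (𝒞' := degBar k X) (fun _ _ => proj_mem) t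

/-- The map induced by `h̄` is a homotopy between the right half of `Δ` and the signed flip of
its left half. As `h̄(e_x b) = -(x ⊗ e_x) h(b)`, the identity at `e_x b` is that of
`tensorDiff_homotopyH` at `b`, multiplied by `x ⊗ e_x`, up to terms that vanish in `B̄`. -/
theorem tensorDiffBar_homBar (c : Bbar k X) :
    tensorDiffBar k X (homBar k X c) + homBar k X (diffBar k X c) =
      rightBar k X c - signedFlip (degBar k X) (leftBar k X c) := by
  have h : tensorDiffBar k X ∘ₗ homBar k X + homBar k X ∘ₗ diffBar k X =
      rightBar k X - signedFlip (degBar k X) ∘ₗ leftBar k X := by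
    refine Bbar_ext ?_ (fun x b => ?_)
    · simp [leftBar_proj, rightBar_proj, homBar_proj, diffBar_proj]
    · have hb := tensorDiff_homotopyH b
      rw [← eq_sub_iff_add_eq] at hb
      simp only [LinearMap.comp_apply, LinearMap.add_apply, LinearMap.sub_apply, homBar_proj,
        diffBar_proj, leftBar_proj, rightBar_proj, tensorDiffBar_proj₂, diff_ge_mul,
        homotopyBar_ge_mul, homotopyBar_gx_mul, leftHalf_ge_mul, rightHalf_ge_mul, map_sub,
        map_neg, tensorDiff_opXE, hb, signedFlip_proj₂, signedFlip_opEX, proj₂_opXX, proj₂_opXO]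
      simp only [proj₂_opXE]
      abel
  exact LinearMap.congr_fun h c

theorem homBar_ges (x : X) (xs : List X) :
    homBar k X (proj k X (ges k (x :: xs))) =
      proj₂ k X ((ofBB k X).symm (-(tm 1 (ge k x) * ofBB k X (homotopyH k X (ges k xs))))) := by
  rw [← ofBB_opOE, map_neg, map_neg, LinearEquiv.symm_apply_apply, homBar_proj, ges_cons,
    homotopyBar_ge_mul, map_neg, proj₂_opXE]

theorem homBar_mem {n : ℕ} {c : Bbar k X} (hc : c ∈ degBar k X n) :
    homBar k X c ∈ tensorDegree (degBar k X) (n + 1) := by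
  obtain ⟨b, hb, rfl⟩ := hc
  exact proj₂_mem (homotopyBar_mem hb)

variable (k X) in
/-- The projection `B ⊗ (B ⊗ B) → B̄ ⊗ (B̄ ⊗ B̄)`. -/
def proj₃ : B k X ⊗[k] (B k X ⊗[k] B k X) →ₗ[k] Bbar k X ⊗[k] (Bbar k X ⊗[k] Bbar k X) :=
  TensorProduct.map (proj k X) (proj₂ k X)

theorem compLeft_proj {f g : B k X →ₗ[k] B k X ⊗[k] B k X}
    {f' g' : Bbar k X →ₗ[k] Bbar k X ⊗[k] Bbar k X}
    (hf : ∀ b, f' (proj k X b) = proj₂ k X (f b)) (hg : ∀ b, g' (proj k X b) = proj₂ k X (g b))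
    (b : B k X) : compLeft f' g' (proj k X b) = proj₃ k X (compLeft f g b) := by
  simp only [compLeft, LinearMap.comp_apply, LinearEquiv.coe_coe, hg]
  have key : ∀ t, TensorProduct.assoc k _ _ _
      (TensorProduct.map (proj₂ k X) (proj k X) t) =
      proj₃ k X (TensorProduct.assoc k _ _ _ t) := fun t =>
    (LinearMap.congr_fun
      (TensorProduct.map_map_comp_assoc_eq (proj k X) (proj k X) (proj k X)) t).symm
  rw [← key]
  congr 1
  induction g b with
  | zero => simp
  | tmul u v => simp [hf]
  | add s t hs ht => simp only [map_add, hs, ht]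

theorem compRight_proj {f g : B k X →ₗ[k] B k X ⊗[k] B k X}
    {f' g' : Bbar k X →ₗ[k] Bbar k X ⊗[k] Bbar k X}
    (hf : ∀ b, f' (proj k X b) = proj₂ k X (f b)) (hg : ∀ b, g' (proj k X b) = proj₂ k X (g b))
    (b : B k X) : compRight f' g' (proj k X b) = proj₃ k X (compRight f g b) := by
  simp only [compRight, LinearMap.comp_apply, hg]
  induction g b with
  | zero => simp
  | tmul u v => simp [hf, proj₃]
  | add s t hs ht => simp only [map_add, hs, ht]

theorem comulBar_mem {n : ℕ} {c : Bbar k X} (hc : c ∈ degBar k X n) :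
    comulBar k X c ∈ tensorDegree (degBar k X) n := by
  obtain ⟨b, hb, rfl⟩ := hc
  exact proj₂_mem (comul_mem hb)

theorem leftBar_mem {n : ℕ} {c : Bbar k X} (hc : c ∈ degBar k X n) :
    leftBar k X c ∈ tensorDegree (degBar k X) n := by
  obtain ⟨b, hb, rfl⟩ := hc
  exact proj₂_mem (leftHalf_mem hb)

theorem rightBar_mem {n : ℕ} {c : Bbar k X} (hc : c ∈ degBar k X n) :
    rightBar k X c ∈ tensorDegree (degBar k X) n := by
  obtain ⟨b, hb, rfl⟩ := hc
  exact proj₂_mem (rightHalf_mem hb)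

theorem comulBar_eq_add {c : Bbar k X} (hc : c ∈ plus (degBar k X)) :
    comulBar k X c = leftBar k X c + rightBar k X c := by
  obtain ⟨b, hb, rfl⟩ := exists_of_mem_plus hc
  rw [comulBar_proj, comul_eq_leftHalf_add_rightHalf hb, map_add, leftBar_proj, rightBar_proj]

theorem isPlusCodendriform_Bbar :
    IsPlusCodendriform (degBar k X) (comulBar k X) (leftBar k X) (rightBar k X) where
  Δ_degree _ _ := comulBar_mem
  L_zero c hc := by
    obtain ⟨b, hb, rfl⟩ := hc
    rw [leftBar_proj, isPlusCodendriform_B.L_zero b hb, map_zero]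
  R_zero c hc := by
    obtain ⟨b, hb, rfl⟩ := hc
    rw [rightBar_proj, isPlusCodendriform_B.R_zero b hb, map_zero]
  L_degree _ _ := leftBar_mem
  R_degree _ _ := rightBar_mem
  L_mem c := by
    obtain ⟨b, rfl⟩ := proj_surjective c
    exact map_mem_plusTensor (fun _ => proj_mem_plus) (leftHalf_mem_plusTensor b)
  R_mem c := by
    obtain ⟨b, rfl⟩ := proj_surjective c
    exact map_mem_tensorPlus (fun _ => proj_mem_plus) (rightHalf_mem_tensorPlus b)
  dendri_left := proj_ext fun b => by
    rw [compLeft_proj leftBar_proj leftBar_proj, compRight_proj comulBar_proj leftBar_proj,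
      leftHalf_dendriform]
  dendri_right := proj_ext fun b => by
    rw [compRight_proj rightBar_proj rightBar_proj, compLeft_proj comulBar_proj rightBar_proj,
      rightHalf_dendriform]
  dendri_mid := proj_ext fun b => by
    rw [compRight_proj leftBar_proj rightBar_proj, compLeft_proj rightBar_proj leftBar_proj,
      middle_dendriform]
  splitting _ := comulBar_eq_add
  coassoc_zero c _ := by
    obtain ⟨b, rfl⟩ := proj_surjective c
    rw [compLeft_proj comulBar_proj comulBar_proj, compRight_proj comulBar_proj comulBar_proj,
      comul_coassoc]

theorem diffBar_mem {n : ℕ} {c : Bbar k X} (hc : c ∈ degBar k X (n + 1)) :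
    diffBar k X c ∈ degBar k X n := by
  obtain ⟨b, hb, rfl⟩ := hc
  exact proj_mem (diff_mem_deg hb)

theorem diffBar_of_mem_zero {c : Bbar k X} (hc : c ∈ degBar k X 0) : diffBar k X c = 0 := by
  obtain ⟨b, hb, rfl⟩ := hc
  rw [diffBar_proj, diff_of_mem_deg_zero hb, map_zero]

theorem diffBar_diffBar (c : Bbar k X) : diffBar k X (diffBar k X c) = 0 := by
  obtain ⟨b, rfl⟩ := proj_surjective c
  rw [diffBar_proj, diffBar_proj, diff_diff, map_zero]

/-- `B̄_n` is spanned by the classes of the words `e_{x₁} ⋯ e_{x_n}`. -/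
theorem degBar_le {n : ℕ} {N : Submodule k (Bbar k X)}
    (h : ∀ x : Fin n → X, proj k X (ges k (List.ofFn x)) ∈ N) : degBar k X n ≤ N := by
  let N' : ℕ → Submodule k (B k X) := fun n =>
    Submodule.span k {b | ∃ as xs : List X, xs.length = n ∧ b = gxs k as * ges k xs}
  have h' : ∀ n, deg k X n ≤ N' n := by
    refine deg_le (Submodule.subset_span ⟨[], [], rfl, by simp⟩) ?_ ?_
    · intro n x
      refine Submodule.span_le (p := (N' n).comap (lmul (gx k x))).2 ?_
      rintro _ ⟨as, xs, hxs, rfl⟩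
      exact Submodule.subset_span ⟨x :: as, xs, hxs, by
        rw [gxs_cons, mul_assoc, lmul_apply]⟩
    · intro n x b _ hb
      refine Submodule.span_le (p := (N' (n + 1)).comap (lmul (ge k x))).2 ?_ hb
      rintro _ ⟨as, xs, hxs, rfl⟩
      obtain ⟨y, hy⟩ := ge_mul_gxs (k := k) x as
      exact Submodule.subset_span ⟨as, y :: xs, by simp [hxs], by
        rw [ges_cons, lmul_apply, ← mul_assoc, hy, mul_assoc]⟩
  rintro _ ⟨b, hb, rfl⟩
  refine Submodule.span_le (p := N.comap (proj k X)).2 ?_ (h' n hb)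
  rintro _ ⟨as, xs, rfl, rfl⟩
  have hp : proj k X (gxs k as * ges k xs) = proj k X (ges k xs) := by
    induction as with
    | nil => simp
    | cons a as ih => rw [gxs_cons, mul_assoc, proj_gx_mul, ih]
  have hh := h xs.get
  rw [List.ofFn_get] at hh
  change proj k X (gxs k as * ges k xs) ∈ N
  rwa [hp]

theorem isDGPlusCodendriform_Bbar :
    IsDGPlusCodendriform (degBar k X) (diffBar k X) (comulBar k X) (leftBar k X)
      (rightBar k X) where
  toIsPlusCodendriform := isPlusCodendriform_Bbar
  d_degree _ _ := diffBar_mem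
  d_zero _ := diffBar_of_mem_zero
  d_d := diffBar_diffBar
  L_d _ c _ := leftBar_diffBar c
  R_d _ c _ := rightBar_diffBar c
  Δ_d_one := by
    have h : degBar k X 1 ≤ LinearMap.eqLocus (comulBar k X ∘ₗ diffBar k X)
        (leftD (diffBar k X) ∘ₗ leftBar k X +
          rightD (degBar k X) (diffBar k X) ∘ₗ rightBar k X) := by
      refine degBar_le fun x => ?_
      have hd : proj k X (1 - gx k (x 0)) = 0 := by
        have h := proj_gx_mul (k := k) (x 0) 1
        rw [mul_one] at h
        rw [map_sub, h, sub_self]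
      have hx : ges k (List.ofFn x) = ge k (x 0) * 1 := by simp [ges]
      rw [LinearMap.mem_eqLocus, LinearMap.add_apply, LinearMap.comp_apply, LinearMap.comp_apply,
        LinearMap.comp_apply, diffBar_proj, leftBar_proj, rightBar_proj, hx, leftHalf_ge_mul,
        rightHalf_ge_mul, comul_one, opEX_tmul, opOE_tmul, mul_one, proj₂_tmul, proj₂_tmul, diff_ge,
        hd]
      simp [leftD, rightD, diffBar_proj, hd]
    exact fun c hc => h hc

end Quotient

/-! ### Cochains as functionals on `B̄(X)` -/

section Functional

theorem face₀_zero {Y : Type*} {n : ℕ} (x : Fin (n + 1) → Y) : face₀ 0 x = fun j => x j.succ := by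
  funext j
  simp [face₀]

theorem face₀_succ {Y : Type*} {n : ℕ} (i : Fin (n + 1)) (x : Fin (n + 2) → Y) :
    face₀ i.succ x = Fin.cons (x 0) (face₀ i fun j => x j.succ) := by
  funext j
  refine Fin.cases ?_ (fun j => ?_) j
  · simp [face₀]
  · simp [face₀]

variable {k X : Type*} [CommRing k] [Shelf X]

theorem face₁_zero {n : ℕ} (x : Fin (n + 1) → X) : face₁ 0 x = fun j => x j.succ := by
  funext j
  simp [face₁]

theorem face₁_succ {n : ℕ} (i : Fin (n + 1)) (x : Fin (n + 2) → X) :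
    face₁ i.succ x =
      Fin.cons (Shelf.act (x i.succ) (x 0)) (face₁ i fun j => x j.succ) := by
  funext j
  refine Fin.cases ?_ (fun j => ?_) j
  · simp [face₁]
  · simp [face₁]

/-- The differential of a word, with the letters of degree `0` moved to the front. -/
theorem diff_ges (n : ℕ) (x : Fin (n + 1) → X) :
    diff k X (ges k (List.ofFn x)) = ∑ i : Fin (n + 1), (-1 : k) ^ (i : ℕ) •
      (ges k (List.ofFn (face₀ i x)) - gx k (x i) * ges k (List.ofFn (face₁ i x))) := by
  induction n with
  | zero => simp [ges_cons]
  | succ n ih =>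
    rw [List.ofFn_succ, ges_cons, diff_ge_mul, ih, Fin.sum_univ_succ (n := n + 1)]
    rw [face₀_zero, face₁_zero, Finset.mul_sum, sub_eq_add_neg _ (Finset.sum _ _),
      ← Finset.sum_neg_distrib]
    congr 1
    · simp
    · refine Finset.sum_congr rfl fun i _ => ?_
      rw [face₀_succ, face₁_succ, List.ofFn_cons, List.ofFn_cons, ges_cons, ges_cons,
        rel_ex_assoc, ← mul_sub, Fin.val_succ, pow_succ, mul_neg_one, neg_smul, mul_smul_comm]

/-- Linear maps on `B̄` that agree on words are equal. -/
theorem Bbar_ext_words {M : Type*} [AddCommGroup M] [Module k M] {f g : Bbar k X →ₗ[k] M}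
    (h : ∀ n (x : Fin n → X), f (proj k X (ges k (List.ofFn x))) =
      g (proj k X (ges k (List.ofFn x)))) : f = g :=
  linearMap_ext_homogeneous (degBar k X) fun n _ hc =>
    degBar_le (N := LinearMap.eqLocus f g) (h n) hc

theorem functional_word (p n : ℕ) (f : Cochain k X p) (x : Fin n → X) :
    functional k X p f (proj k X (ges k (List.ofFn x))) =
      if h : n = p then f (fun i => x (i.cast h.symm)) else 0 := by
  change Finsupp.linearCombination k _ (toWords k X _) = _
  rw [toWords_ges, Finsupp.linearCombination_single, one_smul]
  by_cases h : n = p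
  · subst h
    simp
  · simp [h]

theorem functional_word_self (n : ℕ) (f : Cochain k X n) (x : Fin n → X) :
    functional k X n f (proj k X (ges k (List.ofFn x))) = f x := by
  rw [functional_word, dif_pos rfl]
  rfl

theorem functional_injective (n : ℕ) : Function.Injective (functional k X n) := by
  intro f g h
  funext x
  rw [← functional_word_self n f, h, functional_word_self n g]

theorem functional_of_ne {p n : ℕ} (hn : n ≠ p) (f : Cochain k X p) {c : Bbar k X}
    (hc : c ∈ degBar k X n) : functional k X p f c = 0 := by
  refine degBar_le (N := LinearMap.ker (functional k X p f)) (fun x => ?_) hc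
  rw [LinearMap.mem_ker, functional_word, dif_neg hn]

theorem functional_signOp (p : ℕ) (f : Cochain k X p) (c : Bbar k X) :
    functional k X p f (signOp (degBar k X) c) = (-1 : k) ^ p * functional k X p f c := by
  have h : functional k X p f ∘ₗ signOp (degBar k X) = (-1 : k) ^ p • functional k X p f := by
    refine linearMap_ext_homogeneous (degBar k X) fun n c hc => ?_
    rw [LinearMap.comp_apply, signOp_of_mem hc, map_smul, LinearMap.smul_apply]
    by_cases hn : n = p
    · rw [hn]
    · rw [functional_of_ne hn f hc, smul_zero, smul_zero]
  exact LinearMap.congr_fun h c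

theorem ges_mem {n : ℕ} (x : Fin n → X) : ges k (List.ofFn x) ∈ deg k X n := by
  induction n with
  | zero => simpa using (SetLike.GradedOne.one_mem : (1 : B k X) ∈ deg k X 0)
  | succ n ih =>
    rw [List.ofFn_succ, ges_cons]
    exact ge_mul_mem (x 0) (ih _)

/-- The coboundary of cochains is the signed transpose of the differential of `B̄`. -/
theorem functional_coboundary (n : ℕ) (f : Cochain k X n) :
    functional k X (n + 1) (coboundary k X n f) =
      (-1 : k) ^ n • (functional k X n f ∘ₗ diffBar k X) := by
  refine Bbar_ext_words fun m x => ?_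
  rw [LinearMap.smul_apply, LinearMap.comp_apply]
  by_cases hm : m = n + 1
  · subst hm
    rw [functional_word_self, diffBar_proj, diff_ges, map_sum, map_sum]
    simp only [map_smul, map_sub, proj_gx_mul, functional_word_self]
    rfl
  · have hx := proj_mem (ges_mem (k := k) x)
    rw [functional_word, dif_neg hm]
    cases m with
    | zero => rw [diffBar_of_mem_zero hx, map_zero, smul_zero]
    | succ m => rw [functional_of_ne (fun h => hm (by rw [h])) f (diffBar_mem hx), smul_zero]

theorem pairing_of_ne {p q n : ℕ} (hn : n ≠ p + q) (f : Cochain k X p) (g : Cochain k X q)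
    {t : Bbar k X ⊗[k] Bbar k X} (ht : t ∈ tensorDegree (degBar k X) n) :
    pairing k X p q f g t = 0 := by
  refine tensorDegree_le (N := LinearMap.ker (pairing k X p q f g))
    (fun i j hij u hu v hv => ?_) ht
  change functional k X p f u * functional k X q g v = 0
  by_cases hi : i = p
  · have hj : j ≠ q := fun hj => hn (by rw [← hij, hi, hj])
    rw [functional_of_ne hj g hv, mul_zero]
  · rw [functional_of_ne hi f hu, zero_mul]

theorem pairing_tmul (p q : ℕ) (f : Cochain k X p) (g : Cochain k X q) (u v : Bbar k X) :
    pairing k X p q f g (u ⊗ₜ v) = functional k X p f u * functional k X q g v := rfl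

/-- A functional of degree `n` is that of its restriction to words of length `n`. -/
theorem functional_transpose (φ : Bbar k X →ₗ[k] Bbar k X ⊗[k] Bbar k X) (n : ℕ)
    (ψ : Module.Dual k (Bbar k X ⊗[k] Bbar k X))
    (h : ∀ m, m ≠ n → ∀ c ∈ degBar k X m, ψ (φ c) = 0) :
    functional k X n (transpose k X φ n ψ) = ψ ∘ₗ φ := by
  refine Bbar_ext_words fun m x => ?_
  by_cases hm : m = n
  · subst hm
    rw [functional_word_self]
    rfl
  · rw [functional_word, dif_neg hm, LinearMap.comp_apply, h m hm _ (proj_mem (ges_mem x))]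

/-- The product dual to a map `φ` of degree `0`, in terms of functionals. -/
theorem functional_dualProduct {φ : Bbar k X →ₗ[k] Bbar k X ⊗[k] Bbar k X}
    (hφ : ∀ n, ∀ c ∈ degBar k X n, φ c ∈ tensorDegree (degBar k X) n) (p q : ℕ)
    (f : Cochain k X p) (g : Cochain k X q) :
    functional k X (p + q) (dualProduct k X φ p q f g) =
      (-1 : k) ^ (p * q) • (pairing k X p q f g ∘ₗ φ) := by
  have h : dualProduct k X φ p q f g =
      (-1 : k) ^ (p * q) • transpose k X φ (p + q) (pairing k X p q f g) := rfl
  rw [h, map_smul, functional_transpose]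
  exact fun m hm c hc => pairing_of_ne hm f g (hφ m c hc)

/-- The homotopy dual to a map `η` of degree `1`, in terms of functionals. -/
theorem functional_dualHomotopy {η : Bbar k X →ₗ[k] Bbar k X ⊗[k] Bbar k X}
    (hη : ∀ n, ∀ c ∈ degBar k X n, η c ∈ tensorDegree (degBar k X) (n + 1)) (p q : ℕ)
    (f : Cochain k X (p + 1)) (g : Cochain k X (q + 1)) :
    functional k X (p + q + 1) (dualHomotopy k X η p q f g) =
      (-1 : k) ^ (p * q) • (pairing k X (p + 1) (q + 1) f g ∘ₗ η) := by
  have h : dualHomotopy k X η p q f g =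
      (-1 : k) ^ (p * q) • transpose k X η (p + q + 1) (pairing k X (p + 1) (q + 1) f g) := rfl
  rw [h, map_smul, functional_transpose]
  exact fun m hm c hc => pairing_of_ne (by omega) f g (hη m c hc)

/-- The pairing of functionals with `B̄ ⊗ (B̄ ⊗ B̄)`. -/
def pairing₃ {p q r : ℕ} (f : Cochain k X p) (g : Cochain k X q) (l : Cochain k X r) :
    Module.Dual k (Bbar k X ⊗[k] (Bbar k X ⊗[k] Bbar k X)) :=
  TensorProduct.dualDistrib k _ _ (functional k X p f ⊗ₜ pairing k X q r g l)

theorem pairing_dualProduct_left {φ : Bbar k X →ₗ[k] Bbar k X ⊗[k] Bbar k X}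
    (hφ : ∀ n, ∀ c ∈ degBar k X n, φ c ∈ tensorDegree (degBar k X) n)
    (ψ : Bbar k X →ₗ[k] Bbar k X ⊗[k] Bbar k X) {p q r : ℕ}
    (f : Cochain k X p) (g : Cochain k X q) (l : Cochain k X r) (c : Bbar k X) :
    pairing k X (p + q) r (dualProduct k X φ p q f g) l (ψ c) =
      (-1 : k) ^ (p * q) * pairing₃ f g l (compLeft φ ψ c) := by
  simp only [compLeft, LinearMap.comp_apply, LinearEquiv.coe_coe]
  induction ψ c with
  | zero => simp
  | tmul u v =>
    rw [pairing_tmul, functional_dualProduct hφ, LinearMap.smul_apply, LinearMap.comp_apply,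
      TensorProduct.map_tmul, LinearMap.id_apply, smul_eq_mul, mul_assoc]
    congr 1
    induction φ u with
    | zero => simp
    | tmul a b =>
      rw [TensorProduct.assoc_tmul, pairing_tmul]
      exact mul_assoc _ _ _
    | add s t hs ht => rw [map_add, add_mul, hs, ht, TensorProduct.add_tmul, map_add, map_add]
  | add s t hs ht => rw [map_add, hs, ht, map_add, map_add, map_add, mul_add]

theorem pairing_dualProduct_right {φ : Bbar k X →ₗ[k] Bbar k X ⊗[k] Bbar k X}
    (hφ : ∀ n, ∀ c ∈ degBar k X n, φ c ∈ tensorDegree (degBar k X) n)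
    (ψ : Bbar k X →ₗ[k] Bbar k X ⊗[k] Bbar k X) {p q r : ℕ}
    (f : Cochain k X p) (g : Cochain k X q) (l : Cochain k X r) (c : Bbar k X) :
    pairing k X p (q + r) f (dualProduct k X φ q r g l) (ψ c) =
      (-1 : k) ^ (q * r) * pairing₃ f g l (compRight φ ψ c) := by
  simp only [compRight, LinearMap.comp_apply]
  induction ψ c with
  | zero => simp
  | tmul u v =>
    rw [pairing_tmul, functional_dualProduct hφ, LinearMap.smul_apply, LinearMap.comp_apply,
      TensorProduct.map_tmul, LinearMap.id_apply, smul_eq_mul, mul_left_comm]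
    rfl
  | add s t hs ht => rw [map_add, hs, ht, map_add, map_add, mul_add]

/-- Associativity relations between the products dual to maps of degree `0` follow from the
coassociativity relations between these maps. -/
theorem functional_dualProduct_assoc {φ φ' ψ ψ' : Bbar k X →ₗ[k] Bbar k X ⊗[k] Bbar k X}
    (hφ : ∀ n, ∀ c ∈ degBar k X n, φ c ∈ tensorDegree (degBar k X) n)
    (hψ : ∀ n, ∀ c ∈ degBar k X n, ψ c ∈ tensorDegree (degBar k X) n)
    (hφ' : ∀ n, ∀ c ∈ degBar k X n, φ' c ∈ tensorDegree (degBar k X) n)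
    (hψ' : ∀ n, ∀ c ∈ degBar k X n, ψ' c ∈ tensorDegree (degBar k X) n)
    (h : compLeft φ ψ = compRight φ' ψ') {p q r : ℕ}
    (f : Cochain k X p) (g : Cochain k X q) (l : Cochain k X r) :
    functional k X (p + q + r) (dualProduct k X ψ (p + q) r (dualProduct k X φ p q f g) l) =
      functional k X (p + (q + r))
        (dualProduct k X ψ' p (q + r) f (dualProduct k X φ' q r g l)) := by
  rw [functional_dualProduct hψ, functional_dualProduct hψ']
  refine LinearMap.ext fun c => ?_
  rw [LinearMap.smul_apply, LinearMap.smul_apply, LinearMap.comp_apply, LinearMap.comp_apply,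
    pairing_dualProduct_left hφ, pairing_dualProduct_right hφ', h, smul_eq_mul, smul_eq_mul]
  ring

theorem pairing_tensorDiffBar {p q : ℕ} (f : Cochain k X p) (g : Cochain k X q)
    (t : Bbar k X ⊗[k] Bbar k X) :
    pairing k X p q f g (tensorDiffBar k X t) =
      (-1 : k) ^ p * pairing k X (p + 1) q (coboundary k X p f) g t +
        (-1 : k) ^ (p + q) * pairing k X p (q + 1) f (coboundary k X q g) t := by
  induction t with
  | zero => simp
  | tmul u v =>
    change pairing k X p q f g (diffBar k X u ⊗ₜ v + signOp (degBar k X) u ⊗ₜ diffBar k X v) = _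
    have h1 := neg_one_pow_mul_self (k := k) p
    have h2 := neg_one_pow_mul_self (k := k) q
    rw [map_add, pairing_tmul, pairing_tmul, pairing_tmul, pairing_tmul, functional_coboundary,
      functional_coboundary, functional_signOp, LinearMap.smul_apply, LinearMap.smul_apply,
      LinearMap.comp_apply, LinearMap.comp_apply, smul_eq_mul, smul_eq_mul, pow_add]
    linear_combination (-functional k X p f (diffBar k X u) * functional k X q g v) * h1 -
      ((-1 : k) ^ p * functional k X p f u * functional k X q g (diffBar k X v)) * h2
  | add s t hs ht =>
    rw [map_add, map_add, hs, ht, map_add, map_add]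
    ring

/-- The coboundary is a super-derivation for the product dual to a chain map. -/
theorem functional_coboundary_dualProduct {φ : Bbar k X →ₗ[k] Bbar k X ⊗[k] Bbar k X}
    (hφ : ∀ n, ∀ c ∈ degBar k X n, φ c ∈ tensorDegree (degBar k X) n)
    (hd : ∀ c, φ (diffBar k X c) = tensorDiffBar k X (φ c)) {p q : ℕ}
    (f : Cochain k X p) (g : Cochain k X q) :
    functional k X (p + q + 1) (coboundary k X (p + q) (dualProduct k X φ p q f g)) =
      functional k X (p + 1 + q) (dualProduct k X φ (p + 1) q (coboundary k X p f) g) +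
        (-1 : k) ^ p • functional k X (p + (q + 1))
          (dualProduct k X φ p (q + 1) f (coboundary k X q g)) := by
  rw [functional_coboundary, functional_dualProduct hφ, functional_dualProduct hφ,
    functional_dualProduct hφ]
  refine LinearMap.ext fun c => ?_
  simp only [LinearMap.smul_apply, LinearMap.add_apply, LinearMap.comp_apply, hd,
    pairing_tensorDiffBar, smul_eq_mul]
  have h1 := neg_one_pow_mul_self (k := k) p
  have h2 := neg_one_pow_mul_self (k := k) q
  linear_combination
    ((-1 : k) ^ (p * q) * (-1 : k) ^ q * pairing k X (p + 1) q (coboundary k X p f) g (φ c)) * h1 +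
    ((-1 : k) ^ p * (-1 : k) ^ p * (-1 : k) ^ (p * q) *
      pairing k X p (q + 1) f (coboundary k X q g) (φ c)) * h2

theorem pairing_signedFlip {p q : ℕ} (f : Cochain k X p) (g : Cochain k X q)
    (t : Bbar k X ⊗[k] Bbar k X) :
    pairing k X p q f g (signedFlip (degBar k X) t) =
      (-1 : k) ^ (p * q) * pairing k X q p g f t := by
  have h : pairing k X p q f g ∘ₗ signedFlip (degBar k X) =
      (-1 : k) ^ (p * q) • pairing k X q p g f := by
    refine linearMap_tensor_ext_homogeneous (degBar k X) fun i j u hu v hv => ?_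
    rw [LinearMap.comp_apply, signedFlip_tmul hu hv, map_smul, LinearMap.smul_apply, pairing_tmul,
      pairing_tmul, smul_eq_mul, smul_eq_mul]
    by_cases hi : i = q
    · by_cases hj : j = p
      · rw [hi, hj]
        ring
      · rw [functional_of_ne hj f hv]
        ring
    · rw [functional_of_ne hi g hu]
      ring
  exact LinearMap.congr_fun h t

end Functional

/-! ### Graded products on direct sums -/

section DirectSums

variable {k : Type*} [CommRing k] {M : ℕ → Type*} [∀ n, AddCommGroup (M n)] [∀ n, Module k (M n)]

/-- The dendriform identities may be checked on homogeneous elements. -/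
theorem isDendriform_of_lof {l r : (⨁ n, M n) →ₗ[k] (⨁ n, M n) →ₗ[k] (⨁ n, M n)}
    (h1 : ∀ p q s (f : M p) (g : M q) (h : M s),
      l (l (DirectSum.lof k ℕ M p f) (DirectSum.lof k ℕ M q g)) (DirectSum.lof k ℕ M s h) =
        l (DirectSum.lof k ℕ M p f) ((l + r) (DirectSum.lof k ℕ M q g) (DirectSum.lof k ℕ M s h)))
    (h2 : ∀ p q s (f : M p) (g : M q) (h : M s),
      l (r (DirectSum.lof k ℕ M p f) (DirectSum.lof k ℕ M q g)) (DirectSum.lof k ℕ M s h) =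
        r (DirectSum.lof k ℕ M p f) (l (DirectSum.lof k ℕ M q g) (DirectSum.lof k ℕ M s h)))
    (h3 : ∀ p q s (f : M p) (g : M q) (h : M s),
      r ((l + r) (DirectSum.lof k ℕ M p f) (DirectSum.lof k ℕ M q g)) (DirectSum.lof k ℕ M s h) =
        r (DirectSum.lof k ℕ M p f) (r (DirectSum.lof k ℕ M q g) (DirectSum.lof k ℕ M s h))) :
    IsDendriform l r := by
  have key : ∀ u v u' v' : (⨁ n, M n) →ₗ[k] (⨁ n, M n) →ₗ[k] (⨁ n, M n),
      (∀ p q s (f : M p) (g : M q) (h : M s),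
        v (u (DirectSum.lof k ℕ M p f) (DirectSum.lof k ℕ M q g)) (DirectSum.lof k ℕ M s h) =
          v' (DirectSum.lof k ℕ M p f)
            (u' (DirectSum.lof k ℕ M q g) (DirectSum.lof k ℕ M s h))) →
      ∀ a b c, v (u a b) c = v' a (u' b c) := by
    intro u v u' v' h a b c
    induction a using DirectSum.induction_on with
    | zero => simp
    | add a a' ha ha' => rw [map_add, LinearMap.add_apply, map_add, LinearMap.add_apply, ha, ha',
        map_add, LinearMap.add_apply]
    | of p f =>
      induction b using DirectSum.induction_on with
      | zero => simp
      | add a a' ha ha' => rw [map_add, map_add, LinearMap.add_apply, ha, ha', map_add,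
          LinearMap.add_apply, map_add]
      | of q g =>
        induction c using DirectSum.induction_on with
        | zero => simp
        | add a a' ha ha' => rw [map_add, ha, ha', map_add, map_add]
        | of s t =>
          simp only [← DirectSum.lof_eq_of k]
          exact h p q s f g t
  exact ⟨key l l (l + r) l h1, key r l l r h2, key (l + r) r r r h3⟩

/-- Bilinear maps on a direct sum that agree on homogeneous elements are equal. -/
theorem directSum_bilinear_ext {N : Type*} [AddCommGroup N] [Module k N]
    {l r : (⨁ n, M n) →ₗ[k] (⨁ n, M n) →ₗ[k] N}
    (h : ∀ p q (f : M p) (g : M q),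
      l (DirectSum.lof k ℕ M p f) (DirectSum.lof k ℕ M q g) =
        r (DirectSum.lof k ℕ M p f) (DirectSum.lof k ℕ M q g)) : l = r := by
  refine DirectSum.linearMap_ext k fun p => LinearMap.ext fun f => ?_
  exact DirectSum.linearMap_ext k fun q => LinearMap.ext fun g => h p q f g

theorem lof_mem_posDegree (n : ℕ) (f : M n) :
    DirectSum.lof k ℕ M n f ∈ posDegree (k := k) M (n + 1) := ⟨f, rfl⟩

theorem posDegree_cases {p : ℕ} {a : ⨁ n, M n} (ha : a ∈ posDegree (k := k) M p) :
    a = 0 ∨ ∃ n, ∃ f : M n, p = n + 1 ∧ a = DirectSum.lof k ℕ M n f := by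
  cases p with
  | zero => exact Or.inl ha
  | succ p =>
    obtain ⟨f, rfl⟩ := ha
    exact Or.inr ⟨p, f, rfl, rfl⟩

/-- A product on `⨁_{n ≥ 1} M^n` is graded if it is so on the summands; the summand with index
`n` has degree `n + 1`. -/
theorem isGradedProduct_of_lof {l : (⨁ n, M n) →ₗ[k] (⨁ n, M n) →ₗ[k] (⨁ n, M n)}
    (h : ∀ p q (f : M p) (g : M q), ∃ e : M (p + 1 + q),
      l (DirectSum.lof k ℕ M p f) (DirectSum.lof k ℕ M q g) = DirectSum.lof k ℕ M (p + 1 + q) e) :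
    IsGradedProduct (posDegree (k := k) M) l := by
  intro p q a ha b hb
  rcases posDegree_cases ha with rfl | ⟨p, f, rfl, rfl⟩
  · simp
  · rcases posDegree_cases hb with rfl | ⟨q, g, rfl, rfl⟩
    · simp
    · obtain ⟨e, he⟩ := h p q f g
      rw [he]
      exact lof_mem_posDegree (p + 1 + q) e

end DirectSums

/-! ### The differential graded dendriform algebra of cochains -/

section PosCochains

variable {k X : Type*} [CommRing k] [Shelf X]

variable (k X) in
/-- A cochain of degree `n + 1` as an element of `⨁_{n ≥ 1} C^n(X)`, whose summands are indexed
by `n`. -/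
abbrev cof (n : ℕ) (f : Cochain k X (n + 1)) : PosCochains k X :=
  DirectSum.lof k ℕ (fun n => Cochain k X (n + 1)) n f

variable (k X) in
/-- Cochains of positive degree as functionals on `B̄`. -/
def toDual : PosCochains k X →ₗ[k] Module.Dual k (Bbar k X) :=
  DirectSum.toModule k ℕ _ fun n => functional k X (n + 1)

theorem toDual_cof (n : ℕ) (f : Cochain k X (n + 1)) :
    toDual k X (cof k X n f) = functional k X (n + 1) f := by
  simp [toDual]

theorem toDual_word (F : PosCochains k X) (n : ℕ) (x : Fin (n + 1) → X) :
    toDual k X F (proj k X (ges k (List.ofFn x))) = F n x := by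
  induction F using DirectSum.induction_on with
  | zero => simp
  | add a b ha hb => rw [map_add, LinearMap.add_apply, ha, hb]; rfl
  | of m f =>
    rw [← DirectSum.lof_eq_of k, toDual_cof, DirectSum.lof_eq_of]
    by_cases h : n = m
    · subst h
      rw [functional_word_self, DirectSum.of_eq_same]
    · rw [functional_word, dif_neg (by omega), DirectSum.of_eq_of_ne _ _ _ h]
      rfl

theorem toDual_injective : Function.Injective (toDual k X) := by
  intro F G h
  refine DFinsupp.ext fun n => funext fun x => ?_
  have hF := toDual_word F n x
  rw [h, toDual_word] at hF
  exact hF.symm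

theorem posCoboundary_cof (n : ℕ) (f : Cochain k X (n + 1)) :
    posCoboundary k X (cof k X n f) = cof k X (n + 1) (coboundary k X (n + 1) f) := by
  simp [posCoboundary]

theorem posProduct_cof (φ : Bbar k X →ₗ[k] Bbar k X ⊗[k] Bbar k X) (p q : ℕ)
    (f : Cochain k X (p + 1)) (g : Cochain k X (q + 1)) :
    posProduct k X φ (cof k X p f) (cof k X q g) =
      cof k X (p + 1 + q) (dualProduct k X φ (p + 1) (q + 1) f g) := by
  simp [posProduct, assemble]

theorem posHomotopy_cof (η : Bbar k X →ₗ[k] Bbar k X ⊗[k] Bbar k X) (p q : ℕ)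
    (f : Cochain k X (p + 1)) (g : Cochain k X (q + 1)) :
    posHomotopy k X η (cof k X p f) (cof k X q g) =
      cof k X (p + q) (dualHomotopy k X η p q f g) := by
  simp [posHomotopy, assemble]

theorem dualProduct_add {φ φ' ψ : Bbar k X →ₗ[k] Bbar k X ⊗[k] Bbar k X} {n p q : ℕ}
    (hn : p + q = n + 1) (h : ∀ c ∈ degBar k X (n + 1), ψ c = φ c + φ' c)
    (f : Cochain k X p) (g : Cochain k X q) :
    dualProduct k X ψ p q f g = dualProduct k X φ p q f g + dualProduct k X φ' p q f g := by
  have e : ∀ (φ : Bbar k X →ₗ[k] Bbar k X ⊗[k] Bbar k X) x, dualProduct k X φ p q f g x =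
      (-1 : k) ^ (p * q) * pairing k X p q f g (φ (proj k X (ges k (List.ofFn x)))) :=
    fun _ _ => rfl
  funext x
  rw [Pi.add_apply, e, e, e, h _ (hn ▸ proj_mem (ges_mem x)), map_add, mul_add]

theorem posProduct_comulBar :
    posProduct k X (comulBar k X) =
      posProduct k X (leftBar k X) + posProduct k X (rightBar k X) := by
  refine directSum_bilinear_ext (M := fun n => Cochain k X (n + 1)) fun p q f g => ?_
  rw [LinearMap.add_apply, LinearMap.add_apply, posProduct_cof, posProduct_cof, posProduct_cof,
    ← map_add]
  congr 1
  exact dualProduct_add (n := p + 1 + q) (p := p + 1) (q := q + 1) rfl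
    (fun c hc => comulBar_eq_add (mem_plus hc)) f g

theorem posProduct_assoc {φ φ' ψ ψ' : Bbar k X →ₗ[k] Bbar k X ⊗[k] Bbar k X}
    (hφ : ∀ n, ∀ c ∈ degBar k X n, φ c ∈ tensorDegree (degBar k X) n)
    (hψ : ∀ n, ∀ c ∈ degBar k X n, ψ c ∈ tensorDegree (degBar k X) n)
    (hφ' : ∀ n, ∀ c ∈ degBar k X n, φ' c ∈ tensorDegree (degBar k X) n)
    (hψ' : ∀ n, ∀ c ∈ degBar k X n, ψ' c ∈ tensorDegree (degBar k X) n)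
    (h : compLeft φ ψ = compRight φ' ψ') (p q r : ℕ)
    (f : Cochain k X (p + 1)) (g : Cochain k X (q + 1)) (l : Cochain k X (r + 1)) :
    posProduct k X ψ (posProduct k X φ (cof k X p f) (cof k X q g)) (cof k X r l) =
      posProduct k X ψ' (cof k X p f) (posProduct k X φ' (cof k X q g) (cof k X r l)) := by
  rw [posProduct_cof, posProduct_cof, posProduct_cof, posProduct_cof]
  refine toDual_injective ?_
  rw [toDual_cof, toDual_cof]
  exact functional_dualProduct_assoc hφ hψ hφ' hψ' h f g l

theorem isDendriform_posProduct :
    IsDendriform (posProduct k X (leftBar k X)) (posProduct k X (rightBar k X)) := by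
  have hL : ∀ n, ∀ c ∈ degBar k X n, leftBar k X c ∈ tensorDegree (degBar k X) n :=
    fun _ _ => leftBar_mem
  have hR : ∀ n, ∀ c ∈ degBar k X n, rightBar k X c ∈ tensorDegree (degBar k X) n :=
    fun _ _ => rightBar_mem
  have hΔ : ∀ n, ∀ c ∈ degBar k X n, comulBar k X c ∈ tensorDegree (degBar k X) n :=
    fun _ _ => comulBar_mem
  refine isDendriform_of_lof (M := fun n => Cochain k X (n + 1)) ?_ ?_ ?_
  · rw [← posProduct_comulBar]
    exact posProduct_assoc hL hL hΔ hL isPlusCodendriform_Bbar.dendri_left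
  · exact posProduct_assoc hR hL hL hR isPlusCodendriform_Bbar.dendri_mid.symm
  · rw [← posProduct_comulBar]
    exact posProduct_assoc hΔ hR hR hR isPlusCodendriform_Bbar.dendri_right.symm

theorem coboundary_coboundary (n : ℕ) (f : Cochain k X n) :
    coboundary k X (n + 1) (coboundary k X n f) = 0 := by
  refine functional_injective _ ?_
  rw [functional_coboundary, functional_coboundary, map_zero]
  refine LinearMap.ext fun c => ?_
  simp [diffBar_diffBar]

theorem posCoboundary_mem (p : ℕ) {a : PosCochains k X}
    (ha : a ∈ posDegree (k := k) (fun n => Cochain k X (n + 1)) p) :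
    posCoboundary k X a ∈ posDegree (k := k) (fun n => Cochain k X (n + 1)) (p + 1) := by
  rcases posDegree_cases ha with rfl | ⟨p, f, rfl, rfl⟩
  · simp
  · exact ⟨_, (posCoboundary_cof p f).symm⟩

theorem isLeibniz_posProduct {φ : Bbar k X →ₗ[k] Bbar k X ⊗[k] Bbar k X}
    (hφ : ∀ n, ∀ c ∈ degBar k X n, φ c ∈ tensorDegree (degBar k X) n)
    (hd : ∀ c, φ (diffBar k X c) = tensorDiffBar k X (φ c)) :
    IsLeibniz (posDegree fun n => Cochain k X (n + 1)) (posCoboundary k X) (posProduct k X φ) := by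
  intro p a ha b
  rcases posDegree_cases ha with rfl | ⟨p, f, rfl, rfl⟩
  · simp
  · induction b using DirectSum.induction_on with
    | zero => simp
    | add b b' hb hb' =>
      simp only [map_add, hb, hb', smul_add]
      abel
    | of q g =>
      rw [← DirectSum.lof_eq_of k, posProduct_cof, posCoboundary_cof, posCoboundary_cof,
        posCoboundary_cof, posProduct_cof, posProduct_cof]
      refine toDual_injective ?_
      rw [map_add, map_smul, toDual_cof, toDual_cof, toDual_cof]
      exact functional_coboundary_dualProduct hφ hd f g

theorem isDGDendriform_posProduct :
    IsDGDendriform (posDegree fun n => Cochain k X (n + 1)) (posCoboundary k X)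
      (posProduct k X (leftBar k X)) (posProduct k X (rightBar k X)) where
  toIsDendriform := isDendriform_posProduct
  δ_degree p _ := posCoboundary_mem p
  δ_δ a := by
    induction a using DirectSum.induction_on with
    | zero => simp
    | add a b ha hb => rw [map_add, map_add, ha, hb, add_zero]
    | of n f =>
      rw [← DirectSum.lof_eq_of k, posCoboundary_cof, posCoboundary_cof, coboundary_coboundary]
      exact map_zero _
  l_degree := isGradedProduct_of_lof (M := fun n => Cochain k X (n + 1))
    fun p q f g => ⟨_, posProduct_cof _ p q f g⟩
  r_degree := isGradedProduct_of_lof (M := fun n => Cochain k X (n + 1))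
    fun p q f g => ⟨_, posProduct_cof _ p q f g⟩
  l_δ := isLeibniz_posProduct (fun _ _ => leftBar_mem) leftBar_diffBar
  r_δ := isLeibniz_posProduct (fun _ _ => rightBar_mem) rightBar_diffBar

/-- The transpose of the homotopy `h̄` makes the two products dual to the halves of `Δ` agree up
to the flip and a homotopy. -/
theorem functional_zinbielHomotopy (p q : ℕ) (f : Cochain k X (p + 1)) (g : Cochain k X (q + 1)) :
    functional k X (p + q + 2)
        (coboundary k X (p + q + 1) (dualHomotopy k X (homBar k X) p q f g)) +
      functional k X (p + 1 + q + 1)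
        (dualHomotopy k X (homBar k X) (p + 1) q (coboundary k X (p + 1) f) g) +
      (-1 : k) ^ (p + 1) • functional k X (p + (q + 1) + 1)
        (dualHomotopy k X (homBar k X) p (q + 1) f (coboundary k X (q + 1) g)) =
    functional k X (p + 1 + (q + 1)) (dualProduct k X (rightBar k X) (p + 1) (q + 1) f g) -
      (-1 : k) ^ ((p + 1) * (q + 1)) • functional k X (q + 1 + (p + 1))
        (dualProduct k X (leftBar k X) (q + 1) (p + 1) g f) := by
  have hη : ∀ n, ∀ c ∈ degBar k X n, homBar k X c ∈ tensorDegree (degBar k X) (n + 1) :=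
    fun _ _ => homBar_mem
  rw [functional_coboundary, functional_dualHomotopy hη, functional_dualHomotopy hη,
    functional_dualHomotopy hη, functional_dualProduct fun _ _ => rightBar_mem,
    functional_dualProduct fun _ _ => leftBar_mem]
  refine LinearMap.ext fun c => ?_
  have h := congrArg (pairing k X (p + 1) (q + 1) f g) (tensorDiffBar_homBar c)
  rw [map_add, map_sub, pairing_tensorDiffBar, pairing_signedFlip] at h
  simp only [LinearMap.smul_apply, LinearMap.add_apply, LinearMap.sub_apply,
    LinearMap.comp_apply, smul_eq_mul]
  have h1 := neg_one_pow_mul_self (k := k) p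
  have h2 := neg_one_pow_mul_self (k := k) q
  -- What remains is the homotopy relation `h` on `B̄`, multiplied by a sign.
  generalize pairing k X (p + 1) (q + 1) f g (homBar k X (diffBar k X c)) = A at h ⊢
  generalize pairing k X (p + 1 + 1) (q + 1) (coboundary k X (p + 1) f) g (homBar k X c) = E at h ⊢
  generalize pairing k X (p + 1) (q + 1 + 1) f (coboundary k X (q + 1) g) (homBar k X c) = F at h ⊢
  generalize pairing k X (p + 1) (q + 1) f g (rightBar k X c) = R at h ⊢
  generalize pairing k X (q + 1) (p + 1) g f (leftBar k X c) = L at h ⊢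
  have e : (p + 1) * (q + 1) = p * q + p + q + 1 := by ring
  have e' : (q + 1) * (p + 1) = p * q + p + q + 1 := by ring
  have e1 : (p + 1) * q = p * q + q := by ring
  have e2 : p * (q + 1) = p * q + p := by ring
  rw [e] at h ⊢
  rw [e', e1, e2]
  simp only [pow_add, pow_one] at h ⊢
  generalize (-1 : k) ^ (p * q) = s at h ⊢
  generalize (-1 : k) ^ p = a at h h1 ⊢
  generalize (-1 : k) ^ q = b at h h2 ⊢
  linear_combination (-a * b * s) * h - (s * b * E) * h1 + (a * a * s * F) * h2

theorem isZinbielHomotopy_posHomotopy :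
    IsZinbielHomotopy (posDegree fun n => Cochain k X (n + 1)) (posCoboundary k X)
      (posProduct k X (leftBar k X)) (posProduct k X (rightBar k X))
      (posHomotopy k X (homBar k X)) where
  degree p q a ha b hb := by
    rcases posDegree_cases ha with rfl | ⟨p, f, rfl, rfl⟩
    · simp
    · rcases posDegree_cases hb with rfl | ⟨q, g, rfl, rfl⟩
      · simp
      · rw [posHomotopy_cof, show p + 1 + (q + 1) - 1 = p + q + 1 by omega]
        exact lof_mem_posDegree (M := fun n => Cochain k X (n + 1)) (p + q) _
  homotopy p q a ha b hb := by
    rcases posDegree_cases ha with rfl | ⟨p, f, rfl, rfl⟩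
    · simp
    · rcases posDegree_cases hb with rfl | ⟨q, g, rfl, rfl⟩
      · simp
      · rw [posHomotopy_cof, posCoboundary_cof, posCoboundary_cof, posCoboundary_cof,
          posHomotopy_cof, posHomotopy_cof, posProduct_cof, posProduct_cof]
        refine toDual_injective ?_
        rw [map_add, map_add, map_sub, map_smul, map_smul, toDual_cof, toDual_cof, toDual_cof,
          toDual_cof, toDual_cof]
        exact functional_zinbielHomotopy p q f g

end PosCochains

/-! ### Products on rack cohomology -/

section Subquotients

variable {k M N P : Type*} [CommRing k] [AddCommGroup M] [Module k M] [AddCommGroup N]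
  [Module k N] [AddCommGroup P] [Module k P]

/-- The restriction of a bilinear map to submodules. -/
def bilinearRestrict (β : M →ₗ[k] N →ₗ[k] P) (Z : Submodule k M) (Z' : Submodule k N)
    (Z'' : Submodule k P) (h : ∀ a ∈ Z, ∀ b ∈ Z', β a b ∈ Z'') : Z →ₗ[k] Z' →ₗ[k] Z'' :=
  LinearMap.mk₂ k (fun a b => ⟨β a b, h a a.2 b b.2⟩)
    (fun a a' b => Subtype.ext (LinearMap.map_add₂ β a.1 a'.1 b.1))
    (fun c a b => Subtype.ext (LinearMap.map_smul₂ β c a.1 b.1))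
    (fun a b b' => Subtype.ext (map_add (β a) b.1 b'.1))
    (fun c a b => Subtype.ext (map_smul (β a) c b.1))

/-- The bilinear map of subquotients `Z / D` induced by a bilinear map that takes cycles to cycles
and the product of a boundary and a cycle, in either order, to a boundary. -/
def bilinearSubquotient (β : M →ₗ[k] N →ₗ[k] P) (Z D : Submodule k M) (Z' D' : Submodule k N)
    (Z'' D'' : Submodule k P) (h : ∀ a ∈ Z, ∀ b ∈ Z', β a b ∈ Z'')
    (hl : ∀ a ∈ D, ∀ b ∈ Z', β a b ∈ D'') (hr : ∀ a ∈ Z, ∀ b ∈ D', β a b ∈ D'') :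
    (Z ⧸ D.submoduleOf Z) →ₗ[k] (Z' ⧸ D'.submoduleOf Z') →ₗ[k] (Z'' ⧸ D''.submoduleOf Z'') :=
  let m := (bilinearRestrict β Z Z' Z'' h).compr₂ (D''.submoduleOf Z'').mkQ
  (D.submoduleOf Z).liftQ
    ((D'.submoduleOf Z').liftQ m.flip (fun b hb => LinearMap.mem_ker.2 <| LinearMap.ext fun a =>
      (Submodule.Quotient.mk_eq_zero _).2 (hr a a.2 b hb))).flip
    (fun a ha => LinearMap.mem_ker.2 <| LinearMap.ext fun u => by
      obtain ⟨b, rfl⟩ := Submodule.Quotient.mk_surjective _ u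
      exact (Submodule.Quotient.mk_eq_zero _).2 (hl a ha b b.2))

variable {Q : ℕ → Type*} [∀ n, AddCommGroup (Q n)] [∀ n, Module k (Q n)]

/-- The bilinear product on a direct sum with the given components. -/
def directSumProduct (m : ℕ → ℕ → ℕ) (F : ∀ p q, Q p →ₗ[k] Q q →ₗ[k] Q (m p q)) :
    (⨁ n, Q n) →ₗ[k] (⨁ n, Q n) →ₗ[k] (⨁ n, Q n) :=
  DirectSum.toModule k ℕ _ fun p => LinearMap.flip <|
    DirectSum.toModule k ℕ _ fun q => LinearMap.flip <|
      (F p q).compr₂ (DirectSum.lof k ℕ Q (m p q))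

theorem directSumProduct_lof (m : ℕ → ℕ → ℕ) (F : ∀ p q, Q p →ₗ[k] Q q →ₗ[k] Q (m p q))
    (p q : ℕ) (u : Q p) (v : Q q) :
    directSumProduct m F (DirectSum.lof k ℕ Q p u) (DirectSum.lof k ℕ Q q v) =
      DirectSum.lof k ℕ Q (m p q) (F p q u v) := by
  simp [directSumProduct]

/-- A product on a graded module concentrated in positive degrees is Zinbiel if the dendriform
identities and the commutation relation hold on the summands. Here `t` is the sum of the two
products. -/
theorem isZinbiel_of_lof {l r t : (⨁ n, Q n) →ₗ[k] (⨁ n, Q n) →ₗ[k] (⨁ n, Q n)}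
    (ht : ∀ p q (f : Q p) (g : Q q), t (DirectSum.lof k ℕ Q p f) (DirectSum.lof k ℕ Q q g) =
      l (DirectSum.lof k ℕ Q p f) (DirectSum.lof k ℕ Q q g) +
        r (DirectSum.lof k ℕ Q p f) (DirectSum.lof k ℕ Q q g))
    (h1 : ∀ p q s (f : Q p) (g : Q q) (h : Q s),
      l (l (DirectSum.lof k ℕ Q p f) (DirectSum.lof k ℕ Q q g)) (DirectSum.lof k ℕ Q s h) =
        l (DirectSum.lof k ℕ Q p f) (t (DirectSum.lof k ℕ Q q g) (DirectSum.lof k ℕ Q s h)))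
    (h2 : ∀ p q s (f : Q p) (g : Q q) (h : Q s),
      l (r (DirectSum.lof k ℕ Q p f) (DirectSum.lof k ℕ Q q g)) (DirectSum.lof k ℕ Q s h) =
        r (DirectSum.lof k ℕ Q p f) (l (DirectSum.lof k ℕ Q q g) (DirectSum.lof k ℕ Q s h)))
    (h3 : ∀ p q s (f : Q p) (g : Q q) (h : Q s),
      r (t (DirectSum.lof k ℕ Q p f) (DirectSum.lof k ℕ Q q g)) (DirectSum.lof k ℕ Q s h) =
        r (DirectSum.lof k ℕ Q p f) (r (DirectSum.lof k ℕ Q q g) (DirectSum.lof k ℕ Q s h)))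
    (hl : ∀ p q (f : Q p) (g : Q q), ∃ e : Q (p + 1 + q),
      l (DirectSum.lof k ℕ Q p f) (DirectSum.lof k ℕ Q q g) = DirectSum.lof k ℕ Q (p + 1 + q) e)
    (hr : ∀ p q (f : Q p) (g : Q q), ∃ e : Q (p + 1 + q),
      r (DirectSum.lof k ℕ Q p f) (DirectSum.lof k ℕ Q q g) = DirectSum.lof k ℕ Q (p + 1 + q) e)
    (hc : ∀ p q (f : Q p) (g : Q q), r (DirectSum.lof k ℕ Q p f) (DirectSum.lof k ℕ Q q g) =
      (-1 : k) ^ ((p + 1) * (q + 1)) •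
        l (DirectSum.lof k ℕ Q q g) (DirectSum.lof k ℕ Q p f)) :
    IsZinbiel (posDegree (k := k) Q) l r := by
  obtain rfl : t = l + r := directSum_bilinear_ext ht
  have hd : IsDendriform l r := isDendriform_of_lof h1 h2 h3
  have comm : ∀ p q, ∀ a ∈ posDegree (k := k) Q p, ∀ b ∈ posDegree (k := k) Q q,
      r a b = (-1 : k) ^ (p * q) • l b a := by
    intro p q a ha b hb
    rcases posDegree_cases ha with rfl | ⟨p, f, rfl, rfl⟩
    · simp
    · rcases posDegree_cases hb with rfl | ⟨q, g, rfl, rfl⟩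
      · simp
      · exact hc p q f g
  exact
    { hd with
      l_degree := isGradedProduct_of_lof hl
      r_degree := isGradedProduct_of_lof hr
      comm := comm
      zinbiel := fun _ q s a _ b hb c hc => by rw [← comm q s b hb c hc]; exact hd.left a b c }

end Subquotients

section Cohomology

variable {k X : Type*} [CommRing k] [Shelf X]

/-- A cochain whose functional is that of a coboundary is a coboundary. The equality of degrees
takes care of degrees that are only propositionally equal. -/
theorem mem_range_coboundary {m n : ℕ} (h : m = n) {b : Cochain k X (n + 1)} (a : Cochain k X m)
    (hab : functional k X (m + 1) (coboundary k X m a) = functional k X (n + 1) b) :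
    b ∈ LinearMap.range (coboundary k X n) := by
  subst h
  exact ⟨a, functional_injective _ hab⟩

/-- Cocycles are cohomologous if the difference of their functionals is that of a coboundary. -/
theorem cls_eq_of_functional {m n s : ℕ} (h : m = n) (hs : s = m) {f : Cochain k X (m + 1)}
    {g : Cochain k X (n + 1)} (hf : f ∈ cocycles k X (m + 1)) (hg : g ∈ cocycles k X (n + 1))
    (a : Cochain k X s)
    (e : functional k X (s + 1) (coboundary k X s a) =
      functional k X (m + 1) f - functional k X (n + 1) g) :
    cls f hf = cls g hg := by
  subst h hs
  unfold cls
  congr 1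
  rw [Submodule.Quotient.eq]
  exact ⟨a, functional_injective _ (e.trans (map_sub _ _ _).symm)⟩

theorem cls_eq_of_functional_eq {m n : ℕ} (h : m = n) {f : Cochain k X (m + 1)}
    {g : Cochain k X (n + 1)} (hf : f ∈ cocycles k X (m + 1)) (hg : g ∈ cocycles k X (n + 1))
    (e : functional k X (m + 1) f = functional k X (n + 1) g) : cls f hf = cls g hg :=
  cls_eq_of_functional h rfl hf hg 0 (by rw [map_zero, map_zero, e, sub_self])

theorem smul_cls {n : ℕ} (c : k) {f : Cochain k X (n + 1)} (hf : f ∈ cocycles k X (n + 1)) :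
    c • cls f hf = cls (c • f) (Submodule.smul_mem _ c hf) := by
  unfold cls
  rw [← map_smul, ← Submodule.Quotient.mk_smul]
  rfl

theorem exists_eq_cls (n : ℕ) (u : Cohomology k X n) :
    ∃ (f : Cochain k X (n + 1)) (hf : f ∈ cocycles k X (n + 1)),
      DirectSum.lof k ℕ (fun n => Cohomology k X n) n u = cls f hf := by
  obtain ⟨⟨f, hf⟩, rfl⟩ := Submodule.Quotient.mk_surjective _ u
  exact ⟨f, hf, rfl⟩

variable (k X) in
/-- The maps `B̄ → B̄ ⊗ B̄` of degree `0` that commute with the differentials. -/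
structure IsChainCoproduct (φ : Bbar k X →ₗ[k] Bbar k X ⊗[k] Bbar k X) : Prop where
  degree : ∀ n, ∀ c ∈ degBar k X n, φ c ∈ tensorDegree (degBar k X) n
  comm : ∀ c, φ (diffBar k X c) = tensorDiffBar k X (φ c)

theorem isChainCoproduct_leftBar : IsChainCoproduct k X (leftBar k X) :=
  ⟨fun _ _ => leftBar_mem, leftBar_diffBar⟩

theorem isChainCoproduct_rightBar : IsChainCoproduct k X (rightBar k X) :=
  ⟨fun _ _ => rightBar_mem, rightBar_diffBar⟩

theorem isChainCoproduct_comulBar : IsChainCoproduct k X (comulBar k X) where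
  degree _ _ := comulBar_mem
  comm c := by
    obtain ⟨b, rfl⟩ := proj_surjective c
    rw [diffBar_proj, comulBar_proj, comulBar_proj, tensorDiffBar_proj₂, tensorDiff_comul]

variable {φ : Bbar k X →ₗ[k] Bbar k X ⊗[k] Bbar k X}

theorem dualProduct_mem_cocycles (hφ : IsChainCoproduct k X φ) {p q : ℕ} {f : Cochain k X p}
    {g : Cochain k X q} (hf : f ∈ cocycles k X p) (hg : g ∈ cocycles k X q) :
    dualProduct k X φ p q f g ∈ cocycles k X (p + q) := by
  have hf : coboundary k X p f = 0 := hf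
  have hg : coboundary k X q g = 0 := hg
  refine LinearMap.mem_ker.2 (functional_injective _ ?_)
  rw [functional_coboundary_dualProduct hφ.degree hφ.comm, hf, hg]
  simp

theorem dualProduct_coboundary_left (hφ : IsChainCoproduct k X φ) {p q : ℕ} (f : Cochain k X p)
    {g : Cochain k X (q + 1)} (hg : g ∈ cocycles k X (q + 1)) :
    dualProduct k X φ (p + 1) (q + 1) (coboundary k X p f) g ∈
      LinearMap.range (coboundary k X (p + 1 + q)) := by
  have hg : coboundary k X (q + 1) g = 0 := hg
  refine mem_range_coboundary (m := p + (q + 1)) (by omega) (dualProduct k X φ p (q + 1) f g) ?_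
  rw [functional_coboundary_dualProduct hφ.degree hφ.comm, hg, map_zero, map_zero, smul_zero,
    add_zero]
  rfl

theorem dualProduct_coboundary_right (hφ : IsChainCoproduct k X φ) {p q : ℕ}
    {f : Cochain k X (p + 1)} (hf : f ∈ cocycles k X (p + 1)) (g : Cochain k X q) :
    dualProduct k X φ (p + 1) (q + 1) f (coboundary k X q g) ∈
      LinearMap.range (coboundary k X (p + 1 + q)) := by
  have hf : coboundary k X (p + 1) f = 0 := hf
  refine mem_range_coboundary (m := p + 1 + q) rfl
    ((-1 : k) ^ (p + 1) • dualProduct k X φ (p + 1) q f g) ?_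
  rw [map_smul, map_smul, functional_coboundary_dualProduct hφ.degree hφ.comm, hf, map_zero,
    LinearMap.zero_apply, map_zero, zero_add, smul_smul, neg_one_pow_mul_self, one_smul]
  rfl

variable (k X) in
/-- The product `dualProduct` of cochains of positive degree, with the degree of the result written
as the successor of the index `p + 1 + q` under which `Cohomology` files it. -/
def dualProductSucc (φ : Bbar k X →ₗ[k] Bbar k X ⊗[k] Bbar k X) (p q : ℕ) :
    Cochain k X (p + 1) →ₗ[k] Cochain k X (q + 1) →ₗ[k] Cochain k X (p + 1 + q + 1) :=
  dualProduct k X φ (p + 1) (q + 1)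

theorem dualProductSucc_mem_cocycles (hφ : IsChainCoproduct k X φ) {p q : ℕ}
    {f : Cochain k X (p + 1)} {g : Cochain k X (q + 1)} (hf : f ∈ cocycles k X (p + 1))
    (hg : g ∈ cocycles k X (q + 1)) :
    dualProductSucc k X φ p q f g ∈ cocycles k X (p + 1 + q + 1) := by
  have h := dualProduct_mem_cocycles (p := p + 1) (q := q + 1) hφ hf hg
  exact h

/-- The product of two cohomology classes of degrees `p + 1` and `q + 1`. -/
def cohomologyProduct (hφ : IsChainCoproduct k X φ) (p q : ℕ) :
    Cohomology k X p →ₗ[k] Cohomology k X q →ₗ[k] Cohomology k X (p + 1 + q) :=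
  bilinearSubquotient (dualProductSucc k X φ p q)
    (cocycles k X (p + 1)) (LinearMap.range (coboundary k X p))
    (cocycles k X (q + 1)) (LinearMap.range (coboundary k X q))
    (cocycles k X (p + 1 + q + 1)) (LinearMap.range (coboundary k X (p + 1 + q)))
    (fun _ hf _ hg => dualProductSucc_mem_cocycles hφ hf hg)
    (by
      rintro _ ⟨f, rfl⟩ g hg
      exact dualProduct_coboundary_left hφ f hg)
    (by
      rintro f hf _ ⟨g, rfl⟩
      exact dualProduct_coboundary_right hφ hf g)

/-- The product on rack cohomology in positive degree that is dual to `φ`. -/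
def posCohomologyProduct (hφ : IsChainCoproduct k X φ) :
    PosCohomology k X →ₗ[k] PosCohomology k X →ₗ[k] PosCohomology k X :=
  directSumProduct (Q := fun n => Cohomology k X n) (fun p q => p + 1 + q) (cohomologyProduct hφ)

theorem posCohomologyProduct_lof (hφ : IsChainCoproduct k X φ) (p q : ℕ) (u : Cohomology k X p)
    (v : Cohomology k X q) :
    posCohomologyProduct hφ (DirectSum.lof k ℕ (fun n => Cohomology k X n) p u)
        (DirectSum.lof k ℕ (fun n => Cohomology k X n) q v) =
      DirectSum.lof k ℕ (fun n => Cohomology k X n) (p + 1 + q) (cohomologyProduct hφ p q u v) :=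
  directSumProduct_lof (Q := fun n => Cohomology k X n) _ _ p q u v

theorem posCohomologyProduct_cls (hφ : IsChainCoproduct k X φ) {p q : ℕ}
    {f : Cochain k X (p + 1)} {g : Cochain k X (q + 1)} (hf : f ∈ cocycles k X (p + 1))
    (hg : g ∈ cocycles k X (q + 1)) :
    posCohomologyProduct hφ (cls f hf) (cls g hg) =
      cls (n := p + 1 + q) (dualProductSucc k X φ p q f g)
        (dualProductSucc_mem_cocycles hφ hf hg) := by
  unfold cls
  rw [posCohomologyProduct_lof]
  rfl

theorem isInducedProduct_posCohomologyProduct (hφ : IsChainCoproduct k X φ) :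
    IsInducedProduct φ (posCohomologyProduct hφ) :=
  fun _ _ _ _ hf hg =>
    ⟨dualProductSucc_mem_cocycles hφ hf hg, posCohomologyProduct_cls hφ hf hg⟩

theorem posCohomologyProduct_comulBar {p q : ℕ} (u : Cohomology k X p) (v : Cohomology k X q) :
    posCohomologyProduct isChainCoproduct_comulBar
        (DirectSum.lof k ℕ (fun n => Cohomology k X n) p u)
        (DirectSum.lof k ℕ (fun n => Cohomology k X n) q v) =
      posCohomologyProduct isChainCoproduct_leftBar
          (DirectSum.lof k ℕ (fun n => Cohomology k X n) p u)
          (DirectSum.lof k ℕ (fun n => Cohomology k X n) q v) +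
        posCohomologyProduct isChainCoproduct_rightBar
          (DirectSum.lof k ℕ (fun n => Cohomology k X n) p u)
          (DirectSum.lof k ℕ (fun n => Cohomology k X n) q v) := by
  obtain ⟨f, hf, hu⟩ := exists_eq_cls p u
  obtain ⟨g, hg, hv⟩ := exists_eq_cls q v
  rw [hu, hv, posCohomologyProduct_cls, posCohomologyProduct_cls, posCohomologyProduct_cls]
  unfold cls
  rw [← map_add, ← Submodule.Quotient.mk_add]
  congr 2
  exact Subtype.ext (dualProduct_add (n := p + 1 + q) (p := p + 1) (q := q + 1) rfl
    (fun c hc => comulBar_eq_add (mem_plus hc)) f g)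

theorem posCohomologyProduct_assoc {φ φ' ψ ψ' : Bbar k X →ₗ[k] Bbar k X ⊗[k] Bbar k X}
    (hφ : IsChainCoproduct k X φ) (hψ : IsChainCoproduct k X ψ) (hφ' : IsChainCoproduct k X φ')
    (hψ' : IsChainCoproduct k X ψ') (h : compLeft φ ψ = compRight φ' ψ') (p q s : ℕ)
    (u : Cohomology k X p) (v : Cohomology k X q) (w : Cohomology k X s) :
    posCohomologyProduct hψ
        (posCohomologyProduct hφ (DirectSum.lof k ℕ (fun n => Cohomology k X n) p u)
          (DirectSum.lof k ℕ (fun n => Cohomology k X n) q v))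
        (DirectSum.lof k ℕ (fun n => Cohomology k X n) s w) =
      posCohomologyProduct hψ' (DirectSum.lof k ℕ (fun n => Cohomology k X n) p u)
        (posCohomologyProduct hφ' (DirectSum.lof k ℕ (fun n => Cohomology k X n) q v)
          (DirectSum.lof k ℕ (fun n => Cohomology k X n) s w)) := by
  obtain ⟨f, hf, hu⟩ := exists_eq_cls p u
  obtain ⟨g, hg, hv⟩ := exists_eq_cls q v
  obtain ⟨l, hl, hw⟩ := exists_eq_cls s w
  rw [hu, hv, hw, posCohomologyProduct_cls, posCohomologyProduct_cls, posCohomologyProduct_cls,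
    posCohomologyProduct_cls]
  exact cls_eq_of_functional_eq (by omega) _ _
    (functional_dualProduct_assoc hφ.degree hψ.degree hφ'.degree hψ'.degree h f g l)

/-- On cohomology the homotopy `h̄` becomes a strict commutation relation. -/
theorem posCohomologyProduct_comm (p q : ℕ) (u : Cohomology k X p) (v : Cohomology k X q) :
    posCohomologyProduct isChainCoproduct_rightBar
        (DirectSum.lof k ℕ (fun n => Cohomology k X n) p u)
        (DirectSum.lof k ℕ (fun n => Cohomology k X n) q v) =
      (-1 : k) ^ ((p + 1) * (q + 1)) • posCohomologyProduct isChainCoproduct_leftBar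
        (DirectSum.lof k ℕ (fun n => Cohomology k X n) q v)
        (DirectSum.lof k ℕ (fun n => Cohomology k X n) p u) := by
  obtain ⟨f, hf, hu⟩ := exists_eq_cls p u
  obtain ⟨g, hg, hv⟩ := exists_eq_cls q v
  rw [hu, hv, posCohomologyProduct_cls, posCohomologyProduct_cls, smul_cls]
  refine cls_eq_of_functional (s := p + q + 1) (by omega) (by omega) _ _
    (dualHomotopy k X (homBar k X) p q f g) ?_
  have h := functional_zinbielHomotopy p q f g
  have hf : coboundary k X (p + 1) f = 0 := hf
  have hg : coboundary k X (q + 1) g = 0 := hg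
  rw [hf, hg, map_zero, map_zero, LinearMap.zero_apply, map_zero, map_zero, smul_zero,
    add_zero, add_zero] at h
  rw [map_smul]
  exact h

theorem isZinbiel_posCohomologyProduct :
    IsZinbiel (posDegree fun n => Cohomology k X n)
      (posCohomologyProduct (isChainCoproduct_leftBar (k := k) (X := X)))
      (posCohomologyProduct (isChainCoproduct_rightBar (k := k) (X := X))) :=
  isZinbiel_of_lof (Q := fun n => Cohomology k X n)
    (t := posCohomologyProduct isChainCoproduct_comulBar)
    (fun _ _ => posCohomologyProduct_comulBar)
    (posCohomologyProduct_assoc _ _ _ _ isPlusCodendriform_Bbar.dendri_left)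
    (posCohomologyProduct_assoc _ _ _ _ isPlusCodendriform_Bbar.dendri_mid.symm)
    (posCohomologyProduct_assoc _ _ _ _ isPlusCodendriform_Bbar.dendri_right.symm)
    (fun p q u v => ⟨_, posCohomologyProduct_lof _ p q u v⟩)
    (fun p q u v => ⟨_, posCohomologyProduct_lof _ p q u v⟩)
    posCohomologyProduct_comm

end Cohomology

end

end RackZinbiel

theorem mainTheorem1 (k : Type*) [CommRing k] (X : Type*) [Shelf X] :
    Submodule.span k {b : B k X | ∃ as xs : List X, b = gxs k as * ges k xs} = ⊤ ∧
    ∃ L R h hb : B k X →ₗ[k] B k X ⊗[k] B k X,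
      (IsLeftHalf L ∧ IsRightHalf R ∧ IsHomotopyH h ∧ IsHomotopyBar h hb) ∧
      IsPlusCodendriform (deg k X) (comul k X) L R ∧
      ∃ Lbar Rbar hbar : Bbar k X →ₗ[k] Bbar k X ⊗[k] Bbar k X,
        (Lbar ∘ₗ proj k X = proj₂ k X ∘ₗ L ∧ Rbar ∘ₗ proj k X = proj₂ k X ∘ₗ R ∧
          hbar ∘ₗ proj k X = proj₂ k X ∘ₗ hb) ∧
        IsDGPlusCodendriform (degBar k X) (diffBar k X) (comulBar k X) Lbar Rbar ∧
        (∀ (x : X) (xs : List X), hbar (proj k X (ges k (x :: xs))) =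
          proj₂ k X ((GradedTensorProduct.of k (deg k X) (deg k X)).symm
            (-(tm 1 (ge k x) * GradedTensorProduct.of k (deg k X) (deg k X) (h (ges k xs)))))) ∧
        (∀ n, ∀ c ∈ degBar k X n, hbar c ∈ tensorDegree (degBar k X) (n + 1)) ∧
        (∀ c ∈ plus (degBar k X),
          leftD (diffBar k X) (hbar c) + rightD (degBar k X) (diffBar k X) (hbar c) +
            hbar (diffBar k X c) = Rbar c - signedFlip (degBar k X) (Lbar c)) ∧
        posProduct k X (comulBar k X) = posProduct k X Lbar + posProduct k X Rbar ∧
        IsDGDendriform (posDegree fun n => Cochain k X (n + 1)) (posCoboundary k X)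
          (posProduct k X Lbar) (posProduct k X Rbar) ∧
        IsZinbielHomotopy (posDegree fun n => Cochain k X (n + 1)) (posCoboundary k X)
          (posProduct k X Lbar) (posProduct k X Rbar) (posHomotopy k X hbar) ∧
        ∃ zl zr : PosCohomology k X →ₗ[k] PosCohomology k X →ₗ[k] PosCohomology k X,
          IsInducedProduct Lbar zl ∧ IsInducedProduct Rbar zr ∧
          IsZinbiel (posDegree fun n => Cohomology k X n) zl zr := by
  refine ⟨span_monomials, leftHalf k X, rightHalf k X, homotopyH k X, homotopyBar k X,
    ⟨isLeftHalf_leftHalf, isRightHalf_rightHalf, isHomotopyH_homotopyH,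
      isHomotopyBar_homotopyBar⟩, isPlusCodendriform_B, leftBar k X, rightBar k X, homBar k X,
    ⟨LinearMap.ext leftBar_proj, LinearMap.ext rightBar_proj, LinearMap.ext homBar_proj⟩,
    isDGPlusCodendriform_Bbar, fun x xs => homBar_ges x xs, fun _ _ => homBar_mem,
    fun c _ => tensorDiffBar_homBar c, posProduct_comulBar, isDGDendriform_posProduct,
    isZinbielHomotopy_posHomotopy, posCohomologyProduct isChainCoproduct_leftBar,
    posCohomologyProduct isChainCoproduct_rightBar, isInducedProduct_posCohomologyProduct _,
    isInducedProduct_posCohomologyProduct _, isZinbiel_posCohomologyProduct⟩
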